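/- Let $\lambda\in(0,\infty)$ and let $\mathbb P$ be the law of the Erdős–Rényi random graph $G_n=G(n,p_n)$ on $n$ vertices with $p_n=\lambda/n$. For a graph $G$ let $V_T(G)$ be the number of vertices of $G$ that lie in a triangle and $E(G)$ the number of edges. For $g\colon[0,1]\to\mathbb R$ let $\mathbb P_g$ be the exponential random graph model $$\frac{d\mathbb P_g}{d\mathbb P}=\frac1{Z_n(g)}\,e^{\,n\log n\; g(V_T(G_n)/n)},\qquad Z_n(g)=\mathbb E\big[e^{\,n\log n\; g(V_T(G_n)/n)}\big].$$ Suppose that $g$ is continuous and that all maximizers of $a\mapsto g(a)-\tfrac13a$ on $[0,1]$ lie in $(0,1)$, and let $a^\star$ be any of them. Then $$\lim_{n\to\infty}\frac1{n\log n}\log Z_n(g)=g(a^\star)-\tfrac13a^\star.$$ If, moreover, $a^\star$ is the unique maximizer, then, in probability under $\mathbb P_g$ as $n\to\infty$, $$\frac{V_T(G_n)}n\to a^\star\qquad\text{and}\qquad\frac{E(G_n)}n\to a^\star+\frac\lambda2 .$$ -/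

import Mathlib

open Filter Topology MeasureTheory

noncomputable section

namespace TriangleERGM

/-- `V_T(G)`: the number of vertices of `G` that are part of a triangle. -/
def verticesInTriangles {n : ℕ} (G : SimpleGraph (Fin n)) : ℕ :=
  {v : Fin n | ∃ u w : Fin n, G.Adj v u ∧ G.Adj u w ∧ G.Adj w v}.ncard

/-- `E(G)`: the number of edges of `G`. -/
def numEdges {n : ℕ} (G : SimpleGraph (Fin n)) : ℕ :=
  G.edgeSet.ncard

/-- The edge probability `p_n = lam / n`, as an element of `[0,1]` (truncated to `1` for the
finitely many `n < lam`). -/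
def edgeProb (lam : ℝ) (n : ℕ) : unitInterval :=
  Set.projIcc 0 1 zero_le_one (lam / n)

/-- The law of the Erdős–Rényi random graph `G(n, p_n)` with `p_n = lam / n`. -/
def erLaw (lam : ℝ) (n : ℕ) : Measure (SimpleGraph (Fin n)) :=
  SimpleGraph.binomialRandom (Fin n) (edgeProb lam n)

/-- The exponential weight `exp (n log n · g (V_T(G) / n))`. -/
def weight (g : ℝ → ℝ) (n : ℕ) (G : SimpleGraph (Fin n)) : ℝ :=
  Real.exp (n * Real.log n * g ((verticesInTriangles G : ℝ) / n))

/-- The partition function `Z_n(g)`, the expectation of the weight under the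
Erdős–Rényi law. -/
def partitionFunction (lam : ℝ) (g : ℝ → ℝ) (n : ℕ) : ℝ :=
  ∫ G, weight g n G ∂(erLaw lam n)

/-- The exponential random graph `P_g` on `n` vertices: the law whose density with respect to the
Erdős–Rényi law is `weight / Z_n(g)`. -/
def ergmLaw (lam : ℝ) (g : ℝ → ℝ) (n : ℕ) : Measure (SimpleGraph (Fin n)) :=
  (erLaw lam n).withDensity
    (fun G => ENNReal.ofReal (weight g n G / partitionFunction lam g n))

/-- `X_n(G_n) → c` in probability, where for each `n` the graph `G_n` has law `μ n`
(the laws live on different spaces, so no coupling is involved). -/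
def TendstoInProbability (μ : (n : ℕ) → Measure (SimpleGraph (Fin n)))
    (X : (n : ℕ) → SimpleGraph (Fin n) → ℝ) (c : ℝ) : Prop :=
  ∀ ε : ℝ, 0 < ε → Tendsto (fun n => μ n {G | ε ≤ |X n G - c|}) atTop (𝓝 0)

end TriangleERGM

end

/-!
The graph is treated as its random edge set `X`, a percolation with parameter `p = lam / n` on the
edges of the complete graph (`percProb`). The heart of the matter is that the number of vertices in
triangles satisfies `P (|triangleVerts X| = k) = n ^ (-k / 3)` up to factors `exp (O(n))`, so that
`Z_n` is a Laplace sum at speed `n log n` with rate function `x / 3`.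

*Lower bound* (`percProb_card_triangleVerts_ge`). There are about `n ^ (2k / 3)` graphs consisting
of `k / 3` disjoint triangles, each with `k` edges. Given that such a graph is present, Harris'
inequality bounds below the probability that no further triangle appears
(`percProb_no_more_triangles_ge`).

*Upper bound* (`percProb_card_triangleVerts_le`). If a vertex is attached to both ends of an edge of
an already chosen edge set of size `O(n)`, there are `O(n)` choices and two new edges, hence a
factor `O(n * p ^ 2) = O(1 / n)`; all other choices of edges together cost only
`(1 + p) ^ (n ^ 2) = exp (O(n))`. It therefore suffices to find, inside any graph, at least `k / 3`
attached vertices (`hasScaffold_triangleVerts`). Triangles are explored one at a time: a triangle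
disjoint from the explored set, or meeting it in one vertex, has a vertex attached to a base edge.
A triangle with just one new vertex attaches that vertex to an edge which may itself have been
created by an attachment; a two-colouring of these vertices, of which the larger colour class is
counted, removes the circularity. The count is larger than `k / 3` by a constant multiple of the
number of vertices whose triangle meets another triangle.

*Number of edges.* Since the weight depends only on the number of triangle vertices, it suffices to
control the number of edges given `|triangleVerts X| = k`, uniformly in `k`; as the bounds above
lose `exp (O(n))`, unlikely events must beat every such factor. By the surplus in the upper bound,
all but `O(n / log n)` triangle vertices lie in isolated triangles, where there are as many edges as
vertices; and to pack `δ n` edges into `O(n / log n)` vertices is superexponentially unlikely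
(`percProb_excess_le`, `eventually_percProb_excess_le`). So there are `k + o(n)` triangle edges. The
other edges are, given the triangle edges, a percolation conditioned to create no triangle; this
event has probability at least `exp (-o(n))`, because a graph with few more edges than vertices
has few paths of length two. Chernoff's bound then puts the number of other edges near `lam * n / 2`
(`percProb_triangleEdges_eq_and_deviation_le`).
-/

open scoped Classical

set_option linter.unusedSectionVars false

namespace TriangleERGM

/-! ### Bernoulli percolation on a finite set -/

section Percolation

variable {α : Type*} [DecidableEq α]

/-- The probability that the random subset of `E` containing each element independently with
probability `p` equals `X`. -/
noncomputable def percWeight (p : ℝ) (E X : Finset α) : ℝ :=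
  p ^ X.card * (1 - p) ^ (E.card - X.card)

/-- The probability that the random subset of `E` containing each element independently with
probability `p` satisfies `P`. -/
noncomputable def percProb (p : ℝ) (E : Finset α) (P : Finset α → Prop) : ℝ :=
  ∑ X ∈ E.powerset, if P X then percWeight p E X else 0

variable {p : ℝ} {E : Finset α}

lemma percWeight_nonneg (hp0 : 0 ≤ p) (hp1 : p ≤ 1) (X : Finset α) : 0 ≤ percWeight p E X :=
  mul_nonneg (pow_nonneg hp0 _) (pow_nonneg (by linarith) _)

lemma percProb_nonneg (hp0 : 0 ≤ p) (hp1 : p ≤ 1) (P : Finset α → Prop) :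
    0 ≤ percProb p E P :=
  Finset.sum_nonneg fun X _ => by
    split_ifs
    · exact percWeight_nonneg hp0 hp1 X
    · exact le_rfl

lemma percProb_mono (hp0 : 0 ≤ p) (hp1 : p ≤ 1) {P Q : Finset α → Prop}
    (h : ∀ X ⊆ E, P X → Q X) : percProb p E P ≤ percProb p E Q :=
  Finset.sum_le_sum fun X hX => by
    have := percWeight_nonneg (E := E) hp0 hp1 X
    have := h X (Finset.mem_powerset.1 hX)
    split_ifs <;> first | exact le_rfl | assumption | (exfalso; tauto)

lemma percProb_congr {P Q : Finset α → Prop} (h : ∀ X ⊆ E, (P X ↔ Q X)) :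
    percProb p E P = percProb p E Q :=
  Finset.sum_congr rfl fun X hX => by
    have := h X (Finset.mem_powerset.1 hX)
    simp only [this]

lemma sum_percWeight : ∑ X ∈ E.powerset, percWeight p E X = 1 := by
  have := Finset.sum_pow_mul_eq_add_pow p (1 - p) E
  simpa [percWeight] using this

lemma percProb_le_one (hp0 : 0 ≤ p) (hp1 : p ≤ 1) (P : Finset α → Prop) :
    percProb p E P ≤ 1 := by
  rw [← sum_percWeight (p := p) (E := E)]
  refine Finset.sum_le_sum fun X _ => ?_
  split_ifs
  · exact le_rfl
  · exact percWeight_nonneg hp0 hp1 X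

lemma percProb_or_le (hp0 : 0 ≤ p) (hp1 : p ≤ 1) (P Q : Finset α → Prop) :
    percProb p E (fun X => P X ∨ Q X) ≤ percProb p E P + percProb p E Q := by
  rw [percProb, percProb, percProb, ← Finset.sum_add_distrib]
  refine Finset.sum_le_sum fun X _ => ?_
  have := percWeight_nonneg (E := E) hp0 hp1 X
  by_cases h1 : P X <;> by_cases h2 : Q X <;> simp [h1, h2, this]

lemma percProb_exists_le (hp0 : 0 ≤ p) (hp1 : p ≤ 1) {ι : Type*} (s : Finset ι)
    (P : ι → Finset α → Prop) :
    percProb p E (fun X => ∃ i ∈ s, P i X) ≤ ∑ i ∈ s, percProb p E (P i) := by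
  simp only [percProb]
  rw [Finset.sum_comm]
  refine Finset.sum_le_sum fun X _ => ?_
  have hw := percWeight_nonneg (E := E) hp0 hp1 X
  have hn : ∀ i ∈ s, 0 ≤ (if P i X then percWeight p E X else 0) := fun i _ => by
    split_ifs <;> simp [hw]
  split_ifs with h
  · obtain ⟨i, hi, hP⟩ := h
    refine le_trans ?_ (Finset.single_le_sum hn hi)
    simp [hP]
  · exact Finset.sum_nonneg hn

/-- Decomposition of a probability over the values of a random variable. -/
lemma percProb_eq_sum {ι : Type*} (s : Finset ι) (f : Finset α → ι)
    (P : Finset α → Prop) (h : ∀ X ⊆ E, P X → f X ∈ s) :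
    percProb p E P = ∑ i ∈ s, percProb p E (fun X => P X ∧ f X = i) := by
  simp only [percProb]
  rw [Finset.sum_comm]
  refine Finset.sum_congr rfl fun X hX => ?_
  by_cases hP : P X
  · have := h X (Finset.mem_powerset.1 hX) hP
    simp [hP, this]
  · simp [hP]

/-- Conditioning on a set `H` of open elements: the remaining elements form an independent
percolation on `E \ H`. -/
lemma percProb_superset {H : Finset α} (hH : H ⊆ E) (P : Finset α → Prop) :
    percProb p E (fun X => H ⊆ X ∧ P X) =
      p ^ H.card * percProb p (E \ H) (fun R => P (H ∪ R)) := by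
  simp only [percProb]
  rw [Finset.mul_sum, ← Finset.sum_filter_add_sum_filter_not E.powerset (fun X => H ⊆ X)]
  rw [add_eq_left.2 (Finset.sum_eq_zero fun X hX => by simp [(Finset.mem_filter.1 hX).2])]
  refine Finset.sum_nbij' (fun X => X \ H) (fun R => H ∪ R) ?_ ?_ ?_ ?_ ?_
  · intro X hX
    simp only [Finset.mem_filter, Finset.mem_powerset] at hX ⊢
    exact Finset.sdiff_subset_sdiff hX.1 le_rfl
  · intro R hR
    simp only [Finset.mem_filter, Finset.mem_powerset] at hR ⊢
    exact ⟨Finset.union_subset hH (hR.trans Finset.sdiff_subset), Finset.subset_union_left⟩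
  · intro X hX
    exact Finset.union_sdiff_of_subset (Finset.mem_filter.1 hX).2
  · intro R hR
    simp only [Finset.mem_powerset] at hR
    have : Disjoint H R := Finset.disjoint_left.2 fun a ha hR' =>
      (Finset.mem_sdiff.1 (hR hR')).2 ha
    rw [Finset.union_sdiff_left, Finset.sdiff_eq_self_of_disjoint this.symm]
  · intro X hX
    simp only [Finset.mem_filter, Finset.mem_powerset] at hX
    simp only [Finset.union_sdiff_of_subset hX.2, hX.2, true_and]
    split_ifs
    · have h1 := Finset.card_sdiff_add_card_eq_card hX.2
      have h2 := Finset.card_sdiff_add_card_eq_card hH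
      have h3 := Finset.card_le_card hX.1
      rw [percWeight, percWeight, ← mul_assoc, ← pow_add]
      congr 2 <;> omega
    · simp

lemma percProb_subset_le (hp0 : 0 ≤ p) (hp1 : p ≤ 1) (K : Finset α) :
    percProb p E (fun X => K ⊆ X) ≤ p ^ K.card := by
  by_cases hK : K ⊆ E
  · have := percProb_superset (p := p) hK (fun _ => True)
    simp only [and_true] at this
    rw [this]
    exact mul_le_of_le_one_right (pow_nonneg hp0 _) (percProb_le_one hp0 hp1 _)
  · have : percProb p E (fun X => K ⊆ X) = 0 :=
      Finset.sum_eq_zero fun X hX => if_neg fun h => hK (h.trans (Finset.mem_powerset.1 hX))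
    rw [this]
    exact pow_nonneg hp0 _

/-- Union bound over the sets of a finite family being contained in the random set. -/
lemma percProb_exists_subset_le (hp0 : 0 ≤ p) (hp1 : p ≤ 1) (𝒦 : Finset (Finset α)) :
    percProb p E (fun X => ∃ K ∈ 𝒦, K ⊆ X) ≤ ∑ K ∈ 𝒦, p ^ K.card :=
  (percProb_exists_le hp0 hp1 𝒦 _).trans
    (Finset.sum_le_sum fun K _ => percProb_subset_le hp0 hp1 K)

lemma percProb_add_not (P : Finset α → Prop) :
    percProb p E P + percProb p E (fun X => ¬ P X) = 1 := by
  rw [← sum_percWeight (p := p) (E := E), percProb, percProb, ← Finset.sum_add_distrib]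
  refine Finset.sum_congr rfl fun X _ => ?_
  by_cases h : P X <;> simp [h]

/-- The exponential moments of the size of the random set. -/
lemma sum_percWeight_mul_exp (t : ℝ) :
    ∑ X ∈ E.powerset, percWeight p E X * Real.exp (t * X.card) =
      (p * Real.exp t + (1 - p)) ^ E.card := by
  rw [← Finset.sum_pow_mul_eq_add_pow]
  refine Finset.sum_congr rfl fun X _ => ?_
  rw [percWeight, mul_pow, ← Real.exp_nat_mul, mul_comm t]
  ring

/-- Exponential Markov inequality for the size of the random set; `t` may have either sign. -/
lemma percProb_exp_le (hp0 : 0 ≤ p) (hp1 : p ≤ 1) (t x : ℝ) :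
    percProb p E (fun X => t * x ≤ t * X.card) ≤
      Real.exp (E.card * (p * (Real.exp t - 1)) - t * x) := by
  have h1 : percProb p E (fun X => t * x ≤ t * X.card) ≤
      ∑ X ∈ E.powerset, percWeight p E X * Real.exp (t * X.card) * Real.exp (-(t * x)) := by
    refine Finset.sum_le_sum fun X _ => ?_
    have hw := percWeight_nonneg (E := E) hp0 hp1 X
    split_ifs with h
    · rw [mul_assoc, ← Real.exp_add]
      exact le_mul_of_one_le_right hw (Real.one_le_exp (by linarith))
    · positivity
  refine h1.trans ?_
  rw [← Finset.sum_mul, sum_percWeight_mul_exp, sub_eq_add_neg (_ * _), Real.exp_add,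
    Real.exp_nat_mul]
  refine mul_le_mul_of_nonneg_right ?_ (Real.exp_pos _).le
  refine pow_le_pow_left₀ ?_ ?_ _
  · have := Real.exp_pos t
    have : 0 ≤ p * Real.exp t := by positivity
    linarith
  · have := Real.add_one_le_exp (p * (Real.exp t - 1))
    linarith

/-- Harris' inequality for two decreasing events. -/
lemma percProb_inter_ge_of_antitone (hp0 : 0 ≤ p) (hp1 : p ≤ 1) {P Q : Finset α → Prop}
    (hP : ∀ X Y, X ⊆ Y → P Y → P X) (hQ : ∀ X Y, X ⊆ Y → Q Y → Q X) :
    percProb p E P * percProb p E Q ≤ percProb p E (fun X => P X ∧ Q X) := by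
  -- The FKG inequality is applied on the order dual of `Finset E`, a finite lattice on which
  -- decreasing events become increasing.
  let μ : (Finset E)ᵒᵈ → ℝ := fun X => p ^ (OrderDual.ofDual X).card *
    (1 - p) ^ (E.card - (OrderDual.ofDual X).card)
  let emb : Finset E → Finset α := fun X => X.map (Function.Embedding.subtype _)
  have key : ∀ R : Finset α → Prop, percProb p E R =
      ∑ X : (Finset E)ᵒᵈ, μ X * (if R (emb (OrderDual.ofDual X)) then 1 else 0) := by
    intro R
    rw [percProb]
    refine Finset.sum_nbij' (fun X => OrderDual.toDual (X.subtype (· ∈ E)))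
      (fun X => emb (OrderDual.ofDual X)) ?_ ?_ ?_ ?_ ?_
    · intro X _; exact Finset.mem_univ _
    · intro X _
      simp only [emb, Finset.mem_powerset]
      intro a ha
      simp only [Finset.mem_map, Function.Embedding.subtype_apply] at ha
      obtain ⟨b, _, rfl⟩ := ha
      exact b.2
    · intro X hX
      simp only [emb, OrderDual.ofDual_toDual]
      ext a
      have := Finset.mem_powerset.1 hX
      simp only [Finset.mem_map, Function.Embedding.subtype_apply, Finset.mem_subtype]
      constructor
      · rintro ⟨b, hb, rfl⟩; exact hb
      · intro ha; exact ⟨⟨a, this ha⟩, ha, rfl⟩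
    · intro X _
      apply OrderDual.ofDual.injective
      simp only [emb, OrderDual.ofDual_toDual]
      ext a
      simp
    · intro X hX
      have hX' := Finset.mem_powerset.1 hX
      have h1 : emb (X.subtype (· ∈ E)) = X := by
        ext a
        simp only [emb, Finset.mem_map, Function.Embedding.subtype_apply, Finset.mem_subtype]
        constructor
        · rintro ⟨b, hb, rfl⟩; exact hb
        · intro ha; exact ⟨⟨a, hX' ha⟩, ha, rfl⟩
      have h2 : (X.subtype (· ∈ E)).card = X.card := by
        conv_rhs => rw [← h1]
        simp [emb]
      simp only [μ, OrderDual.ofDual_toDual, h1, h2, percWeight]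
      split_ifs <;> simp
  have hmon : ∀ R : Finset α → Prop, (∀ X Y, X ⊆ Y → R Y → R X) →
      Monotone (fun X : (Finset E)ᵒᵈ => if R (emb (OrderDual.ofDual X)) then (1 : ℝ) else 0) := by
    intro R hR X Y hXY
    have hsub : emb (OrderDual.ofDual Y) ⊆ emb (OrderDual.ofDual X) :=
      Finset.map_subset_map.2 (OrderDual.ofDual_le_ofDual.2 hXY)
    have := hR _ _ hsub
    dsimp only
    split_ifs <;> first | exact le_rfl | exact zero_le_one | (exfalso; tauto)
  have hnn : ∀ R : Finset α → Prop,
      (0 : (Finset E)ᵒᵈ → ℝ) ≤ fun X => if R (emb (OrderDual.ofDual X)) then (1 : ℝ) else 0 := by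
    intro R X
    dsimp only [Pi.zero_apply]
    split_ifs <;> simp
  have hp1' : 0 ≤ 1 - p := by linarith
  have := fkg (μ := μ) (f := fun X => if P (emb (OrderDual.ofDual X)) then (1 : ℝ) else 0)
    (g := fun X => if Q (emb (OrderDual.ofDual X)) then (1 : ℝ) else 0)
    (fun X => by simp only [Pi.zero_apply, μ]; positivity) (hnn P) (hnn Q) (hmon P hP) (hmon Q hQ)
    (fun A B => by
      simp only [μ]
      have h1 := Finset.card_union_add_card_inter (OrderDual.ofDual A) (OrderDual.ofDual B)
      have hc : ∀ D : Finset E, D.card ≤ E.card := fun D => by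
        simpa using Finset.card_le_univ D
      have h2 := hc (OrderDual.ofDual A ∪ OrderDual.ofDual B)
      have h3 := hc (OrderDual.ofDual A)
      have h4 := hc (OrderDual.ofDual B)
      have h5 := hc (OrderDual.ofDual A ∩ OrderDual.ofDual B)
      have e1 : OrderDual.ofDual (A ⊓ B) = OrderDual.ofDual A ∪ OrderDual.ofDual B := by
        ext; simp
      have e2 : OrderDual.ofDual (A ⊔ B) = OrderDual.ofDual A ∩ OrderDual.ofDual B := by
        ext; simp
      rw [e1, e2, mul_mul_mul_comm, ← pow_add, ← pow_add, mul_mul_mul_comm, ← pow_add, ← pow_add]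
      apply le_of_eq
      congr 2 <;> omega)
  have hone : ∑ X : (Finset E)ᵒᵈ, μ X = 1 := by
    have := key (fun _ => True)
    simp only [if_true, mul_one] at this
    rw [← this, percProb]
    simp only [if_true]
    exact sum_percWeight
  rw [← key P, ← key Q, hone, one_mul] at this
  rw [key (fun X => P X ∧ Q X)]
  refine this.trans (le_of_eq (Finset.sum_congr rfl fun X _ => ?_))
  by_cases h1 : P (emb (OrderDual.ofDual X)) <;> by_cases h2 : Q (emb (OrderDual.ofDual X)) <;>
    simp [h1, h2]

/-- Harris' inequality: the probability of containing none of the sets `A t` is at least the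
product of the individual probabilities. -/
lemma percProb_avoid_ge (hp0 : 0 ≤ p) (hp1 : p ≤ 1) {ι : Type*} (T : Finset ι)
    (A : ι → Finset α) :
    ∏ t ∈ T, (1 - p ^ (A t).card) ≤ percProb p E (fun X => ∀ t ∈ T, ¬ A t ⊆ X) := by
  induction T using Finset.induction_on with
  | empty =>
    have := sum_percWeight (p := p) (E := E)
    simp [percProb, this]
  | insert a T ha ih =>
    rw [Finset.prod_insert ha]
    have h1 : 1 - p ^ (A a).card ≤ percProb p E (fun X => ¬ A a ⊆ X) := by
      have := percProb_add_not (p := p) (E := E) (fun X => A a ⊆ X)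
      have := percProb_subset_le (E := E) hp0 hp1 (A a)
      linarith
    have h2 : 0 ≤ ∏ t ∈ T, (1 - p ^ (A t).card) :=
      Finset.prod_nonneg fun t _ => by
        have := pow_le_one₀ hp0 hp1 (n := (A t).card); linarith
    have h3 := percProb_inter_ge_of_antitone (E := E) hp0 hp1 (P := fun X => ¬ A a ⊆ X)
      (Q := fun X => ∀ t ∈ T, ¬ A t ⊆ X) (fun X Y h hY hX => hY (hX.trans h))
      (fun X Y h hY t ht hX => hY t ht (hX.trans h))
    calc _ ≤ percProb p E (fun X => ¬ A a ⊆ X) * percProb p E (fun X => ∀ t ∈ T, ¬ A t ⊆ X) :=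
          mul_le_mul h1 ih h2 (percProb_nonneg hp0 hp1 _)
      _ ≤ _ := h3
      _ = _ := percProb_congr fun X _ => by simp

lemma exp_neg_two_mul_le {x : ℝ} (h0 : 0 ≤ x) (h1 : x ≤ 1 / 2) : Real.exp (-2 * x) ≤ 1 - x := by
  have h2 : Real.exp (-2 * x) * Real.exp (2 * x) = 1 := by
    rw [← Real.exp_add]; simp
  have h3 := Real.add_one_le_exp (2 * x)
  have h4 : 1 ≤ (1 - x) * (2 * x + 1) := by nlinarith
  have h5 := Real.exp_pos (2 * x)
  have h6 : (1 - x) * (2 * x + 1) ≤ (1 - x) * Real.exp (2 * x) :=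
    mul_le_mul_of_nonneg_left h3 (by linarith)
  exact le_of_mul_le_mul_right (by linarith) h5

/-- Harris' inequality in exponential form, for nonempty sets and `p ≤ 1 / 2`. -/
lemma percProb_avoid_ge_exp (hp0 : 0 ≤ p) (hp1 : p ≤ 1 / 2) {ι : Type*} (T : Finset ι)
    (A : ι → Finset α) (hA : ∀ t ∈ T, (A t).Nonempty) :
    Real.exp (-2 * ∑ t ∈ T, p ^ (A t).card) ≤
      percProb p E (fun X => ∀ t ∈ T, ¬ A t ⊆ X) := by
  refine le_trans ?_ (percProb_avoid_ge hp0 (by linarith) T A)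
  rw [Finset.mul_sum, Real.exp_sum]
  refine Finset.prod_le_prod (fun t _ => (Real.exp_pos _).le) fun t ht => ?_
  refine exp_neg_two_mul_le (pow_nonneg hp0 _) (le_trans ?_ hp1)
  exact pow_le_of_le_one hp0 (by linarith) (Finset.card_ne_zero.2 (hA t ht))

end Percolation

lemma sum_biUnion_le_sum {ι α : Type*} [DecidableEq α] (s : Finset ι) (t : ι → Finset α)
    {f : α → ℝ} (hf : ∀ x, 0 ≤ f x) : ∑ x ∈ s.biUnion t, f x ≤ ∑ i ∈ s, ∑ x ∈ t i, f x := by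
  induction s using Finset.induction_on with
  | empty => simp
  | insert a s ha ih =>
    rw [Finset.biUnion_insert, Finset.sum_insert ha]
    have h := Finset.sum_union_inter (s₁ := t a) (s₂ := s.biUnion t) (f := f)
    have h' : 0 ≤ ∑ x ∈ t a ∩ s.biUnion t, f x := Finset.sum_nonneg fun x _ => hf x
    linarith

/-! ### Counting edge sets obtained by attaching vertices to edges -/

section Attachment

variable {V : Type*} [DecidableEq V]

/-- The edges joining each vertex `y` of `B` to both ends of the pair `φ y`. -/
def attachEdges (B : Finset V) (φ : V → V × V) : Finset (Sym2 V) :=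
  B.biUnion fun y => {s(y, (φ y).1), s(y, (φ y).2)}

/-- `K'` arises from the edge set `K` by joining each of `b` vertices to both ends of an edge of
`K`, so that each of them closes a triangle. The `2 * b` edges added are distinct and not
in `K`, which is what the cardinality records. -/
def IsAttachment (K K' : Finset (Sym2 V)) (b : ℕ) : Prop :=
  ∃ (B : Finset V) (φ : V → V × V), B.card = b ∧ (∀ y ∈ B, s((φ y).1, (φ y).2) ∈ K) ∧
    K' = K ∪ attachEdges B φ ∧ K'.card = K.card + 2 * b

variable [Fintype V]

lemma card_orderedPairs_le (K : Finset (Sym2 V)) :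
    (Finset.univ.filter fun q : V × V => s(q.1, q.2) ∈ K).card ≤ 2 * K.card := by
  refine Finset.card_le_mul_card_image_of_maps_to (f := fun q : V × V => s(q.1, q.2))
    (fun q hq => (Finset.mem_filter.1 hq).2) 2 ?_
  intro e _
  induction e using Sym2.ind with
  | _ x y =>
    refine (Finset.card_le_card (t := {(x, y), (y, x)}) ?_).trans Finset.card_le_two
    intro q hq
    have := (Finset.mem_filter.1 hq).2
    simp only [Sym2.eq_iff] at this
    simp only [Finset.mem_insert, Finset.mem_singleton, Prod.ext_iff]
    exact this

lemma card_attachments_le (K : Finset (Sym2 V)) (b : ℕ) :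
    (Finset.univ.filter fun K' => IsAttachment K K' b).card ≤
      2 ^ Fintype.card V * (2 * K.card) ^ b := by
  set D : Finset (V × V) := Finset.univ.filter fun q => s(q.1, q.2) ∈ K with hD
  set S : Finset ((_ : Finset V) × (V → V × V)) :=
    (Finset.powersetCard b Finset.univ).sigma
      fun B => Fintype.piFinset fun v => if v ∈ B then D else {(v, v)} with hS
  have hsub : (Finset.univ.filter fun K' => IsAttachment K K' b) ⊆
      S.image fun z => K ∪ attachEdges z.1 z.2 := by
    intro K' hK'
    obtain ⟨B, φ, hB, hφ, rfl, -⟩ := (Finset.mem_filter.1 hK').2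
    refine Finset.mem_image.2 ⟨⟨B, fun v => if v ∈ B then φ v else (v, v)⟩, ?_, ?_⟩
    · simp only [hS, Finset.mem_sigma, Finset.mem_powersetCard, Finset.subset_univ, true_and,
        Fintype.mem_piFinset]
      refine ⟨hB, fun v => ?_⟩
      by_cases hv : v ∈ B
      · simpa [hv, hD] using hφ v hv
      · simp [hv]
    · congr 1
      refine Finset.biUnion_congr rfl fun y hy => ?_
      simp [hy]
  refine (Finset.card_le_card hsub).trans (Finset.card_image_le.trans ?_)
  rw [hS, Finset.card_sigma]
  have h1 : ∀ B ∈ Finset.powersetCard b (Finset.univ : Finset V),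
      (Fintype.piFinset fun v => if v ∈ B then D else {(v, v)}).card ≤ (2 * K.card) ^ b := by
    intro B hB
    rw [Fintype.card_piFinset]
    have : ∀ v, (if v ∈ B then D else {(v, v)}).card = if v ∈ B then D.card else 1 := by
      intro v; split_ifs <;> simp
    simp only [this]
    rw [Finset.prod_ite_mem, Finset.univ_inter, Finset.prod_const,
      (Finset.mem_powersetCard.1 hB).2]
    exact Nat.pow_le_pow_left (card_orderedPairs_le K) b
  refine (Finset.sum_le_card_nsmul _ _ _ h1).trans ?_
  rw [smul_eq_mul]
  refine Nat.mul_le_mul_right _ ?_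
  have : (Finset.powersetCard b (Finset.univ : Finset V)) ⊆ Finset.univ.powerset :=
    fun B _ => Finset.mem_powerset.2 (Finset.subset_univ _)
  simpa using Finset.card_le_card this

lemma sum_pow_card_attachments_le {p : ℝ} (hp0 : 0 ≤ p) (𝒦 : Finset (Finset (Sym2 V))) {m : ℕ}
    (hm : ∀ K ∈ 𝒦, K.card ≤ m) (b : ℕ) :
    ∑ K' with ∃ K ∈ 𝒦, IsAttachment K K' b, p ^ K'.card ≤
      2 ^ Fintype.card V * (2 * m * p ^ 2) ^ b * ∑ K ∈ 𝒦, p ^ K.card := by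
  have h1 : (Finset.univ.filter fun K' => ∃ K ∈ 𝒦, IsAttachment K K' b) =
      𝒦.biUnion fun K => Finset.univ.filter fun K' => IsAttachment K K' b := by
    ext K'; simp
  rw [h1]
  refine (sum_biUnion_le_sum _ _ fun _ => by positivity).trans ?_
  rw [Finset.mul_sum]
  refine Finset.sum_le_sum fun K hK => ?_
  have h2 : ∀ K' ∈ Finset.univ.filter fun K' => IsAttachment K K' b,
      p ^ K'.card = p ^ (K.card + 2 * b) := by
    intro K' hK'
    obtain ⟨_, _, _, _, _, h⟩ := (Finset.mem_filter.1 hK').2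
    rw [h]
  rw [Finset.sum_congr rfl h2, Finset.sum_const, nsmul_eq_mul]
  have h3 : ((Finset.univ.filter fun K' => IsAttachment K K' b).card : ℝ) ≤
      2 ^ Fintype.card V * (2 * m) ^ b := by
    have h4 := card_attachments_le K b
    have h5 : 2 ^ Fintype.card V * (2 * K.card) ^ b ≤ 2 ^ Fintype.card V * (2 * m) ^ b :=
      Nat.mul_le_mul_left _ (Nat.pow_le_pow_left (Nat.mul_le_mul_left _ (hm K hK)) b)
    exact_mod_cast h4.trans h5
  calc _ ≤ (2 ^ Fintype.card V * (2 * m) ^ b) * p ^ (K.card + 2 * b) := by gcongr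
    _ = _ := by rw [pow_add, mul_pow (2 * (m : ℝ)), pow_mul]; ring

/-- Union bound for two successive attachments to an edge set from the family `𝒦`. -/
lemma percProb_attach_attach_le {p : ℝ} (hp0 : 0 ≤ p) (hp1 : p ≤ 1) (E : Finset (Sym2 V))
    (𝒦 : Finset (Finset (Sym2 V))) {m : ℕ} (hm : ∀ K ∈ 𝒦, K.card ≤ m) (b a : ℕ) :
    percProb p E (fun X => ∃ K ∈ 𝒦, ∃ K₁ K₂, IsAttachment K K₁ b ∧ IsAttachment K₁ K₂ a ∧
      K₂ ⊆ X) ≤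
      4 ^ Fintype.card V * (2 * m * p ^ 2) ^ b * (2 * (m + 2 * b : ℕ) * p ^ 2) ^ a *
        ∑ K ∈ 𝒦, p ^ K.card := by
  set 𝒦₁ : Finset (Finset (Sym2 V)) := Finset.univ.filter fun K' => ∃ K ∈ 𝒦, IsAttachment K K' b
  have hm₁ : ∀ K ∈ 𝒦₁, K.card ≤ m + 2 * b := by
    intro K' hK'
    obtain ⟨K, hK, _, _, _, _, _, h⟩ := (Finset.mem_filter.1 hK').2
    rw [h]
    exact Nat.add_le_add_right (hm K hK) _
  have h1 := sum_pow_card_attachments_le hp0 𝒦 hm b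
  have h2 := sum_pow_card_attachments_le hp0 𝒦₁ hm₁ a
  refine (percProb_mono hp0 hp1 ?_).trans
    ((percProb_exists_subset_le hp0 hp1
      (Finset.univ.filter fun K' => ∃ K ∈ 𝒦₁, IsAttachment K K' a)).trans (h2.trans ?_))
  · rintro X - ⟨K, hK, K₁, K₂, h₁, h₂, hX⟩
    exact ⟨K₂, Finset.mem_filter.2 ⟨Finset.mem_univ _, K₁,
      Finset.mem_filter.2 ⟨Finset.mem_univ _, K, hK, h₁⟩, h₂⟩, hX⟩
  · calc _ ≤ 2 ^ Fintype.card V * (2 * (m + 2 * b : ℕ) * p ^ 2) ^ a *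
          (2 ^ Fintype.card V * (2 * m * p ^ 2) ^ b * ∑ K ∈ 𝒦, p ^ K.card) := by
          refine mul_le_mul_of_nonneg_left h1 (by positivity)
      _ = _ := by
          rw [show (4 : ℝ) = 2 * 2 by norm_num, mul_pow (2 : ℝ) 2]; ring

/-- Summed over all edge sets, the weight `p ^ |F|` costs only a factor exponential in the
number of vertices when `p` is of order `1 / n`. -/
lemma sum_pow_card_le_exp {p : ℝ} (hp0 : 0 ≤ p) (𝒦 : Finset (Finset (Sym2 V))) :
    ∑ F ∈ 𝒦, p ^ F.card ≤ Real.exp (p * (Fintype.card V) ^ 2) := by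
  have h1 := Finset.sum_pow_mul_eq_add_pow p 1 (Finset.univ : Finset (Sym2 V))
  simp only [one_pow, mul_one, Finset.powerset_univ, Finset.card_univ, Sym2.card] at h1
  refine (Finset.sum_le_sum_of_subset_of_nonneg (Finset.subset_univ 𝒦)
    fun _ _ _ => by positivity).trans ?_
  rw [h1]
  have h2 : p + 1 ≤ Real.exp p := Real.add_one_le_exp p
  refine (pow_le_pow_left₀ (by positivity) h2 _).trans ?_
  rw [← Real.exp_nat_mul, mul_comm]
  refine Real.exp_le_exp.2 (mul_le_mul_of_nonneg_left ?_ hp0)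
  have h3 : (Fintype.card V + 1).choose 2 ≤ Fintype.card V ^ 2 := by
    rw [Nat.choose_two_right, Nat.add_sub_cancel]
    refine Nat.div_le_of_le_mul ?_
    nlinarith [Nat.le_self_pow (n := 2) two_ne_zero (Fintype.card V)]
  exact_mod_cast h3

end Attachment

/-! ### Covering the triangles of a graph by attachments -/

section Scaffold

variable {V : Type*} [DecidableEq V]

/-- The pairs `xy`, `yz`, `zx` all belong to the edge set `X`. -/
def IsTriangle (X : Finset (Sym2 V)) (x y z : V) : Prop :=
  s(x, y) ∈ X ∧ s(y, z) ∈ X ∧ s(z, x) ∈ X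

lemma IsTriangle.rotate {X : Finset (Sym2 V)} {x y z : V} (h : IsTriangle X x y z) :
    IsTriangle X y z x := ⟨h.2.1, h.2.2, h.1⟩

lemma IsTriangle.flip {X : Finset (Sym2 V)} {x y z : V} (h : IsTriangle X x y z) :
    IsTriangle X x z y :=
  ⟨Sym2.eq_swap ▸ h.2.2, Sym2.eq_swap ▸ h.2.1, Sym2.eq_swap ▸ h.1⟩

lemma IsTriangle.mono {X Y : Finset (Sym2 V)} (hXY : X ⊆ Y) {x y z : V}
    (h : IsTriangle X x y z) : IsTriangle Y x y z := ⟨hXY h.1, hXY h.2.1, hXY h.2.2⟩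

/-- No element of `X` is a loop. -/
def Loopless (X : Finset (Sym2 V)) : Prop := ∀ e ∈ X, ¬ e.IsDiag

lemma Loopless.ne {X : Finset (Sym2 V)} (hX : Loopless X) {x y : V} (h : s(x, y) ∈ X) : x ≠ y :=
  fun e => hX _ h (by simpa using e)

lemma card_attachEdges_le (B : Finset V) (φ : V → V × V) :
    (attachEdges B φ).card ≤ 2 * B.card := by
  rw [mul_comm]
  exact Finset.card_biUnion_le_card_mul _ _ _ fun y _ => Finset.card_le_two

lemma attachEdges_insert_update (B : Finset V) (φ : V → V × V) {y : V} (hy : y ∉ B)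
    (q : V × V) : attachEdges (insert y B) (Function.update φ y q) =
      {s(y, q.1), s(y, q.2)} ∪ attachEdges B φ := by
  rw [attachEdges, Finset.biUnion_insert, Function.update_self, attachEdges]
  congr 1
  refine Finset.biUnion_congr rfl fun v hv => ?_
  rw [Function.update_of_ne (ne_of_mem_of_not_mem hv hy)]

lemma attachEdges_update (B : Finset V) (φ : V → V × V) {y : V} (hy : y ∉ B)
    (q : V × V) : attachEdges B (Function.update φ y q) = attachEdges B φ := by
  refine Finset.biUnion_congr rfl fun v hv => ?_
  rw [Function.update_of_ne (ne_of_mem_of_not_mem hv hy)]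

lemma left_mem_attachEdges {B : Finset V} {φ : V → V × V} {y : V} (hy : y ∈ B) :
    s(y, (φ y).1) ∈ attachEdges B φ :=
  Finset.mem_biUnion.2 ⟨y, hy, by simp⟩

/-- A scaffold of the edge set `X` on the vertex set `C`: base edges `F`, vertices `B` attached to
base edges, and vertices `A₀`, `A₁` of two colours, each attached to an edge not created by the
attachment of a vertex of its own colour. The edges created by all these attachments are
distinct and are not base edges. -/
structure Scaffold (X : Finset (Sym2 V)) (C : Finset V) (F : Finset (Sym2 V))
    (B A₀ A₁ : Finset V) (φ : V → V × V) : Prop where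
  subset : F ∪ attachEdges B φ ∪ attachEdges A₀ φ ∪ attachEdges A₁ φ ⊆ X
  mem : ∀ e ∈ F ∪ attachEdges B φ ∪ attachEdges A₀ φ ∪ attachEdges A₁ φ, ∀ v ∈ e, v ∈ C
  pick : ∀ y ∈ B, s((φ y).1, (φ y).2) ∈ F
  pick₀ : ∀ y ∈ A₀, s((φ y).1, (φ y).2) ∈ F ∪ attachEdges B φ ∪ attachEdges A₁ φ
  pick₁ : ∀ y ∈ A₁, s((φ y).1, (φ y).2) ∈ F ∪ attachEdges B φ ∪ attachEdges A₀ φ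
  card : (F ∪ attachEdges B φ ∪ attachEdges A₀ φ ∪ attachEdges A₁ φ).card =
    F.card + 2 * (B.card + A₀.card + A₁.card)

variable {X : Finset (Sym2 V)} {C : Finset V} {F : Finset (Sym2 V)}
    {B A₀ A₁ : Finset V} {φ : V → V × V}

lemma Scaffold.swap (h : Scaffold X C F B A₀ A₁ φ) : Scaffold X C F B A₁ A₀ φ := by
  have e : F ∪ attachEdges B φ ∪ attachEdges A₁ φ ∪ attachEdges A₀ φ =
      F ∪ attachEdges B φ ∪ attachEdges A₀ φ ∪ attachEdges A₁ φ := Finset.union_right_comm _ _ _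
  refine ⟨e ▸ h.subset, e ▸ h.mem, h.pick, h.pick₁, h.pick₀, ?_⟩
  rw [e, h.card]; ring

lemma Scaffold.mem_B (h : Scaffold X C F B A₀ A₁ φ) {y : V} (hy : y ∈ B) : y ∈ C :=
  h.mem s(y, (φ y).1) (by simp [left_mem_attachEdges hy]) y (Sym2.mem_mk_left _ _)

lemma Scaffold.mem_A₀ (h : Scaffold X C F B A₀ A₁ φ) {y : V} (hy : y ∈ A₀) : y ∈ C :=
  h.mem s(y, (φ y).1) (by simp [left_mem_attachEdges hy]) y (Sym2.mem_mk_left _ _)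

lemma Scaffold.mem_A₁ (h : Scaffold X C F B A₀ A₁ φ) {y : V} (hy : y ∈ A₁) : y ∈ C :=
  h.swap.mem_A₀ hy

lemma scaffold_empty (X : Finset (Sym2 V)) (φ : V → V × V) : Scaffold X ∅ ∅ ∅ ∅ ∅ φ := by
  refine ⟨?_, ?_, ?_, ?_, ?_, ?_⟩ <;> simp [attachEdges]

lemma Scaffold.mono (h : Scaffold X C F B A₀ A₁ φ) {C' : Finset V} (hC : C ⊆ C') :
    Scaffold X C' F B A₀ A₁ φ :=
  ⟨h.subset, fun e he v hv => hC (h.mem e he v hv), h.pick, h.pick₀, h.pick₁, h.card⟩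

/-- Adding a base edge. -/
lemma Scaffold.insert_base (h : Scaffold X C F B A₀ A₁ φ) {u v : V} (huv : s(u, v) ∈ X)
    (hu : u ∈ C) (hv : v ∈ C)
    (hn : s(u, v) ∉ F ∪ attachEdges B φ ∪ attachEdges A₀ φ ∪ attachEdges A₁ φ) :
    Scaffold X C (insert s(u, v) F) B A₀ A₁ φ := by
  have e : insert s(u, v) F ∪ attachEdges B φ ∪ attachEdges A₀ φ ∪ attachEdges A₁ φ =
      insert s(u, v) (F ∪ attachEdges B φ ∪ attachEdges A₀ φ ∪ attachEdges A₁ φ) := by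
    simp only [Finset.insert_union]
  have hF : s(u, v) ∉ F := fun h' => hn (by simp [h'])
  refine ⟨?_, ?_, ?_, ?_, ?_, ?_⟩
  · rw [e]; exact Finset.insert_subset huv h.subset
  · rw [e]
    intro f hf w hw
    rcases Finset.mem_insert.1 hf with rfl | hf
    · rcases Sym2.mem_iff.1 hw with rfl | rfl <;> assumption
    · exact h.mem f hf w hw
  · exact fun y hy => Finset.mem_insert_of_mem (h.pick y hy)
  · intro y hy
    simp only [Finset.insert_union]
    exact Finset.mem_insert_of_mem (h.pick₀ y hy)
  · intro y hy
    simp only [Finset.insert_union]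
    exact Finset.mem_insert_of_mem (h.pick₁ y hy)
  · rw [e, Finset.card_insert_of_notMem hn, Finset.card_insert_of_notMem hF, h.card]; ring

lemma card_pair_union_of_notMem {T : Finset (Sym2 V)} (hT : ∀ e ∈ T, ∀ v ∈ e, v ∈ C) {y x z : V}
    (hy : y ∉ C) (hxz : x ≠ z) : ({s(y, x), s(y, z)} ∪ T : Finset (Sym2 V)).card = T.card + 2 := by
  have hd : Disjoint ({s(y, x), s(y, z)} : Finset (Sym2 V)) T := by
    rw [Finset.disjoint_left]
    intro e he heT
    refine hy (hT e heT y ?_)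
    simp only [Finset.mem_insert, Finset.mem_singleton] at he
    rcases he with rfl | rfl <;> exact Sym2.mem_mk_left _ _
  rw [Finset.card_union_of_disjoint hd, Finset.card_pair fun h => hxz (Sym2.congr_right.1 h),
    add_comm]

lemma Scaffold.insert_B (h : Scaffold X C F B A₀ A₁ φ) {x y z : V} (hy : y ∉ C) (hx : x ∈ C)
    (hz : z ∈ C) (hxz : x ≠ z) (hT : IsTriangle X x y z) (hF : s(x, z) ∈ F) :
    Scaffold X (insert y C) F (insert y B) A₀ A₁ (Function.update φ y (x, z)) := by
  have hB : y ∉ B := fun h' => hy (h.mem_B h')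
  have h0 : y ∉ A₀ := fun h' => hy (h.mem_A₀ h')
  have h1 : y ∉ A₁ := fun h' => hy (h.mem_A₁ h')
  have e : F ∪ ({s(y, x), s(y, z)} ∪ attachEdges B φ) ∪ attachEdges A₀ φ ∪ attachEdges A₁ φ =
      {s(y, x), s(y, z)} ∪ (F ∪ attachEdges B φ ∪ attachEdges A₀ φ ∪ attachEdges A₁ φ) := by
    ext; simp only [Finset.mem_union]; tauto
  have hup : ∀ v ≠ y, Function.update φ y (x, z) v = φ v := fun v hv =>
    Function.update_of_ne hv _ _
  constructor
  · rw [attachEdges_insert_update _ _ hB, attachEdges_update _ _ h0, attachEdges_update _ _ h1, e]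
    refine Finset.union_subset ?_ h.subset
    intro f hf
    simp only [Finset.mem_insert, Finset.mem_singleton] at hf
    rcases hf with rfl | rfl
    · exact Sym2.eq_swap ▸ hT.1
    · exact hT.2.1
  · rw [attachEdges_insert_update _ _ hB, attachEdges_update _ _ h0, attachEdges_update _ _ h1, e]
    intro f hf w hw
    rcases Finset.mem_union.1 hf with hf | hf
    · simp only [Finset.mem_insert, Finset.mem_singleton] at hf
      rcases hf with rfl | rfl <;> rcases Sym2.mem_iff.1 hw with rfl | rfl <;> simp [hx, hz]
    · exact Finset.mem_insert_of_mem (h.mem f hf w hw)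
  · intro v hv
    rcases Finset.mem_insert.1 hv with rfl | hv
    · simpa using hF
    · rw [hup v (ne_of_mem_of_not_mem hv hB)]; exact h.pick v hv
  · intro v hv
    rw [hup v (ne_of_mem_of_not_mem hv h0), attachEdges_insert_update _ _ hB,
      attachEdges_update _ _ h1]
    have := h.pick₀ v hv
    simp only [Finset.mem_union] at this ⊢
    tauto
  · intro v hv
    rw [hup v (ne_of_mem_of_not_mem hv h1), attachEdges_insert_update _ _ hB,
      attachEdges_update _ _ h0]
    have := h.pick₁ v hv
    simp only [Finset.mem_union] at this ⊢
    tauto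
  · rw [attachEdges_insert_update _ _ hB, attachEdges_update _ _ h0, attachEdges_update _ _ h1, e,
      card_pair_union_of_notMem h.mem hy hxz, h.card, Finset.card_insert_of_notMem hB]
    ring

lemma Scaffold.insert_A₀ (h : Scaffold X C F B A₀ A₁ φ) {x y z : V} (hy : y ∉ C) (hx : x ∈ C)
    (hz : z ∈ C) (hxz : x ≠ z) (hT : IsTriangle X x y z)
    (hF : s(x, z) ∈ F ∪ attachEdges B φ ∪ attachEdges A₁ φ) :
    Scaffold X (insert y C) F B (insert y A₀) A₁ (Function.update φ y (x, z)) := by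
  have hB : y ∉ B := fun h' => hy (h.mem_B h')
  have h0 : y ∉ A₀ := fun h' => hy (h.mem_A₀ h')
  have h1 : y ∉ A₁ := fun h' => hy (h.mem_A₁ h')
  have e : F ∪ attachEdges B φ ∪ ({s(y, x), s(y, z)} ∪ attachEdges A₀ φ) ∪ attachEdges A₁ φ =
      {s(y, x), s(y, z)} ∪ (F ∪ attachEdges B φ ∪ attachEdges A₀ φ ∪ attachEdges A₁ φ) := by
    ext; simp only [Finset.mem_union]; tauto
  have hup : ∀ v ≠ y, Function.update φ y (x, z) v = φ v := fun v hv =>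
    Function.update_of_ne hv _ _
  constructor
  · rw [attachEdges_insert_update _ _ h0, attachEdges_update _ _ hB, attachEdges_update _ _ h1, e]
    refine Finset.union_subset ?_ h.subset
    intro f hf
    simp only [Finset.mem_insert, Finset.mem_singleton] at hf
    rcases hf with rfl | rfl
    · exact Sym2.eq_swap ▸ hT.1
    · exact hT.2.1
  · rw [attachEdges_insert_update _ _ h0, attachEdges_update _ _ hB, attachEdges_update _ _ h1, e]
    intro f hf w hw
    rcases Finset.mem_union.1 hf with hf | hf
    · simp only [Finset.mem_insert, Finset.mem_singleton] at hf
      rcases hf with rfl | rfl <;> rcases Sym2.mem_iff.1 hw with rfl | rfl <;> simp [hx, hz]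
    · exact Finset.mem_insert_of_mem (h.mem f hf w hw)
  · intro v hv
    rw [hup v (ne_of_mem_of_not_mem hv hB)]; exact h.pick v hv
  · intro v hv
    rw [attachEdges_update _ _ hB, attachEdges_update _ _ h1]
    rcases Finset.mem_insert.1 hv with rfl | hv
    · simpa using hF
    · rw [hup v (ne_of_mem_of_not_mem hv h0)]; exact h.pick₀ v hv
  · intro v hv
    rw [hup v (ne_of_mem_of_not_mem hv h1), attachEdges_insert_update _ _ h0,
      attachEdges_update _ _ hB]
    have := h.pick₁ v hv
    simp only [Finset.mem_union] at this ⊢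
    tauto
  · rw [attachEdges_insert_update _ _ h0, attachEdges_update _ _ hB, attachEdges_update _ _ h1, e,
      card_pair_union_of_notMem h.mem hy hxz, h.card, Finset.card_insert_of_notMem h0]
    ring

/-- A base edge with at least one new end, followed by a vertex attached to it. -/
lemma Scaffold.insert_triangle (h : Scaffold X C F B A₀ A₁ φ) (hX : Loopless X) {u v w : V}
    (hT : IsTriangle X u v w) (hv : v ∉ C) (hw : w ∉ C) :
    ∃ φ', Scaffold X (insert w (insert v (insert u C))) (insert s(u, v) F) (insert w B) A₀ A₁ φ'
      ∧ s(u, v) ∉ F := by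
  have hn : s(u, v) ∉ F ∪ attachEdges B φ ∪ attachEdges A₀ φ ∪ attachEdges A₁ φ :=
    fun h' => hv (h.mem _ h' v (Sym2.mem_mk_right _ _))
  have h2 := (h.mono (C' := insert v (insert u C))
    ((Finset.subset_insert _ _).trans (Finset.subset_insert _ _))).insert_base (u := u) (v := v)
    hT.1 (by simp) (by simp) hn
  have hwu : w ≠ u := hX.ne hT.2.2
  have hwv : w ≠ v := (hX.ne hT.2.1).symm
  have h3 := h2.insert_B (x := u) (y := w) (z := v) (by simp [hwu, hwv, hw]) (by simp) (by simp)
    (hX.ne hT.1) hT.flip (by simp)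
  exact ⟨_, h3, fun h' => hn (by simp [h'])⟩

/-- A single vertex attached to an edge inside `C`; the colour is chosen so that this edge was not
created by a vertex of the same colour. -/
lemma Scaffold.insert_single (h : Scaffold X C F B A₀ A₁ φ) (hX : Loopless X) {x y z : V}
    (hT : IsTriangle X x y z) (hy : y ∉ C) (hx : x ∈ C) (hz : z ∈ C) :
    ∃ F' A₀' A₁' φ', Scaffold X (insert y C) F' B A₀' A₁' φ' ∧ F'.card ≤ F.card + 1 ∧
      A₀'.card + A₁'.card = A₀.card + A₁.card + 1 := by
  have hxz : x ≠ z := (hX.ne hT.2.2).symm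
  have h0 : y ∉ A₀ := fun h' => hy (h.mem_A₀ h')
  have h1 : y ∉ A₁ := fun h' => hy (h.mem_A₁ h')
  by_cases hm : s(x, z) ∈ F ∪ attachEdges B φ ∪ attachEdges A₁ φ
  · exact ⟨F, _, A₁, _, h.insert_A₀ hy hx hz hxz hT hm, by omega, by
      rw [Finset.card_insert_of_notMem h0]; ring⟩
  by_cases hm' : s(x, z) ∈ F ∪ attachEdges B φ ∪ attachEdges A₀ φ
  · exact ⟨F, A₀, _, _, (h.swap.insert_A₀ hy hx hz hxz hT hm').swap, by omega, by
      rw [Finset.card_insert_of_notMem h1]; ring⟩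
  have hn : s(x, z) ∉ F ∪ attachEdges B φ ∪ attachEdges A₀ φ ∪ attachEdges A₁ φ := by
    simp only [Finset.mem_union] at hm hm' ⊢; tauto
  have h2 := h.insert_base (Sym2.eq_swap ▸ hT.2.2) hx hz hn
  exact ⟨_, _, A₁, _, h2.insert_A₀ hy hx hz hxz hT (by simp), Finset.card_insert_le _ _, by
      rw [Finset.card_insert_of_notMem h0]; ring⟩

/-- Reading off two successive attachments from a scaffold: the edges created by the
vertices of one colour are added to the base. -/
lemma Scaffold.isAttachment (h : Scaffold X C F B A₀ A₁ φ) :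
    IsAttachment (F ∪ attachEdges A₁ φ) (F ∪ attachEdges A₁ φ ∪ attachEdges B φ) B.card ∧
    IsAttachment (F ∪ attachEdges A₁ φ ∪ attachEdges B φ)
      (F ∪ attachEdges A₁ φ ∪ attachEdges B φ ∪ attachEdges A₀ φ) A₀.card ∧
    F ∪ attachEdges A₁ φ ∪ attachEdges B φ ∪ attachEdges A₀ φ ⊆ X ∧
    (F ∪ attachEdges A₁ φ).card ≤ F.card + 2 * A₁.card := by
  have e : F ∪ attachEdges A₁ φ ∪ attachEdges B φ ∪ attachEdges A₀ φ =
      F ∪ attachEdges B φ ∪ attachEdges A₀ φ ∪ attachEdges A₁ φ := by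
    ext; simp only [Finset.mem_union]; tauto
  have c := h.card
  rw [← e] at c
  have c0 := card_attachEdges_le A₀ φ
  have c1 := card_attachEdges_le A₁ φ
  have cB := card_attachEdges_le B φ
  have u1 := Finset.card_union_le F (attachEdges A₁ φ)
  have u2 := Finset.card_union_le (F ∪ attachEdges A₁ φ) (attachEdges B φ)
  have u3 := Finset.card_union_le (F ∪ attachEdges A₁ φ ∪ attachEdges B φ) (attachEdges A₀ φ)
  refine ⟨⟨B, φ, rfl, ?_, rfl, by omega⟩, ⟨A₀, φ, rfl, ?_, rfl, by omega⟩, e ▸ h.subset, by omega⟩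
  · intro y hy
    exact Finset.mem_union_left _ (h.pick y hy)
  · intro y hy
    have := h.pick₀ y hy
    simp only [Finset.mem_union] at this ⊢
    tauto

variable [Fintype V]

/-- The vertices lying in a triangle of `X`. -/
noncomputable def triangleVerts (X : Finset (Sym2 V)) : Finset V :=
  Finset.univ.filter fun x => ∃ y z, IsTriangle X x y z

/-- The vertices whose triangle shares no vertex with any other triangle of `X`. -/
noncomputable def isolatedVerts (X : Finset (Sym2 V)) : Finset V :=
  Finset.univ.filter fun x => ∃ y z, IsTriangle X x y z ∧
    ∀ u ∈ ({x, y, z} : Finset V), ∀ v w, IsTriangle X u v w → v ∈ ({x, y, z} : Finset V)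

lemma mem_triangleVerts {x : V} : x ∈ triangleVerts X ↔ ∃ y z, IsTriangle X x y z := by
  simp [triangleVerts]

lemma isolatedVerts_subset : isolatedVerts X ⊆ triangleVerts X := by
  intro x hx
  obtain ⟨y, z, h, _⟩ := (Finset.mem_filter.1 hx).2
  exact mem_triangleVerts.2 ⟨y, z, h⟩

lemma IsTriangle.mem_triangleVerts {x y z : V} (h : IsTriangle X x y z) :
    x ∈ triangleVerts X ∧ y ∈ triangleVerts X ∧ z ∈ triangleVerts X :=
  ⟨TriangleERGM.mem_triangleVerts.2 ⟨_, _, h⟩, TriangleERGM.mem_triangleVerts.2 ⟨_, _, h.rotate⟩,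
    TriangleERGM.mem_triangleVerts.2 ⟨_, _, h.rotate.rotate⟩⟩

lemma IsTriangle.mem_isolatedVerts {x y z : V} (h : IsTriangle X x y z)
    (hi : ∀ u ∈ ({x, y, z} : Finset V), ∀ v w, IsTriangle X u v w → v ∈ ({x, y, z} : Finset V)) :
    x ∈ isolatedVerts X ∧ y ∈ isolatedVerts X ∧ z ∈ isolatedVerts X := by
  have e1 : ({y, z, x} : Finset V) = {x, y, z} := by ext; simp; tauto
  have e2 : ({z, x, y} : Finset V) = {x, y, z} := by ext; simp; tauto
  refine ⟨?_, ?_, ?_⟩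
  · exact Finset.mem_filter.2 ⟨Finset.mem_univ _, y, z, h, hi⟩
  · exact Finset.mem_filter.2 ⟨Finset.mem_univ _, z, x, h.rotate, by rw [e1]; exact hi⟩
  · exact Finset.mem_filter.2 ⟨Finset.mem_univ _, x, y, h.rotate.rotate, by rw [e2]; exact hi⟩

/-- A scaffold on `C` whose number of attachments, with the coloured vertices counting one half, is
at least `|C| / 3 + |C \ isolatedVerts X| / 24`, up to a deficit of `d / 24`. The half accounts for
discarding one of the two colours. -/
def HasScaffold (X : Finset (Sym2 V)) (C : Finset V) (d : ℕ) : Prop :=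
  C ⊆ triangleVerts X ∧ ∃ F B A₀ A₁ φ, Scaffold X C F B A₀ A₁ φ ∧ F.card ≤ C.card ∧
    8 * C.card + (C \ isolatedVerts X).card ≤ 24 * B.card + 12 * (A₀.card + A₁.card) + d

lemma card_insert_sdiff_le (C I : Finset V) (y : V) :
    (insert y C \ I).card ≤ (C \ I).card + 1 := by
  refine (Finset.card_le_card (t := insert y (C \ I)) ?_).trans (Finset.card_insert_le _ _)
  intro v hv
  simp only [Finset.mem_sdiff, Finset.mem_insert] at hv ⊢
  tauto

lemma HasScaffold.insert_single {d : ℕ} (h : HasScaffold X C d) (hd : d ≤ 3) (hX : Loopless X)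
    {x y z : V} (hT : IsTriangle X x y z) (hy : y ∉ C) (hx : x ∈ C) (hz : z ∈ C) :
    HasScaffold X (insert y C) 0 := by
  obtain ⟨hC, F, B, A₀, A₁, φ, hS, hF, hc⟩ := h
  obtain ⟨F', A₀', A₁', φ', hS', hF', hA⟩ := hS.insert_single hX hT hy hx hz
  refine ⟨Finset.insert_subset hT.mem_triangleVerts.2.1 hC, F', B, A₀', A₁', φ', hS', ?_, ?_⟩
  · rw [Finset.card_insert_of_notMem hy]; omega
  · have := card_insert_sdiff_le C (isolatedVerts X) y
    rw [Finset.card_insert_of_notMem hy]; omega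

lemma HasScaffold.insert_pair {d : ℕ} (h : HasScaffold X C d) (hd : d ≤ 3) (hX : Loopless X)
    {x y z : V} (hT : IsTriangle X x y z) (hx : x ∈ C) (hy : y ∉ C) (hz : z ∉ C) :
    HasScaffold X (insert z (insert y C)) 0 := by
  obtain ⟨hC, F, B, A₀, A₁, φ, hS, hF, hc⟩ := h
  obtain ⟨φ', hS', hF'⟩ := hS.insert_triangle hX hT hy hz
  rw [Finset.insert_eq_of_mem hx] at hS'
  have hzB : z ∉ B := fun h' => hz (hS.mem_B h')
  have hzy : z ∉ insert y C := by
    simp [hz, (hX.ne hT.2.1).symm]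
  refine ⟨Finset.insert_subset hT.mem_triangleVerts.2.2
    (Finset.insert_subset hT.mem_triangleVerts.2.1 hC), _, _, A₀, A₁, φ', hS', ?_, ?_⟩
  · rw [Finset.card_insert_of_notMem hzy, Finset.card_insert_of_notMem hy,
      Finset.card_insert_of_notMem hF']
    omega
  · have h1 := card_insert_sdiff_le C (isolatedVerts X) y
    have h2 := card_insert_sdiff_le (insert y C) (isolatedVerts X) z
    rw [Finset.card_insert_of_notMem hzy, Finset.card_insert_of_notMem hy,
      Finset.card_insert_of_notMem hzB]
    omega

lemma card_insert_three (hX : Loopless X) {u v w : V} (hT : IsTriangle X u v w) (hu : u ∉ C)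
    (hv : v ∉ C) (hw : w ∉ C) : (insert w (insert v (insert u C))).card = C.card + 3 := by
  rw [Finset.card_insert_of_notMem (by simp [hw, hX.ne hT.2.2, (hX.ne hT.2.1).symm]),
    Finset.card_insert_of_notMem (by simp [hv, (hX.ne hT.1).symm]),
    Finset.card_insert_of_notMem hu]

/-- Starting a new triangle leaves a deficit of `3`, unless the triangle is isolated. The deficit is
made up by the first extension of the triangle. -/
lemma HasScaffold.insert_start (h : HasScaffold X C 0) (hX : Loopless X)
    {u v w : V} (hT : IsTriangle X u v w) (hu : u ∉ C) (hv : v ∉ C) (hw : w ∉ C) :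
    HasScaffold X (insert w (insert v (insert u C))) 3 ∧
    (u ∈ isolatedVerts X → v ∈ isolatedVerts X → w ∈ isolatedVerts X →
      HasScaffold X (insert w (insert v (insert u C))) 0) := by
  obtain ⟨hC, F, B, A₀, A₁, φ, hS, hF, hc⟩ := h
  obtain ⟨φ', hS', hF'⟩ := hS.insert_triangle hX hT hv hw
  have hwB : w ∉ B := fun h' => hw (hS.mem_B h')
  have hsub : insert w (insert v (insert u C)) ⊆ triangleVerts X :=
    Finset.insert_subset hT.mem_triangleVerts.2.2
      (Finset.insert_subset hT.mem_triangleVerts.2.1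
        (Finset.insert_subset hT.mem_triangleVerts.1 hC))
  have hcard := card_insert_three hX hT hu hv hw
  have hFc : (insert s(u, v) F).card ≤ (insert w (insert v (insert u C))).card := by
    rw [hcard, Finset.card_insert_of_notMem hF']
    omega
  refine ⟨⟨hsub, _, _, A₀, A₁, φ', hS', hFc, ?_⟩,
    fun h1 h2 h3 => ⟨hsub, _, _, A₀, A₁, φ', hS', hFc, ?_⟩⟩
  · have h1 := card_insert_sdiff_le C (isolatedVerts X) u
    have h2 := card_insert_sdiff_le (insert u C) (isolatedVerts X) v
    have h3 := card_insert_sdiff_le (insert v (insert u C)) (isolatedVerts X) w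
    rw [hcard, Finset.card_insert_of_notMem hwB]
    omega
  · rw [hcard, Finset.card_insert_of_notMem hwB, Finset.insert_sdiff_of_mem _ h3,
      Finset.insert_sdiff_of_mem _ h2, Finset.insert_sdiff_of_mem _ h1]
    omega

/-- A scaffold with small deficit extends along any triangle that leaves `C`. -/
lemma HasScaffold.exists_extend {d : ℕ} (h : HasScaffold X C d) (hd : d ≤ 3) (hX : Loopless X)
    {x y z : V} (hT : IsTriangle X x y z) (hx : x ∈ C) (hy : y ∉ C) :
    ∃ C', HasScaffold X C' 0 ∧ C.card < C'.card := by
  by_cases hz : z ∈ C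
  · exact ⟨_, h.insert_single hd hX hT hy hx hz, by
      rw [Finset.card_insert_of_notMem hy]; omega⟩
  · refine ⟨_, h.insert_pair hd hX hT hx hy hz, ?_⟩
    rw [Finset.card_insert_of_notMem (by simp [hz, (hX.ne hT.2.1).symm]),
      Finset.card_insert_of_notMem hy]
    omega

/-- All vertices in triangles are covered by a scaffold of gain at least `1 / 3` per vertex, with a
surplus for the vertices whose triangle meets another triangle. -/
theorem hasScaffold_triangleVerts (hX : Loopless X) : HasScaffold X (triangleVerts X) 0 := by
  obtain ⟨C, hC, hmax⟩ := (Finset.univ.filter fun C => HasScaffold X C 0).exists_max_image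
    Finset.card ⟨∅, Finset.mem_filter.2 ⟨Finset.mem_univ _, Finset.empty_subset _, ∅, ∅, ∅, ∅,
      fun v => (v, v), scaffold_empty X _, le_rfl, by simp⟩⟩
  have hC := (Finset.mem_filter.1 hC).2
  have hno : ¬ ∃ C', HasScaffold X C' 0 ∧ C.card < C'.card := fun ⟨C', h', hlt⟩ =>
    absurd (hmax C' (Finset.mem_filter.2 ⟨Finset.mem_univ _, h'⟩)) (by omega)
  have hclosed : ∀ x y z, IsTriangle X x y z → x ∈ C → y ∈ C := fun x y z hT hx => by
    by_contra hy
    exact hno (hC.exists_extend (by omega) hX hT hx hy)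
  have hsub : triangleVerts X ⊆ C := by
    intro u hu
    by_contra hu'
    obtain ⟨v, w, hT⟩ := mem_triangleVerts.1 hu
    have hw' : w ∉ C := fun h' => hu' (hclosed _ _ _ hT.rotate.rotate h')
    have hv' : v ∉ C := fun h' => hw' (hclosed _ _ _ hT.rotate h')
    obtain ⟨h3, h0⟩ := hC.insert_start hX hT hu' hv' hw'
    have hcard := card_insert_three hX hT hu' hv' hw'
    by_cases hi : ∀ a ∈ ({u, v, w} : Finset V), ∀ b c, IsTriangle X a b c →
        b ∈ ({u, v, w} : Finset V)
    · obtain ⟨i1, i2, i3⟩ := hT.mem_isolatedVerts hi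
      exact hno ⟨_, h0 i1 i2 i3, by omega⟩
    -- Some triangle leaves `{u, v, w}`, and it avoids `C` because `C` is closed: the new start and
    -- its first extension together leave no deficit.
    · push Not at hi
      obtain ⟨a, ha, b, c, hab, hb⟩ := hi
      simp only [Finset.mem_insert, Finset.mem_singleton] at ha hb
      have haC : a ∈ insert w (insert v (insert u C)) := by
        simp only [Finset.mem_insert]; tauto
      have hbC : b ∉ insert w (insert v (insert u C)) := by
        have : b ∉ C := fun h' => by
          have haC' : a ∈ C := hclosed _ _ _ (hab.flip.rotate.rotate) h'
          rcases ha with rfl | rfl | rfl <;> contradiction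
        simp only [Finset.mem_insert]; tauto
      obtain ⟨C', hC', hlt⟩ := h3.exists_extend le_rfl hX hab haC hbC
      exact hno ⟨C', hC', by omega⟩
  rwa [← Finset.Subset.antisymm hC.1 hsub]

/-- The isolated triangles are covered by a scaffold of gain exactly `1 / 3` per vertex. -/
theorem exists_scaffold_isolatedVerts (hX : Loopless X) :
    ∃ F B φ, Scaffold X (isolatedVerts X) F B ∅ ∅ φ ∧ F.card ≤ (isolatedVerts X).card ∧
      3 * B.card = (isolatedVerts X).card := by
  let P : Finset V → Prop := fun C => C ⊆ isolatedVerts X ∧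
    (∀ x y z, IsTriangle X x y z → x ∈ C → y ∈ C) ∧
    ∃ F B φ, Scaffold X C F B ∅ ∅ φ ∧ F.card ≤ C.card ∧ 3 * B.card = C.card
  obtain ⟨C, hC, hmax⟩ := (Finset.univ.filter P).exists_max_image
    Finset.card ⟨∅, Finset.mem_filter.2 ⟨Finset.mem_univ _, Finset.empty_subset _, by simp, ∅, ∅,
      fun v => (v, v), scaffold_empty X _, le_rfl, by simp⟩⟩
  obtain ⟨hCI, hclosed, F, B, φ, hS, hF, hB⟩ := (Finset.mem_filter.1 hC).2
  have hsub : isolatedVerts X ⊆ C := by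
    intro u hu
    by_contra hu'
    obtain ⟨v, w, hT, hi⟩ := (Finset.mem_filter.1 hu).2
    have hw' : w ∉ C := fun h' => hu' (hclosed _ _ _ hT.rotate.rotate h')
    have hv' : v ∉ C := fun h' => hw' (hclosed _ _ _ hT.rotate h')
    obtain ⟨φ', hS', hF'⟩ := hS.insert_triangle hX hT hv' hw'
    have hcard := card_insert_three hX hT hu' hv' hw'
    have hwB : w ∉ B := fun h' => hw' (hS.mem_B h')
    obtain ⟨i1, i2, i3⟩ := hT.mem_isolatedVerts hi
    refine absurd (hmax (insert w (insert v (insert u C))) (Finset.mem_filter.2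
      ⟨Finset.mem_univ _, ?_, ?_, _, _, φ', hS', ?_, ?_⟩)) (by omega)
    · exact Finset.insert_subset i3 (Finset.insert_subset i2 (Finset.insert_subset i1 hCI))
    · intro x y z hxyz hx
      have : x ∈ C ∨ x ∈ ({u, v, w} : Finset V) := by
        simp only [Finset.mem_insert, Finset.mem_singleton] at hx ⊢; tauto
      rcases this with h' | h'
      · have := hclosed _ _ _ hxyz h'
        simp [this]
      · have := hi x h' y z hxyz
        simp only [Finset.mem_insert, Finset.mem_singleton] at this ⊢; tauto
    · rw [hcard, Finset.card_insert_of_notMem hF']; omega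
    · rw [hcard, Finset.card_insert_of_notMem hwB]; omega
  rw [← Finset.Subset.antisymm hCI hsub]
  exact ⟨F, B, φ, hS, hF, hB⟩

/-- The edges of `X` lying in a triangle of `X`. -/
noncomputable def triangleEdges (X : Finset (Sym2 V)) : Finset (Sym2 V) :=
  X.filter fun e => ∃ x y z, e = s(x, y) ∧ IsTriangle X x y z

lemma mem_triangleEdges {x y : V} :
    s(x, y) ∈ triangleEdges X ↔ ∃ z, IsTriangle X x y z := by
  simp only [triangleEdges, Finset.mem_filter]
  constructor
  · rintro ⟨-, a, b, c, he, h⟩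
    rcases Sym2.eq_iff.1 he with ⟨rfl, rfl⟩ | ⟨rfl, rfl⟩
    · exact ⟨c, h⟩
    · exact ⟨c, h.flip.rotate.rotate⟩
  · rintro ⟨z, h⟩
    exact ⟨h.1, x, y, z, rfl, h⟩

/-- In a disjoint union of triangles there are as many edges as vertices: each vertex is matched
with the opposite edge. -/
lemma card_triangleEdges_isolatedVerts_le (hX : Loopless X) :
    ((triangleEdges X).filter fun e => ∃ v ∈ e, v ∈ isolatedVerts X).card ≤
      (isolatedVerts X).card := by
  have hch : ∀ w : V, ∃ e : Sym2 V, w ∈ isolatedVerts X → ∀ x y, IsTriangle X w x y →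
      e = s(x, y) := by
    intro w
    by_cases hw : w ∈ isolatedVerts X
    · obtain ⟨y, z, hT, hi⟩ := (Finset.mem_filter.1 hw).2
      refine ⟨s(y, z), fun _ a b hab => ?_⟩
      have ha := hi w (by simp) a b hab
      have hb := hi w (by simp) b a hab.flip
      have n1 := hX.ne hab.1
      have n2 := hX.ne hab.2.1
      have n3 := hX.ne hab.2.2
      simp only [Finset.mem_insert, Finset.mem_singleton] at ha hb
      rw [Sym2.eq_iff]
      rcases ha with rfl | rfl | rfl <;> rcases hb with rfl | rfl | rfl <;> simp_all
    · exact ⟨s(w, w), fun h => absurd h hw⟩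
  choose opp hopp using hch
  refine (Finset.card_le_card (t := (isolatedVerts X).image opp) ?_).trans Finset.card_image_le
  intro e he
  obtain ⟨he, v, hve, hv⟩ := Finset.mem_filter.1 he
  obtain ⟨u, rfl⟩ := Sym2.mem_iff_exists.1 hve
  obtain ⟨w, hT⟩ := mem_triangleEdges.1 he
  obtain ⟨y, z, hT', hi⟩ := (Finset.mem_filter.1 hv).2
  have hw : w ∈ isolatedVerts X := by
    have h1 := hi v (by simp) w u hT.flip
    obtain ⟨i1, i2, i3⟩ := hT'.mem_isolatedVerts hi
    simp only [Finset.mem_insert, Finset.mem_singleton] at h1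
    rcases h1 with rfl | rfl | rfl <;> assumption
  exact Finset.mem_image.2 ⟨w, hw, hopp w hw v u hT.rotate.rotate⟩

end Scaffold

/-! ### Upper bounds for the number of vertices in triangles -/

section UpperBound

variable {V : Type*} [DecidableEq V] [Fintype V]

lemma card_add_one_le_exp (n : ℕ) : (n : ℝ) + 1 ≤ Real.exp n := Real.add_one_le_exp _

lemma isAttachment_zero (K : Finset (Sym2 V)) [Nonempty V] : IsAttachment K K 0 :=
  ⟨∅, fun v => (v, v), by simp, by simp, by simp [attachEdges], by simp⟩

/-- With `p` of order `1 / n` and base edge sets of size `O(n)`, each attached vertex gains a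
factor `1 / n`. -/
lemma percProb_attach_attach_le_exp {lam p : ℝ} (hp0 : 0 ≤ p) (hp1 : p ≤ 1)
    (hV : 0 < Fintype.card V) (hp : p ≤ lam / Fintype.card V) (E : Finset (Sym2 V))
    (𝒦 : Finset (Finset (Sym2 V))) (hm : ∀ K ∈ 𝒦, K.card ≤ 4 * Fintype.card V) {b a : ℕ}
    (hb : b ≤ Fintype.card V) (ha : a ≤ Fintype.card V) :
    percProb p E (fun X => ∃ K ∈ 𝒦, ∃ K₁ K₂, IsAttachment K K₁ b ∧ IsAttachment K₁ K₂ a ∧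
      K₂ ⊆ X) ≤
      Real.exp ((24 * lam ^ 2 + 4) * Fintype.card V - (b + a) * Real.log (Fintype.card V)) *
        ∑ K ∈ 𝒦, p ^ K.card := by
  refine (percProb_attach_attach_le hp0 hp1 E 𝒦 hm b a).trans ?_
  refine mul_le_mul_of_nonneg_right ?_ (Finset.sum_nonneg fun _ _ => by positivity)
  set n := Fintype.card V
  have hn : (0 : ℝ) < n := by exact_mod_cast hV
  have hb' : (b : ℝ) ≤ n := by exact_mod_cast hb
  have ha' : (a : ℝ) ≤ n := by exact_mod_cast ha
  have hp2 : p ^ 2 * n ≤ lam ^ 2 / n := by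
    have : p ^ 2 ≤ (lam / n) ^ 2 := pow_le_pow_left₀ hp0 hp 2
    calc p ^ 2 * n ≤ (lam / n) ^ 2 * n := by gcongr
      _ = lam ^ 2 / n := by field_simp
  set M : ℝ := 12 * lam ^ 2 with hM
  have hMe : M / n ≤ Real.exp (M - Real.log n) := by
    rw [Real.exp_sub, Real.exp_log hn]
    have := Real.add_one_le_exp M
    gcongr; linarith
  have hdiv : M / n = 12 * (lam ^ 2 / n) := by rw [hM]; ring
  have hM0 : 0 ≤ M := by positivity
  have h0 : 0 ≤ lam ^ 2 / n := by positivity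
  have h1 : 2 * ((4 * n : ℕ) : ℝ) * p ^ 2 ≤ Real.exp (M - Real.log n) := by
    push_cast
    nlinarith
  have h2 : 2 * ((4 * n + 2 * b : ℕ) : ℝ) * p ^ 2 ≤ Real.exp (M - Real.log n) := by
    push_cast
    have : (b : ℝ) * p ^ 2 ≤ n * p ^ 2 := by gcongr
    nlinarith
  have h4 : (4 : ℝ) ^ n ≤ Real.exp (4 * n) := by
    rw [mul_comm, Real.exp_nat_mul]
    exact pow_le_pow_left₀ (by norm_num) (by linarith [Real.add_one_le_exp (4 : ℝ)]) _
  calc _ ≤ Real.exp (4 * n) * Real.exp (M - Real.log n) ^ b * Real.exp (M - Real.log n) ^ a := by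
        gcongr
    _ = Real.exp (4 * n + M * (b + a) - (b + a) * Real.log n) := by
        rw [← Real.exp_nat_mul, ← Real.exp_nat_mul, ← Real.exp_add, ← Real.exp_add]
        congr 1; ring
    _ ≤ _ := by
        refine Real.exp_le_exp.2 ?_
        have : M * (b + a) ≤ M * (n + n) := by gcongr
        rw [hM] at this ⊢
        linarith

/-- The probability that `k` vertices lie in triangles is at most `n ^ (-k / 3)` up to an
exponential factor, with an additional gain if many of these triangles are not isolated. -/
theorem percProb_card_triangleVerts_le {lam p : ℝ} (hp0 : 0 ≤ p) (hp1 : p ≤ 1)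
    (hV : 0 < Fintype.card V) (hp : p ≤ lam / Fintype.card V) {E : Finset (Sym2 V)}
    (hE : Loopless E) (k s : ℕ) :
    percProb p E (fun X => (triangleVerts X).card = k ∧
      s ≤ (triangleVerts X \ isolatedVerts X).card) ≤
      Real.exp ((24 * lam ^ 2 + lam + 6) * Fintype.card V -
        ((k : ℝ) / 3 + s / 24) * Real.log (Fintype.card V)) := by
  set n := Fintype.card V with hn
  have hnpos : (0 : ℝ) < n := by exact_mod_cast hV
  have hlog : 0 ≤ Real.log n := Real.log_nonneg (by exact_mod_cast hV)
  set 𝒦 : Finset (Finset (Sym2 V)) := Finset.univ.filter fun K => K.card ≤ 4 * n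
  set I : Finset (ℕ × ℕ) := ((Finset.range (n + 1)) ×ˢ (Finset.range (n + 1))).filter
    fun q => 8 * k + s ≤ 24 * (q.1 + q.2)
  have h1 : percProb p E (fun X => (triangleVerts X).card = k ∧
      s ≤ (triangleVerts X \ isolatedVerts X).card) ≤
      percProb p E (fun X => ∃ q ∈ I, ∃ K ∈ 𝒦, ∃ K₁ K₂, IsAttachment K K₁ q.1 ∧
        IsAttachment K₁ K₂ q.2 ∧ K₂ ⊆ X) := by
    refine percProb_mono hp0 hp1 ?_
    rintro X hXE ⟨hk, hs⟩
    have hX : Loopless X := fun e he => hE e (hXE he)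
    obtain ⟨-, F, B, A₀, A₁, φ, hS, hF, hc⟩ := hasScaffold_triangleVerts hX
    -- The more numerous colour is the one attached last.
    wlog hA : A₁.card ≤ A₀.card generalizing A₀ A₁
    · exact this A₁ A₀ hS.swap (by omega) (by omega)
    obtain ⟨ha1, ha2, hsub, hcard⟩ := hS.isAttachment
    have c1 : B.card ≤ n := Finset.card_le_univ _
    have c2 : A₀.card ≤ n := Finset.card_le_univ _
    have c3 : (triangleVerts X).card ≤ n := Finset.card_le_univ _
    have c4 : A₁.card ≤ n := Finset.card_le_univ _
    refine ⟨(B.card, A₀.card), ?_, _, ?_, _, _, ha1, ha2, hsub⟩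
    · simp only [I, Finset.mem_filter, Finset.mem_product, Finset.mem_range]
      omega
    · simp only [𝒦, Finset.mem_filter, Finset.mem_univ, true_and]
      omega
  refine h1.trans ((percProb_exists_le hp0 hp1 I _).trans ?_)
  have hsum : ∑ K ∈ 𝒦, p ^ K.card ≤ Real.exp (lam * n) := by
    refine (sum_pow_card_le_exp hp0 𝒦).trans (Real.exp_le_exp.2 ?_)
    calc p * (n : ℝ) ^ 2 ≤ lam / n * (n : ℝ) ^ 2 := by gcongr
      _ = lam * n := by field_simp
  have h2 : ∀ q ∈ I, percProb p E (fun X => ∃ K ∈ 𝒦, ∃ K₁ K₂, IsAttachment K K₁ q.1 ∧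
        IsAttachment K₁ K₂ q.2 ∧ K₂ ⊆ X) ≤
      Real.exp ((24 * lam ^ 2 + lam + 4) * n - ((k : ℝ) / 3 + s / 24) * Real.log n) := by
    intro q hq
    simp only [I, Finset.mem_filter, Finset.mem_product, Finset.mem_range] at hq
    obtain ⟨⟨q1, q2⟩, q3⟩ := hq
    refine (percProb_attach_attach_le_exp hp0 hp1 hV hp E 𝒦
      (fun K hK => (Finset.mem_filter.1 hK).2) (by omega) (by omega)).trans ?_
    refine (mul_le_mul_of_nonneg_left hsum (Real.exp_pos _).le).trans ?_
    rw [← Real.exp_add]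
    refine Real.exp_le_exp.2 ?_
    have h3 : (k : ℝ) / 3 + s / 24 ≤ q.1 + q.2 := by
      have : (8 * k + s : ℝ) ≤ 24 * (q.1 + q.2) := by exact_mod_cast q3
      linarith
    have := mul_le_mul_of_nonneg_right h3 hlog
    rw [← hn]
    linarith
  refine (Finset.sum_le_card_nsmul _ _ _ h2).trans ?_
  have hI : (I.card : ℝ) ≤ Real.exp (2 * n) := by
    have h3 : I.card ≤ (n + 1) * (n + 1) := by
      refine (Finset.card_filter_le _ _).trans ?_
      simp
    have h4 : (I.card : ℝ) ≤ (n + 1) * (n + 1) := by exact_mod_cast h3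
    have h5 := card_add_one_le_exp n
    calc (I.card : ℝ) ≤ (n + 1) * (n + 1) := h4
      _ ≤ Real.exp n * Real.exp n := by gcongr
      _ = Real.exp (2 * n) := by rw [← Real.exp_add]; congr 1; ring
  rw [nsmul_eq_mul]
  refine (mul_le_mul_of_nonneg_right hI (Real.exp_pos _).le).trans ?_
  rw [← Real.exp_add]
  exact Real.exp_le_exp.2 (by linarith)

lemma sum_image_le_sum {ι α : Type*} [DecidableEq α] (s : Finset ι) (t : ι → α)
    {f : α → ℝ} (hf : ∀ x, 0 ≤ f x) : ∑ x ∈ s.image t, f x ≤ ∑ i ∈ s, f (t i) := by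
  have h := sum_biUnion_le_sum s (fun i => {t i}) hf
  have e : (s.biUnion fun i => {t i}) = s.image t := by ext; simp [eq_comm]
  rw [e] at h
  simpa using h

/-- The base sets `F ∪ L` where `L` consists of `m` pairs inside a set of fewer than `s`
vertices. -/
noncomputable def clusteredBases (V : Type*) [DecidableEq V] [Fintype V] (s m : ℕ) :
    Finset (Finset (Sym2 V)) :=
  ((((Finset.univ : Finset (Finset (Sym2 V))).filter fun F => F.card ≤ Fintype.card V) ×ˢ
    (((Finset.univ : Finset (Finset V)).filter fun S => S.card + 1 ≤ s).sigma
      fun S => Finset.powersetCard m S.sym2)).filter fun q => Disjoint q.1 q.2.2).image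
    fun q => q.1 ∪ q.2.2

lemma card_sym2_le {S : Finset V} {s : ℕ} (h : S.card + 1 ≤ s) : S.sym2.card ≤ s ^ 2 := by
  rw [Finset.card_sym2, Nat.choose_two_right, Nat.add_sub_cancel]
  refine Nat.div_le_of_le_mul ?_
  nlinarith

lemma sum_clusteredBases_le {lam p : ℝ} (hp0 : 0 ≤ p)
    (hV : 0 < Fintype.card V) (hp : p ≤ lam / Fintype.card V) (s m : ℕ) :
    ∑ K ∈ clusteredBases V s m, p ^ K.card ≤ Real.exp ((lam + 1) * Fintype.card V) *
      (((s : ℝ) ^ 2 * lam / Fintype.card V) ^ m / m.factorial) := by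
  set n := Fintype.card V with hn
  have hnpos : (0 : ℝ) < n := by exact_mod_cast hV
  have hlam : 0 ≤ lam := by
    by_contra h
    have : lam / n < 0 := div_neg_of_neg_of_pos (by linarith) hnpos
    linarith
  set 𝒮 : Finset ((_ : Finset V) × Finset (Sym2 V)) :=
    ((Finset.univ : Finset (Finset V)).filter fun S => S.card + 1 ≤ s).sigma
      fun S => Finset.powersetCard m S.sym2 with h𝒮
  set 𝒦 : Finset (Finset (Sym2 V)) := Finset.univ.filter fun F => F.card ≤ n with h𝒦
  have hstep : ∑ K ∈ clusteredBases V s m, p ^ K.card ≤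
      ∑ q ∈ (𝒦 ×ˢ 𝒮).filter fun q => Disjoint q.1 q.2.2, p ^ (q.1 ∪ q.2.2).card :=
    sum_image_le_sum _ _ (f := fun K : Finset (Sym2 V) => p ^ K.card)
      fun K => pow_nonneg hp0 _
  have hstep2 : ∑ q ∈ (𝒦 ×ˢ 𝒮).filter (fun q => Disjoint q.1 q.2.2), p ^ (q.1 ∪ q.2.2).card ≤
      ∑ q ∈ 𝒦 ×ˢ 𝒮, p ^ q.1.card * p ^ q.2.2.card := by
    refine le_trans ?_ (Finset.sum_le_sum_of_subset_of_nonneg (Finset.filter_subset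
      (fun q : Finset (Sym2 V) × ((_ : Finset V) × Finset (Sym2 V)) => Disjoint q.1 q.2.2) _)
      fun _ _ _ => by positivity)
    refine Finset.sum_le_sum fun q hq => le_of_eq ?_
    rw [Finset.card_union_of_disjoint (Finset.mem_filter.1 hq).2, pow_add]
  refine hstep.trans (hstep2.trans ?_)
  have hprod : ∑ q ∈ 𝒦 ×ˢ 𝒮, p ^ q.1.card * p ^ q.2.2.card =
      (∑ F ∈ 𝒦, p ^ F.card) * ∑ z ∈ 𝒮, p ^ z.2.card := by
    rw [Finset.sum_product, Finset.sum_mul_sum]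
  rw [hprod, h𝒮, Finset.sum_sigma]
  have hsum : ∑ K ∈ 𝒦, p ^ K.card ≤ Real.exp (lam * n) := by
    refine (sum_pow_card_le_exp hp0 𝒦).trans (Real.exp_le_exp.2 ?_)
    calc p * (n : ℝ) ^ 2 ≤ lam / n * (n : ℝ) ^ 2 := by gcongr
      _ = lam * n := by field_simp
  have hS : ∀ S ∈ (Finset.univ : Finset (Finset V)).filter (fun S => S.card + 1 ≤ s),
      ∑ L ∈ Finset.powersetCard m S.sym2, p ^ L.card ≤
        ((s : ℝ) ^ 2 * lam / n) ^ m / m.factorial := by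
    intro S hS
    have hS' := (Finset.mem_filter.1 hS).2
    rw [Finset.sum_congr rfl fun L hL => by rw [(Finset.mem_powersetCard.1 hL).2],
      Finset.sum_const, Finset.card_powersetCard, nsmul_eq_mul]
    have h1 : ((S.sym2.card.choose m : ℕ) : ℝ) ≤ ((s : ℝ) ^ 2) ^ m / m.factorial := by
      refine (Nat.choose_le_pow_div m _).trans ?_
      have := card_sym2_le hS'
      gcongr
      exact_mod_cast this
    calc _ ≤ ((s : ℝ) ^ 2) ^ m / m.factorial * (lam / n) ^ m := by gcongr
      _ = _ := by rw [mul_div_assoc, mul_pow]; ring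
  have hS2 : ∑ S ∈ (Finset.univ : Finset (Finset V)).filter (fun S => S.card + 1 ≤ s),
      ∑ L ∈ Finset.powersetCard m S.sym2, p ^ L.card ≤
        Real.exp n * (((s : ℝ) ^ 2 * lam / n) ^ m / m.factorial) := by
    refine (Finset.sum_le_card_nsmul _ _ _ hS).trans ?_
    rw [nsmul_eq_mul]
    refine mul_le_mul_of_nonneg_right ?_ (by positivity)
    have h1 : ((Finset.univ : Finset (Finset V)).filter (fun S => S.card + 1 ≤ s)).card ≤
        2 ^ n := (Finset.card_filter_le _ _).trans (by simp [hn])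
    have h2 : (2 : ℝ) ^ n ≤ Real.exp n := by
      rw [← mul_one (n : ℝ), Real.exp_nat_mul]
      exact pow_le_pow_left₀ (by norm_num) (by linarith [Real.add_one_le_exp (1 : ℝ)]) _
    exact le_trans (by exact_mod_cast h1) h2
  refine (mul_le_mul hsum hS2 (Finset.sum_nonneg fun _ _ =>
    Finset.sum_nonneg fun _ _ => by positivity) (Real.exp_pos _).le).trans (le_of_eq ?_)
  rw [← mul_assoc, ← Real.exp_add]
  congr 2; ring

/-- The probability of having `m` more triangle edges than triangle vertices while fewer than `s`
vertices lie in non-isolated triangles: the excess edges are packed into `s` vertices. -/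
theorem percProb_excess_le {lam p : ℝ} (hp0 : 0 ≤ p) (hp1 : p ≤ 1)
    (hV : 0 < Fintype.card V) (hp : p ≤ lam / Fintype.card V) {E : Finset (Sym2 V)}
    (hE : Loopless E) {k s m : ℕ} (hm : m ≤ Fintype.card V) :
    percProb p E (fun X => (triangleVerts X).card = k ∧
      (triangleVerts X \ isolatedVerts X).card < s ∧ k + m ≤ (triangleEdges X).card) ≤
      Real.exp ((24 * lam ^ 2 + lam + 6) * Fintype.card V +
        ((s : ℝ) / 3 - k / 3) * Real.log (Fintype.card V)) *
        (((s : ℝ) ^ 2 * lam / Fintype.card V) ^ m / m.factorial) := by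
  set n := Fintype.card V with hn
  have hnpos : (0 : ℝ) < n := by exact_mod_cast hV
  have hlog : 0 ≤ Real.log n := Real.log_nonneg (by exact_mod_cast hV)
  have : Nonempty V := Fintype.card_pos_iff.1 hV
  set 𝒦 := clusteredBases V s m with h𝒦
  set I : Finset ℕ := (Finset.range (n + 1)).filter fun b => k ≤ 3 * b + s
  have h1 : percProb p E (fun X => (triangleVerts X).card = k ∧
      (triangleVerts X \ isolatedVerts X).card < s ∧ k + m ≤ (triangleEdges X).card) ≤
      percProb p E (fun X => ∃ b ∈ I, ∃ K ∈ 𝒦, ∃ K₁ K₂, IsAttachment K K₁ b ∧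
        IsAttachment K₁ K₂ 0 ∧ K₂ ⊆ X) := by
    refine percProb_mono hp0 hp1 ?_
    rintro X hXE ⟨hk, hs, hcard⟩
    have hX : Loopless X := fun e he => hE e (hXE he)
    obtain ⟨F, B, φ, hS, hF, hB⟩ := exists_scaffold_isolatedVerts hX
    obtain ⟨ha1, -, -, -⟩ := hS.isAttachment
    have hsub := hS.subset
    have hmem := hS.mem
    simp only [attachEdges, Finset.biUnion_empty, Finset.union_empty] at ha1 hsub hmem
    change IsAttachment F (F ∪ attachEdges B φ) B.card at ha1
    change F ∪ attachEdges B φ ⊆ X at hsub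
    change ∀ e ∈ F ∪ attachEdges B φ, _ at hmem
    have hsd := Finset.card_sdiff_add_card_eq_card (isolatedVerts_subset (X := X))
    set S := triangleVerts X \ isolatedVerts X with hSdef
    -- All but `|isolatedVerts X|` of the triangle edges lie inside `S`.
    have hin : (triangleEdges X).filter (fun e => ¬ ∃ v ∈ e, v ∈ isolatedVerts X) ⊆ S.sym2 := by
      intro e he
      obtain ⟨he, hno⟩ := Finset.mem_filter.1 he
      rw [Finset.mem_sym2_iff]
      intro v hv
      refine Finset.mem_sdiff.2 ⟨?_, fun h' => hno ⟨v, hv, h'⟩⟩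
      obtain ⟨u, rfl⟩ := Sym2.mem_iff_exists.1 hv
      obtain ⟨w, hT⟩ := mem_triangleEdges.1 he
      exact hT.mem_triangleVerts.1
    have hpart := Finset.card_filter_add_card_filter_not (s := triangleEdges X)
      (fun e => ∃ v ∈ e, v ∈ isolatedVerts X)
    have hiso := card_triangleEdges_isolatedVerts_le hX
    have hle := Finset.card_le_card (isolatedVerts_subset (X := X))
    have hL : m ≤ ((triangleEdges X).filter
        (fun e => ¬ ∃ v ∈ e, v ∈ isolatedVerts X)).card := by omega
    obtain ⟨L, hLsub, hLcard⟩ := Finset.exists_subset_card_eq hL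
    have hdisj : Disjoint (F ∪ attachEdges B φ) L := by
      rw [Finset.disjoint_left]
      intro e he heL
      refine (Finset.mem_filter.1 (hLsub heL)).2 ?_
      induction e using Sym2.ind with
      | _ x y => exact ⟨x, Sym2.mem_mk_left _ _, hmem _ he x (Sym2.mem_mk_left _ _)⟩
    have hdF : Disjoint F L := Finset.disjoint_of_subset_left Finset.subset_union_left hdisj
    have c1 : B.card ≤ n := Finset.card_le_univ _
    have c3 : (isolatedVerts X).card ≤ n := Finset.card_le_univ _
    refine ⟨B.card, ?_, F ∪ L, ?_, F ∪ attachEdges B φ ∪ L, F ∪ attachEdges B φ ∪ L, ?_,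
      isAttachment_zero _, ?_⟩
    · simp only [I, Finset.mem_filter, Finset.mem_range]
      omega
    · refine Finset.mem_image.2 ⟨(F, ⟨S, L⟩), ?_, rfl⟩
      simp only [Finset.mem_filter, Finset.mem_product, Finset.mem_univ, true_and,
        Finset.mem_sigma, Finset.mem_powersetCard]
      exact ⟨⟨by omega, by omega, hLsub.trans hin, hLcard⟩, hdF⟩
    · obtain ⟨-, -, -, -, -, hc⟩ := ha1
      refine ⟨B, φ, rfl, fun y hy => Finset.mem_union_left _ (hS.pick y hy),
        Finset.union_right_comm _ _ _, ?_⟩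
      rw [Finset.card_union_of_disjoint hdisj, Finset.card_union_of_disjoint hdF, hc]
      ring
    · refine Finset.union_subset hsub fun e he => ?_
      exact (Finset.mem_filter.1 (Finset.mem_filter.1 (hLsub he)).1).1
  refine h1.trans ((percProb_exists_le hp0 hp1 I _).trans ?_)
  have hsum := sum_clusteredBases_le hp0 hV hp s m
  rw [← hn] at hsum
  set W : ℝ := ((s : ℝ) ^ 2 * lam / n) ^ m / m.factorial with hW
  have hW0 : 0 ≤ W := by
    have : 0 ≤ Real.exp ((lam + 1) * n) * W :=
      (Finset.sum_nonneg fun _ _ => by positivity).trans hsum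
    exact nonneg_of_mul_nonneg_right this (Real.exp_pos _)
  have h2 : ∀ b ∈ I, percProb p E (fun X => ∃ K ∈ 𝒦, ∃ K₁ K₂, IsAttachment K K₁ b ∧
        IsAttachment K₁ K₂ 0 ∧ K₂ ⊆ X) ≤
      Real.exp ((24 * lam ^ 2 + lam + 5) * n + ((s : ℝ) / 3 - k / 3) * Real.log n) * W := by
    intro b hb
    simp only [I, Finset.mem_filter, Finset.mem_range] at hb
    refine (percProb_attach_attach_le_exp hp0 hp1 hV hp E 𝒦 ?_ (by omega)
      (Nat.zero_le _)).trans ?_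
    · intro K hK
      obtain ⟨q, hq, rfl⟩ := Finset.mem_image.1 hK
      simp only [Finset.mem_filter, Finset.mem_product, Finset.mem_univ, true_and,
        Finset.mem_sigma, Finset.mem_powersetCard] at hq
      have := Finset.card_union_le q.1 q.2.2
      omega
    · refine (mul_le_mul_of_nonneg_left hsum (Real.exp_pos _).le).trans ?_
      rw [← mul_assoc, ← Real.exp_add]
      refine mul_le_mul_of_nonneg_right (Real.exp_le_exp.2 ?_) hW0
      have h3 : (k : ℝ) / 3 - s / 3 ≤ b := by
        have : (k : ℝ) ≤ 3 * b + s := by exact_mod_cast hb.2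
        linarith
      have := mul_le_mul_of_nonneg_right h3 hlog
      rw [← hn]
      push_cast
      linarith
  refine (Finset.sum_le_card_nsmul _ _ _ h2).trans ?_
  have hI : (I.card : ℝ) ≤ Real.exp n := by
    have h3 : I.card ≤ n + 1 := (Finset.card_filter_le _ _).trans (by simp)
    have h4 : (I.card : ℝ) ≤ n + 1 := by exact_mod_cast h3
    exact h4.trans (card_add_one_le_exp n)
  rw [nsmul_eq_mul]
  refine (mul_le_mul_of_nonneg_right hI (by positivity)).trans ?_
  rw [← mul_assoc, ← Real.exp_add]
  refine mul_le_mul_of_nonneg_right (Real.exp_le_exp.2 (by linarith)) hW0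

end UpperBound

/-! ### The law of the graph given its triangle edges -/

section Conditioning

variable {V : Type*} [DecidableEq V] [Fintype V]

/-- The edge set of the complete graph on `V`. -/
noncomputable def allEdges (V : Type*) [Fintype V] [DecidableEq V] : Finset (Sym2 V) :=
  Finset.univ.filter fun e => ¬ e.IsDiag

lemma loopless_allEdges : Loopless (allEdges V) := fun _ he => (Finset.mem_filter.1 he).2

lemma subset_allEdges_iff {X : Finset (Sym2 V)} : X ⊆ allEdges V ↔ Loopless X :=
  ⟨fun h e he => loopless_allEdges e (h he),
    fun h e he => Finset.mem_filter.2 ⟨Finset.mem_univ _, h e he⟩⟩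

lemma card_allEdges : (allEdges V).card = (Fintype.card V).choose 2 := by
  rw [← Sym2.card_subtype_not_diag, Fintype.card_subtype, allEdges]

lemma triangleEdges_subset (X : Finset (Sym2 V)) : triangleEdges X ⊆ X :=
  Finset.filter_subset _ _

lemma triangleEdges_mono {X Y : Finset (Sym2 V)} (h : X ⊆ Y) :
    triangleEdges X ⊆ triangleEdges Y := by
  intro e
  induction e using Sym2.ind with
  | _ x y =>
    rw [mem_triangleEdges, mem_triangleEdges]
    exact fun ⟨z, hz⟩ => ⟨z, hz.mono h⟩

lemma IsTriangle.triangleEdges {X : Finset (Sym2 V)} {x y z : V} (h : IsTriangle X x y z) :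
    IsTriangle (triangleEdges X) x y z :=
  ⟨mem_triangleEdges.2 ⟨_, h⟩, mem_triangleEdges.2 ⟨_, h.rotate⟩,
    mem_triangleEdges.2 ⟨_, h.rotate.rotate⟩⟩

lemma triangleEdges_triangleEdges (X : Finset (Sym2 V)) :
    triangleEdges (triangleEdges X) = triangleEdges X := by
  refine Finset.Subset.antisymm (triangleEdges_subset _) fun e => ?_
  induction e using Sym2.ind with
  | _ x y =>
    intro h
    obtain ⟨z, hz⟩ := mem_triangleEdges.1 h
    exact mem_triangleEdges.2 ⟨z, hz.triangleEdges⟩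

lemma triangleVerts_triangleEdges (X : Finset (Sym2 V)) :
    triangleVerts (triangleEdges X) = triangleVerts X := by
  ext x
  rw [mem_triangleVerts, mem_triangleVerts]
  exact ⟨fun ⟨y, z, h⟩ => ⟨y, z, h.mono (triangleEdges_subset X)⟩,
    fun ⟨y, z, h⟩ => ⟨y, z, h.triangleEdges⟩⟩

lemma percProb_triangleEdges_eq {p : ℝ} {H : Finset (Sym2 V)} (hH : Loopless H)
    (P : Finset (Sym2 V) → Prop) :
    percProb p (allEdges V) (fun X => triangleEdges X = H ∧ P X) =
      p ^ H.card * percProb p (allEdges V \ H)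
        (fun R => triangleEdges (H ∪ R) = H ∧ P (H ∪ R)) := by
  rw [← percProb_superset (subset_allEdges_iff.2 hH)
    (P := fun X => triangleEdges X = H ∧ P X)]
  exact percProb_congr fun X _ =>
    ⟨fun h => ⟨h.1 ▸ triangleEdges_subset X, h⟩, fun h => h.2⟩

/-- The triples of distinct vertices whose first pair is not in `H`. -/
noncomputable def openTriples (H : Finset (Sym2 V)) : Finset (V × V × V) :=
  Finset.univ.filter fun t => t.1 ≠ t.2.1 ∧ t.2.1 ≠ t.2.2 ∧ t.2.2 ≠ t.1 ∧ s(t.1, t.2.1) ∉ H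

/-- The edges that have to be added to `H` for the triple to span a triangle. -/
def missingEdges (H : Finset (Sym2 V)) (t : V × V × V) : Finset (Sym2 V) :=
  {s(t.1, t.2.1), s(t.2.1, t.2.2), s(t.2.2, t.1)} \ H

lemma triangleEdges_union_eq {H R : Finset (Sym2 V)} (hH : triangleEdges H = H)
    (hl : Loopless (H ∪ R)) (h : ∀ t ∈ openTriples H, ¬ missingEdges H t ⊆ R) :
    triangleEdges (H ∪ R) = H := by
  refine Finset.Subset.antisymm (fun e => ?_)
    (hH.symm.subset.trans (triangleEdges_mono Finset.subset_union_left))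
  induction e using Sym2.ind with
  | _ x y =>
    rw [mem_triangleEdges]
    rintro ⟨z, hT⟩
    by_contra hxy
    refine h (x, y, z) ?_ ?_
    · exact Finset.mem_filter.2 ⟨Finset.mem_univ _, hl.ne hT.1, hl.ne hT.2.1, hl.ne hT.2.2, hxy⟩
    · intro f hf
      obtain ⟨hf, hfH⟩ := Finset.mem_sdiff.1 hf
      simp only [Finset.mem_insert, Finset.mem_singleton] at hf
      have : f ∈ H ∪ R := by
        rcases hf with rfl | rfl | rfl
        exacts [hT.1, hT.2.1, hT.2.2]
      exact (Finset.mem_union.1 this).resolve_left hfH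

/-- The number of neighbours of `z` in `H`. -/
noncomputable def deg (H : Finset (Sym2 V)) (z : V) : ℕ :=
  (Finset.univ.filter fun x => s(x, z) ∈ H).card

lemma sum_deg_le (H : Finset (Sym2 V)) (S : Finset V) : ∑ z ∈ S, deg H z ≤ 2 * H.card := by
  refine le_trans ?_ (card_orderedPairs_le H)
  have : ∑ z ∈ S, deg H z =
      (S.sigma fun z => Finset.univ.filter fun x => s(x, z) ∈ H).card := by
    rw [Finset.card_sigma]; rfl
  rw [this]
  refine Finset.card_le_card_of_injOn (fun q => (q.2, q.1)) ?_ ?_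
  · rintro ⟨z, x⟩ h
    simpa using (Finset.mem_sigma.1 h).2
  · rintro ⟨z, x⟩ _ ⟨z', x'⟩ _ h
    simp only [Prod.mk.injEq] at h
    obtain ⟨rfl, rfl⟩ := h
    rfl

lemma two_le_deg {H : Finset (Sym2 V)} (hl : Loopless H) {z : V} (hz : z ∈ triangleVerts H) :
    2 ≤ deg H z := by
  obtain ⟨x, y, h⟩ := mem_triangleVerts.1 hz
  rw [deg, ← Finset.card_pair (hl.ne h.2.1)]
  refine Finset.card_le_card fun v hv => ?_
  simp only [Finset.mem_insert, Finset.mem_singleton] at hv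
  refine Finset.mem_filter.2 ⟨Finset.mem_univ _, ?_⟩
  rcases hv with rfl | rfl
  · exact Sym2.eq_swap ▸ h.1
  · exact h.2.2

/-- Every vertex of a triangle has degree at least two, so there are at least as many edges as
vertices. -/
lemma card_triangleVerts_le {H : Finset (Sym2 V)} (hl : Loopless H) :
    (triangleVerts H).card ≤ H.card := by
  have h1 := sum_deg_le H (triangleVerts H)
  have h2 : (triangleVerts H).card • 2 ≤ ∑ z ∈ triangleVerts H, deg H z :=
    Finset.card_nsmul_le_sum (triangleVerts H) (deg H) 2
    fun z hz => two_le_deg hl hz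
  rw [smul_eq_mul] at h2
  omega

lemma deg_add_le {H : Finset (Sym2 V)} (hl : Loopless H) {z : V} (hz : z ∈ triangleVerts H) :
    deg H z + 2 * (triangleVerts H).card ≤ 2 * H.card + 2 := by
  have h1 := sum_deg_le H (triangleVerts H)
  rw [← Finset.add_sum_erase _ _ hz] at h1
  have h2 : ((triangleVerts H).erase z).card • 2 ≤ ∑ w ∈ (triangleVerts H).erase z, deg H w :=
    Finset.card_nsmul_le_sum ((triangleVerts H).erase z) (deg H) 2
    fun z hz => two_le_deg hl (Finset.mem_of_mem_erase hz)
  rw [smul_eq_mul, Finset.card_erase_of_mem hz] at h2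
  omega

/-- The number of paths of length two in `H`: all degrees are small since the degree sum
exceeds `2 |triangleVerts H|` by only `2 (|H| - |triangleVerts H|)`. -/
lemma card_cherries_le {H : Finset (Sym2 V)} (hl : Loopless H) (hH : triangleEdges H = H) {j : ℕ}
    (hj : H.card ≤ (triangleVerts H).card + j) :
    ((openTriples H).filter fun t => s(t.2.1, t.2.2) ∈ H ∧ s(t.2.2, t.1) ∈ H).card ≤
      2 * H.card * (2 * j + 1) := by
  set D : Finset (V × V) := Finset.univ.filter fun q => s(q.1, q.2) ∈ H
  have h1 : ((openTriples H).filter fun t => s(t.2.1, t.2.2) ∈ H ∧ s(t.2.2, t.1) ∈ H).card ≤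
      (2 * j + 1) * D.card := by
    refine Finset.card_le_mul_card_image_of_maps_to (f := fun t : V × V × V => t.2) ?_ _ ?_
    · intro t ht
      exact Finset.mem_filter.2 ⟨Finset.mem_univ _, (Finset.mem_filter.1 ht).2.1⟩
    · rintro ⟨y, z⟩ hq
      have hyz := (Finset.mem_filter.1 hq).2
      have hz : z ∈ triangleVerts H := by
        rw [← hH] at hyz
        obtain ⟨w, hw⟩ := mem_triangleEdges.1 hyz
        exact hw.mem_triangleVerts.2.1
      have hd := deg_add_le hl hz
      have hlt : (((openTriples H).filter
          fun t => s(t.2.1, t.2.2) ∈ H ∧ s(t.2.2, t.1) ∈ H).filter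
          fun t => t.2 = (y, z)).card + 1 ≤ deg H z := by
        have hy : y ∈ Finset.univ.filter fun x => s(x, z) ∈ H :=
          Finset.mem_filter.2 ⟨Finset.mem_univ _, hyz⟩
        rw [deg, ← Finset.card_erase_add_one hy]
        refine Nat.add_le_add_right ?_ 1
        refine Finset.card_le_card_of_injOn (fun t => t.1) ?_ ?_
        · rintro ⟨x, y', z'⟩ ht
          simp only [Finset.coe_filter, Finset.mem_filter, Set.mem_ofPred_eq, openTriples,
            Finset.mem_univ, true_and, Prod.mk.injEq] at ht
          obtain ⟨⟨⟨h1, -, -, -⟩, -, h2⟩, rfl, rfl⟩ := ht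
          simp only [Finset.coe_erase, Finset.coe_filter, Finset.mem_univ, true_and]
          exact ⟨show s(x, z') ∈ H from Sym2.eq_swap ▸ h2, h1⟩
        · rintro ⟨x, y', z'⟩ ht ⟨x', y'', z''⟩ ht' h
          simp only [Finset.coe_filter, Finset.mem_filter, Set.mem_ofPred_eq] at ht ht'
          rw [Prod.ext_iff]
          exact ⟨h, ht.2.trans ht'.2.symm⟩
      omega
  refine h1.trans ?_
  rw [mul_comm]
  exact Nat.mul_le_mul_right _ (card_orderedPairs_le H)

lemma pow_card_missingEdges_le {p : ℝ} (hp0 : 0 ≤ p) (hp1 : p ≤ 1) {H : Finset (Sym2 V)}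
    {t : V × V × V} (ht : t ∈ openTriples H) :
    p ^ (missingEdges H t).card ≤
      (if s(t.2.1, t.2.2) ∈ H ∧ s(t.2.2, t.1) ∈ H then p else 0) +
      (if s(t.2.1, t.2.2) ∈ H then p ^ 2 else 0) + (if s(t.2.2, t.1) ∈ H then p ^ 2 else 0) +
      p ^ 3 := by
  obtain ⟨x, y, z⟩ := t
  obtain ⟨-, hxy, hyz, hzx, hH⟩ := Finset.mem_filter.1 ht
  simp only at hxy hyz hzx hH ⊢
  have key : ∀ (m : ℕ) (A : Finset (Sym2 V)), A ⊆ missingEdges H (x, y, z) → A.card = m →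
      p ^ (missingEdges H (x, y, z)).card ≤ p ^ m := fun m A hA hm =>
    pow_le_pow_of_le_one hp0 hp1 (hm ▸ Finset.card_le_card hA)
  have m1 : s(x, y) ∈ missingEdges H (x, y, z) := by simp [missingEdges, hH]
  have n1 : s(x, y) ≠ s(z, x) := by
    rw [Ne, Sym2.eq_iff]; rintro (⟨h1, -⟩ | ⟨-, h⟩) <;> [exact hzx h1.symm; exact hyz h]
  have n2 : s(x, y) ≠ s(y, z) := by
    rw [Ne, Sym2.eq_iff]; rintro (⟨h1, -⟩ | ⟨h, -⟩) <;> [exact hxy h1; exact hzx h.symm]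
  have n3 : s(y, z) ≠ s(z, x) := by
    rw [Ne, Sym2.eq_iff]; rintro (⟨h1, -⟩ | ⟨h, -⟩) <;> [exact hyz h1; exact hxy h.symm]
  have hp2 : 0 ≤ p ^ 2 := by positivity
  have hp3 : 0 ≤ p ^ 3 := by positivity
  by_cases h1 : s(y, z) ∈ H <;> by_cases h2 : s(z, x) ∈ H
  · have := key 1 {s(x, y)} (by simpa using m1) (by simp)
    simp only [h1, h2, and_self, if_true]
    linarith [pow_one p]
  · have m2 : s(z, x) ∈ missingEdges H (x, y, z) := by simp [missingEdges, h2]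
    have := key 2 {s(x, y), s(z, x)} (by simp [Finset.insert_subset_iff, m1, m2])
      (Finset.card_pair n1)
    simp only [h1, h2, and_false, if_true, if_false]
    linarith
  · have m2 : s(y, z) ∈ missingEdges H (x, y, z) := by simp [missingEdges, h1]
    have := key 2 {s(x, y), s(y, z)} (by simp [Finset.insert_subset_iff, m1, m2])
      (Finset.card_pair n2)
    simp only [h1, h2, false_and, if_true, if_false]
    linarith
  · have m2 : s(y, z) ∈ missingEdges H (x, y, z) := by simp [missingEdges, h1]
    have m3 : s(z, x) ∈ missingEdges H (x, y, z) := by simp [missingEdges, h2]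
    have := key 3 {s(x, y), s(y, z), s(z, x)} (by simp [Finset.insert_subset_iff, m1, m2, m3])
      (Finset.card_eq_three.2 ⟨_, _, _, n2, n1, n3, rfl⟩)
    simp only [h1, h2, false_and, if_false]
    linarith

lemma sum_pow_card_missingEdges_le {p : ℝ} (hp0 : 0 ≤ p) (hp1 : p ≤ 1) {H : Finset (Sym2 V)}
    (hl : Loopless H) (hH : triangleEdges H = H) {j : ℕ}
    (hj : H.card ≤ (triangleVerts H).card + j) :
    ∑ t ∈ openTriples H, p ^ (missingEdges H t).card ≤
      2 * H.card * (2 * j + 1) * p + 4 * H.card * Fintype.card V * p ^ 2 +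
        (Fintype.card V) ^ 3 * p ^ 3 := by
  set n := Fintype.card V with hn
  refine (Finset.sum_le_sum fun t ht => pow_card_missingEdges_le hp0 hp1 ht).trans ?_
  rw [Finset.sum_add_distrib, Finset.sum_add_distrib, Finset.sum_add_distrib]
  simp only [← Finset.sum_filter, Finset.sum_const, nsmul_eq_mul]
  have c1 := card_cherries_le hl hH hj
  have hD := card_orderedPairs_le H
  have c2 : ((openTriples H).filter fun t => s(t.2.1, t.2.2) ∈ H).card ≤ 2 * H.card * n := by
    refine le_trans (Finset.card_le_card_of_injOn (t := (Finset.univ : Finset V) ×ˢ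
      (Finset.univ.filter fun q : V × V => s(q.1, q.2) ∈ H)) (fun t => (t.1, t.2)) ?_ ?_) ?_
    · intro t ht
      simpa using (Finset.mem_filter.1 ht).2
    · rintro ⟨x, y, z⟩ _ ⟨x', y', z'⟩ _ h
      simpa using h
    · rw [Finset.card_product, Finset.card_univ, mul_comm]
      exact Nat.mul_le_mul_right _ hD
  have c3 : ((openTriples H).filter fun t => s(t.2.2, t.1) ∈ H).card ≤ 2 * H.card * n := by
    refine le_trans (Finset.card_le_card_of_injOn (t := (Finset.univ : Finset V) ×ˢ
      (Finset.univ.filter fun q : V × V => s(q.1, q.2) ∈ H)) (fun t => (t.2.1, (t.2.2, t.1)))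
      ?_ ?_) ?_
    · intro t ht
      simpa using (Finset.mem_filter.1 ht).2
    · rintro ⟨x, y, z⟩ _ ⟨x', y', z'⟩ _ h
      simp only [Prod.mk.injEq] at h ⊢
      tauto
    · rw [Finset.card_product, Finset.card_univ, mul_comm]
      exact Nat.mul_le_mul_right _ hD
  have c4 : (openTriples H).card ≤ n ^ 3 := by
    refine (Finset.card_le_univ _).trans (le_of_eq ?_)
    rw [Fintype.card_prod, Fintype.card_prod]; ring
  have d1 : (((openTriples H).filter fun t => s(t.2.1, t.2.2) ∈ H ∧ s(t.2.2, t.1) ∈ H).card : ℝ)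
      ≤ 2 * H.card * (2 * j + 1) := by exact_mod_cast c1
  have d2 : (((openTriples H).filter fun t => s(t.2.1, t.2.2) ∈ H).card : ℝ) ≤ 2 * H.card * n := by
    exact_mod_cast c2
  have d3 : (((openTriples H).filter fun t => s(t.2.2, t.1) ∈ H).card : ℝ) ≤ 2 * H.card * n := by
    exact_mod_cast c3
  have d4 : ((openTriples H).card : ℝ) ≤ (n : ℝ) ^ 3 := by exact_mod_cast c4
  have e1 := mul_le_mul_of_nonneg_right d1 hp0
  have e2 := mul_le_mul_of_nonneg_right d2 (pow_nonneg hp0 2)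
  have e3 := mul_le_mul_of_nonneg_right d3 (pow_nonneg hp0 2)
  have e4 := mul_le_mul_of_nonneg_right d4 (pow_nonneg hp0 3)
  linarith

/-- Given that the edges of `H` are present, the remaining edges create no further triangle with
probability at least `exp (- O(j + 1))`, where `j` is the excess of edges over vertices in `H`. -/
theorem percProb_no_more_triangles_ge {lam p : ℝ} (hlam : 0 ≤ lam) (hp0 : 0 ≤ p) (hp1 : p ≤ 1 / 2)
    (hV : 0 < Fintype.card V) (hp : p ≤ lam / Fintype.card V) {H : Finset (Sym2 V)}
    (hl : Loopless H) (hH : triangleEdges H = H) {j : ℕ}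
    (hj : H.card ≤ (triangleVerts H).card + j) (hc : H.card ≤ 2 * Fintype.card V) :
    Real.exp (-(16 * lam * j + 8 * lam + 16 * lam ^ 2 + 2 * lam ^ 3)) ≤
      percProb p (allEdges V \ H) (fun R => triangleEdges (H ∪ R) = H) := by
  set n := Fintype.card V with hn
  have hnpos : (0 : ℝ) < n := by exact_mod_cast hV
  have h1 := percProb_avoid_ge_exp (E := allEdges V \ H) hp0 hp1 (openTriples H) (missingEdges H)
    fun t ht => ⟨s(t.1, t.2.1), by
      simp [missingEdges, (Finset.mem_filter.1 ht).2.2.2.2]⟩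
  refine le_trans ?_ (h1.trans (percProb_mono hp0 (by linarith) fun R hR h =>
    triangleEdges_union_eq hH (subset_allEdges_iff.1 (Finset.union_subset
      (subset_allEdges_iff.2 hl) (hR.trans Finset.sdiff_subset))) h))
  refine Real.exp_le_exp.2 ?_
  have h2 := sum_pow_card_missingEdges_le hp0 (by linarith) hl hH hj
  rw [← hn] at h2
  have hc' : (H.card : ℝ) ≤ 2 * n := by exact_mod_cast hc
  have hnp : n * p ≤ lam := by
    calc n * p ≤ n * (lam / n) := by gcongr
      _ = lam := by field_simp
  have hep : H.card * p ≤ 2 * lam := by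
    calc H.card * p ≤ 2 * n * p := by gcongr
      _ ≤ 2 * lam := by linarith
  have b1 : 2 * (H.card : ℝ) * (2 * j + 1) * p ≤ 4 * lam * (2 * j + 1) := by
    have : (0 : ℝ) ≤ 2 * j + 1 := by positivity
    nlinarith
  have b2 : 4 * (H.card : ℝ) * n * p ^ 2 ≤ 8 * lam ^ 2 := by
    have h0 : 0 ≤ n * p := by positivity
    have : (H.card * p) * (n * p) ≤ (2 * lam) * lam := by gcongr
    nlinarith
  have b3 : (n : ℝ) ^ 3 * p ^ 3 ≤ lam ^ 3 := by
    rw [← mul_pow]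
    have h0 : 0 ≤ n * p := by positivity
    gcongr
  linarith

/-- A two-sided Chernoff bound. -/
lemma percProb_abs_card_sub_ge_le {α : Type*} [DecidableEq α] {p : ℝ} (hp0 : 0 ≤ p) (hp1 : p ≤ 1)
    (D : Finset α) {μ c x t lam n : ℝ} (hμ : μ = lam * n / 2) (h1 : D.card * p ≤ μ)
    (h2 : μ - c ≤ D.card * p) (hc : 0 ≤ c) (ht0 : 0 < t) (ht1 : t ≤ 1) (hn : 0 ≤ n)
    (htx : lam * t ≤ x) :
    percProb p D (fun R => x * n ≤ |(R.card : ℝ) - μ|) ≤ 2 * Real.exp (c - t * x * n / 2) := by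
  have hle : percProb p D (fun R => x * n ≤ |(R.card : ℝ) - μ|) ≤
      percProb p D (fun R => t * (μ + x * n) ≤ t * R.card) +
      percProb p D (fun R => -t * (μ - x * n) ≤ -t * R.card) := by
    refine le_trans (percProb_mono hp0 hp1 fun R _ h => ?_) (percProb_or_le hp0 hp1 _ _)
    rcases le_abs'.1 h with h | h
    · right; nlinarith
    · left; nlinarith
  have e1 := percProb_exp_le (E := D) hp0 hp1 t (μ + x * n)
  have e2 := percProb_exp_le (E := D) hp0 hp1 (-t) (μ - x * n)
  have b1 := (abs_le.1 (Real.abs_exp_sub_one_sub_id_le (x := t)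
    (abs_le.2 ⟨by linarith, ht1⟩))).2
  have b2 := (abs_le.1 (Real.abs_exp_sub_one_sub_id_le (x := -t)
    (abs_le.2 ⟨by linarith, by linarith⟩))).2
  have hDp : 0 ≤ D.card * p := by positivity
  have hq : lam * t * (t * n) ≤ x * (t * n) := by gcongr
  have k1 : D.card * (p * (Real.exp t - 1)) - t * (μ + x * n) ≤ c - t * x * n / 2 := by
    have m1 : D.card * p * (Real.exp t - 1) ≤ D.card * p * (t + t ^ 2) := by
      gcongr; linarith
    have m2 : D.card * p * (t + t ^ 2) ≤ μ * (t + t ^ 2) := by gcongr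
    rw [← mul_assoc]
    subst hμ
    nlinarith
  have k2 : D.card * (p * (Real.exp (-t) - 1)) - -t * (μ - x * n) ≤ c - t * x * n / 2 := by
    have m1 : D.card * p * (Real.exp (-t) - 1) ≤ D.card * p * (-t + t ^ 2) := by
      gcongr; linarith
    have m3 : -t + t ^ 2 ≤ 0 := by nlinarith
    have m2 : D.card * p * (-t + t ^ 2) ≤ (μ - c) * (-t + t ^ 2) :=
      mul_le_mul_of_nonpos_right h2 m3
    have m4 : c * (t - t ^ 2) ≤ c * 1 := by
      gcongr; nlinarith
    rw [← mul_assoc]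
    subst hμ
    nlinarith
  have f1 := e1.trans (Real.exp_le_exp.2 k1)
  have f2 := e2.trans (Real.exp_le_exp.2 k2)
  linarith

/-- Given the triangle edges `H`, the number of remaining edges concentrates around
`lam * n / 2` at an exponential rate, provided the excess `j` of `H` is small. -/
theorem percProb_triangleEdges_eq_and_deviation_le {lam : ℝ} (hlam : 0 < lam)
    (hV : 2 * lam ≤ Fintype.card V) {H : Finset (Sym2 V)}
    (hl : Loopless H) (hH : triangleEdges H = H) {j : ℕ}
    (hj : H.card ≤ (triangleVerts H).card + j) (hc : H.card ≤ 2 * Fintype.card V) {x t : ℝ}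
    (ht0 : 0 < t) (ht1 : t ≤ 1) (htx : lam * t ≤ x) :
    percProb (lam / Fintype.card V) (allEdges V) (fun X => triangleEdges X = H ∧
      x * Fintype.card V ≤ |(X.card : ℝ) - H.card - lam * Fintype.card V / 2|) ≤
      2 * Real.exp (11 * lam + 16 * lam ^ 2 + 2 * lam ^ 3 + 16 * lam * j -
        t * x * Fintype.card V / 2) *
      percProb (lam / Fintype.card V) (allEdges V) (fun X => triangleEdges X = H) := by
  set n := Fintype.card V with hn
  have hnpos : (0 : ℝ) < n := by linarith
  have hV' : 0 < n := by exact_mod_cast hnpos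
  set p := lam / (n : ℝ) with hp
  have hp0 : 0 ≤ p := by positivity
  have hp1 : p ≤ 1 / 2 := by
    rw [hp, div_le_div_iff₀ hnpos (by norm_num)]; linarith
  have h1 := percProb_no_more_triangles_ge hlam.le hp0 hp1 hV' le_rfl hl hH hj hc
  have hcardD : ((allEdges V \ H).card : ℝ) = n * (n - 1) / 2 - H.card := by
    have h2 := Finset.card_sdiff_add_card_eq_card (subset_allEdges_iff.2 hl)
    rw [card_allEdges, ← hn] at h2
    have h3 : ((n.choose 2 : ℕ) : ℝ) = n * (n - 1) / 2 := Nat.cast_choose_two ℝ n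
    rw [← h3, ← h2]
    push_cast
    ring
  have hc' : (H.card : ℝ) ≤ 2 * n := by exact_mod_cast hc
  have hnp : n * p = lam := by rw [hp]; field_simp
  have hDp : ((allEdges V \ H).card : ℝ) * p = lam * n / 2 - lam / 2 - H.card * p := by
    rw [hcardD, ← hnp]; ring
  have hHp : H.card * p ≤ 2 * lam := by
    calc H.card * p ≤ 2 * n * p := by gcongr
      _ = 2 * lam := by rw [mul_assoc, hnp]
  have hHp0 : 0 ≤ H.card * p := by positivity
  have h2 := percProb_abs_card_sub_ge_le hp0 (by linarith) (allEdges V \ H)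
    (μ := lam * n / 2) (c := 3 * lam) (x := x) (t := t) (lam := lam) (n := n) rfl
    (by linarith) (by linarith) (by linarith) ht0 ht1 hnpos.le htx
  have hT : percProb p (allEdges V) (fun X => triangleEdges X = H) =
      p ^ H.card * percProb p (allEdges V \ H) (fun R => triangleEdges (H ∪ R) = H) := by
    have := percProb_triangleEdges_eq (p := p) hl (fun _ => True)
    simpa using this
  rw [percProb_triangleEdges_eq hl, hT]
  have h3 : percProb p (allEdges V \ H) (fun R => triangleEdges (H ∪ R) = H ∧
      x * n ≤ |((H ∪ R).card : ℝ) - H.card - lam * n / 2|) ≤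
      percProb p (allEdges V \ H) (fun R => x * n ≤ |(R.card : ℝ) - lam * n / 2|) := by
    refine percProb_mono hp0 (by linarith) fun R hR h => ?_
    have hd : Disjoint H R := Finset.disjoint_left.2 fun a ha hR' =>
      (Finset.mem_sdiff.1 (hR hR')).2 ha
    have := h.2
    rw [Finset.card_union_of_disjoint hd] at this
    push_cast at this
    rwa [add_sub_cancel_left] at this
  have h4 : 2 * Real.exp (3 * lam - t * x * n / 2) ≤
      2 * Real.exp (11 * lam + 16 * lam ^ 2 + 2 * lam ^ 3 + 16 * lam * j - t * x * n / 2) *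
      percProb p (allEdges V \ H) (fun R => triangleEdges (H ∪ R) = H) := by
    refine le_trans (le_of_eq ?_) (mul_le_mul_of_nonneg_left h1 (by positivity))
    rw [mul_assoc (2 : ℝ), ← Real.exp_add]
    congr 2; ring
  calc _ ≤ p ^ H.card * (2 * Real.exp (3 * lam - t * x * n / 2)) := by
        refine mul_le_mul_of_nonneg_left (h3.trans h2) (by positivity)
    _ ≤ p ^ H.card * _ := mul_le_mul_of_nonneg_left h4 (by positivity)
    _ = _ := by ring

end Conditioning

/-! ### Lower bound for the number of vertices in triangles -/

section LowerBound

variable {V : Type*} [DecidableEq V] [Fintype V]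

/-- The `i`-th vertex of the first of the three matched parts. -/
def partFst {q r : ℕ} (f : Fin q ⊕ Fin q ⊕ Fin q ⊕ Fin r ↪ V) (i : Fin q) : V := f (.inl i)

/-- The `i`-th vertex of the second part. -/
def partSnd {q r : ℕ} (f : Fin q ⊕ Fin q ⊕ Fin q ⊕ Fin r ↪ V) (i : Fin q) : V :=
  f (.inr (.inl i))

/-- The `i`-th vertex of the third part. -/
def partTrd {q r : ℕ} (f : Fin q ⊕ Fin q ⊕ Fin q ⊕ Fin r ↪ V) (i : Fin q) : V :=
  f (.inr (.inr (.inl i)))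

/-- The `i`-th vertex outside the three matched parts. -/
def partExtra {q r : ℕ} (f : Fin q ⊕ Fin q ⊕ Fin q ⊕ Fin r ↪ V) (i : Fin r) : V :=
  f (.inr (.inr (.inr i)))

/-- The graph consisting of the disjoint triangles obtained by matching three parts of size `q`
through the permutations `π` and `τ`, and of `r` extra vertices joined to both ends of an edge of
one of the triangles. -/
noncomputable def matchedTriangles {q r : ℕ} (f : Fin q ⊕ Fin q ⊕ Fin q ⊕ Fin r ↪ V) (i₀ : Fin q)
    (π τ : Equiv.Perm (Fin q)) : Finset (Sym2 V) :=
  (Finset.univ.biUnion fun i => {s(partFst f i, partSnd f (π i)),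
    s(partSnd f (π i), partTrd f (τ i)), s(partTrd f (τ i), partFst f i)}) ∪
  Finset.univ.biUnion fun j => {s(partExtra f j, partFst f i₀), s(partExtra f j, partSnd f (π i₀))}

variable {q r : ℕ} (f : Fin q ⊕ Fin q ⊕ Fin q ⊕ Fin r ↪ V) (i₀ : Fin q)
    (π τ : Equiv.Perm (Fin q))

lemma mem_matchedTriangles {e : Sym2 V} : e ∈ matchedTriangles f i₀ π τ ↔
    (∃ i, e = s(partFst f i, partSnd f (π i)) ∨ e = s(partSnd f (π i), partTrd f (τ i)) ∨
      e = s(partTrd f (τ i), partFst f i)) ∨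
    ∃ j, e = s(partExtra f j, partFst f i₀) ∨ e = s(partExtra f j, partSnd f (π i₀)) := by
  simp [matchedTriangles]

lemma isTriangle_matchedTriangles (i : Fin q) : IsTriangle (matchedTriangles f i₀ π τ)
    (partFst f i) (partSnd f (π i)) (partTrd f (τ i)) :=
  ⟨(mem_matchedTriangles ..).2 (.inl ⟨i, .inl rfl⟩),
    (mem_matchedTriangles ..).2 (.inl ⟨i, .inr (.inl rfl)⟩),
    (mem_matchedTriangles ..).2 (.inl ⟨i, .inr (.inr rfl)⟩)⟩

lemma isTriangle_extra_matchedTriangles (j : Fin r) : IsTriangle (matchedTriangles f i₀ π τ)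
    (partExtra f j) (partFst f i₀) (partSnd f (π i₀)) :=
  ⟨(mem_matchedTriangles ..).2 (.inr ⟨j, .inl rfl⟩),
    (mem_matchedTriangles ..).2 (.inl ⟨i₀, .inl rfl⟩),
    (mem_matchedTriangles ..).2 (.inr ⟨j, .inr Sym2.eq_swap⟩)⟩

lemma loopless_matchedTriangles : Loopless (matchedTriangles f i₀ π τ) := by
  intro e he
  rcases (mem_matchedTriangles ..).1 he with ⟨i, rfl | rfl | rfl⟩ | ⟨j, rfl | rfl⟩ <;>
    simp [partFst, partSnd, partTrd, partExtra]

lemma triangleEdges_matchedTriangles :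
    triangleEdges (matchedTriangles f i₀ π τ) = matchedTriangles f i₀ π τ := by
  refine Finset.Subset.antisymm (triangleEdges_subset _) fun e he => ?_
  rcases (mem_matchedTriangles ..).1 he with ⟨i, rfl | rfl | rfl⟩ | ⟨j, rfl | rfl⟩
  · exact mem_triangleEdges.2 ⟨_, isTriangle_matchedTriangles ..⟩
  · exact mem_triangleEdges.2 ⟨_, (isTriangle_matchedTriangles ..).rotate⟩
  · exact mem_triangleEdges.2 ⟨_, (isTriangle_matchedTriangles ..).rotate.rotate⟩
  · exact mem_triangleEdges.2 ⟨_, isTriangle_extra_matchedTriangles ..⟩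
  · exact mem_triangleEdges.2 ⟨_, (isTriangle_extra_matchedTriangles ..).flip⟩

lemma card_triangleVerts_matchedTriangles :
    (triangleVerts (matchedTriangles f i₀ π τ)).card = 3 * q + r := by
  have h : triangleVerts (matchedTriangles f i₀ π τ) = Finset.univ.map f := by
    ext v
    rw [mem_triangleVerts]
    simp only [Finset.mem_map, Finset.mem_univ, true_and]
    constructor
    · rintro ⟨y, z, hT⟩
      have hv : v ∈ s(v, y) := Sym2.mem_mk_left _ _
      rcases (mem_matchedTriangles ..).1 hT.1 with ⟨i, h | h | h⟩ | ⟨j, h | h⟩ <;>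
        rw [h] at hv <;> rcases Sym2.mem_iff.1 hv with rfl | rfl <;> exact ⟨_, rfl⟩
    · rintro ⟨x | x | x | x, rfl⟩
      · exact ⟨_, _, isTriangle_matchedTriangles f i₀ π τ x⟩
      · have := (isTriangle_matchedTriangles f i₀ π τ (π.symm x)).rotate
        rw [Equiv.apply_symm_apply] at this
        exact ⟨_, _, this⟩
      · have := (isTriangle_matchedTriangles f i₀ π τ (τ.symm x)).rotate.rotate
        rw [Equiv.apply_symm_apply] at this
        exact ⟨_, _, this⟩
      · exact ⟨_, _, isTriangle_extra_matchedTriangles f i₀ π τ x⟩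
  rw [h, Finset.card_map, Finset.card_univ]
  simp only [Fintype.card_sum, Fintype.card_fin]
  ring

lemma card_matchedTriangles_le : (matchedTriangles f i₀ π τ).card ≤ 3 * q + 2 * r := by
  refine (Finset.card_union_le _ _).trans (Nat.add_le_add ?_ ?_)
  · refine (Finset.card_biUnion_le_card_mul _ _ 3 fun _ _ => Finset.card_le_three).trans ?_
    simp [mul_comm]
  · refine (Finset.card_biUnion_le_card_mul _ _ 2 fun _ _ => Finset.card_le_two).trans ?_
    simp [mul_comm]

lemma fst_snd_mem_matchedTriangles {i j : Fin q}
    (h : s(partFst f i, partSnd f j) ∈ matchedTriangles f i₀ π τ) : j = π i := by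
  rcases (mem_matchedTriangles ..).1 h with ⟨i, h | h | h⟩ | ⟨j, h | h⟩ <;>
    simp [partFst, partSnd, partTrd, partExtra] at h
  rw [h.1, h.2]

lemma trd_fst_mem_matchedTriangles {i j : Fin q}
    (h : s(partTrd f j, partFst f i) ∈ matchedTriangles f i₀ π τ) : j = τ i := by
  rcases (mem_matchedTriangles ..).1 h with ⟨i, h | h | h⟩ | ⟨j, h | h⟩ <;>
    simp [partFst, partSnd, partTrd, partExtra] at h
  rw [h.1, h.2]

lemma matchedTriangles_injective : Function.Injective
    fun σ : Equiv.Perm (Fin q) × Equiv.Perm (Fin q) => matchedTriangles f i₀ σ.1 σ.2 := by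
  rintro ⟨π, τ⟩ ⟨π', τ'⟩ h
  simp only at h
  have h1 : π = π' := by
    ext1 i
    exact fst_snd_mem_matchedTriangles f i₀ π' τ' (h ▸ (isTriangle_matchedTriangles f i₀ π τ i).1)
  have h2 : τ = τ' := by
    ext1 i
    exact trd_fst_mem_matchedTriangles f i₀ π' τ'
      (h ▸ (isTriangle_matchedTriangles f i₀ π τ i).2.2)
  rw [h1, h2]

/-- Lower bound for the probability that exactly `3 * q + r` vertices lie in triangles, from the
`q! ^ 2` graphs `matchedTriangles`. -/
theorem percProb_card_triangleVerts_ge {lam : ℝ} (hlam : 0 < lam)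
    (hV : 2 * lam ≤ Fintype.card V) {q r : ℕ} (hq : 0 < q) (hqr : 3 * q + r ≤ Fintype.card V) :
    (q.factorial : ℝ) ^ 2 * ((lam / Fintype.card V) ^ (3 * q + 2 * r) *
      Real.exp (-(16 * lam * r + 8 * lam + 16 * lam ^ 2 + 2 * lam ^ 3))) ≤
      percProb (lam / Fintype.card V) (allEdges V)
        (fun X => (triangleVerts X).card = 3 * q + r) := by
  set n := Fintype.card V with hn
  have hnpos : (0 : ℝ) < n := by linarith
  have hV' : 0 < n := by exact_mod_cast hnpos
  set p := lam / (n : ℝ) with hp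
  have hp0 : 0 ≤ p := by positivity
  have hp1 : p ≤ 1 / 2 := by
    rw [hp, div_le_div_iff₀ hnpos (by norm_num)]; linarith
  obtain ⟨f⟩ : Nonempty (Fin q ⊕ Fin q ⊕ Fin q ⊕ Fin r ↪ V) := by
    refine Function.Embedding.nonempty_of_card_le ?_
    simp only [Fintype.card_sum, Fintype.card_fin]
    omega
  let i₀ : Fin q := ⟨0, hq⟩
  set 𝓗 : Finset (Finset (Sym2 V)) := Finset.univ.image
    fun σ : Equiv.Perm (Fin q) × Equiv.Perm (Fin q) => matchedTriangles f i₀ σ.1 σ.2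
  have hcard : 𝓗.card = q.factorial ^ 2 := by
    rw [Finset.card_image_of_injective _ (matchedTriangles_injective f i₀), Finset.card_univ,
      Fintype.card_prod, Fintype.card_perm, Fintype.card_fin, sq]
  have hsum : ∑ H ∈ 𝓗, percProb p (allEdges V) (fun X => triangleEdges X = H) ≤
      percProb p (allEdges V) (fun X => (triangleVerts X).card = 3 * q + r) := by
    rw [percProb_eq_sum Finset.univ triangleEdges _ fun _ _ _ => Finset.mem_univ _]
    refine le_trans (Finset.sum_le_sum fun H hH => ?_) (Finset.sum_le_sum_of_subset_of_nonneg
      (Finset.subset_univ 𝓗) fun _ _ _ => percProb_nonneg hp0 (by linarith) _)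
    obtain ⟨σ, -, rfl⟩ := Finset.mem_image.1 hH
    refine percProb_mono hp0 (by linarith) fun X _ hX => ⟨?_, hX⟩
    rw [← triangleVerts_triangleEdges, hX, card_triangleVerts_matchedTriangles]
  refine le_trans ?_ hsum
  have hterm : ∀ H ∈ 𝓗, p ^ (3 * q + 2 * r) *
      Real.exp (-(16 * lam * r + 8 * lam + 16 * lam ^ 2 + 2 * lam ^ 3)) ≤
      percProb p (allEdges V) (fun X => triangleEdges X = H) := by
    intro H hH
    obtain ⟨σ, -, rfl⟩ := Finset.mem_image.1 hH
    have hl := loopless_matchedTriangles f i₀ σ.1 σ.2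
    have hle := card_matchedTriangles_le f i₀ σ.1 σ.2
    have hT := percProb_triangleEdges_eq (p := p) hl (fun _ => True)
    simp only [and_true] at hT
    rw [hT]
    refine mul_le_mul (pow_le_pow_of_le_one hp0 (by linarith) hle) ?_ (Real.exp_pos _).le
      (by positivity)
    refine percProb_no_more_triangles_ge hlam.le hp0 hp1 hV' le_rfl hl
      (triangleEdges_matchedTriangles ..) ?_ ?_
    · rw [card_triangleVerts_matchedTriangles]; omega
    · omega
  have := Finset.card_nsmul_le_sum _ _ _ hterm
  rw [hcard, nsmul_eq_mul] at this
  exact_mod_cast this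

end LowerBound

/-! ### Asymptotics of the triangle-vertex count -/

lemma exp_le_factorial {q : ℕ} (hq : 0 < q) : Real.exp (q * Real.log q - q) ≤ q.factorial := by
  have h1 := Real.pow_div_factorial_le_exp (q : ℝ) (by positivity) q
  have hq' : (0 : ℝ) < q := by exact_mod_cast hq
  have hf : (0 : ℝ) < q.factorial := by exact_mod_cast q.factorial_pos
  rw [Real.exp_sub, Real.exp_nat_mul, Real.exp_log hq', div_le_iff₀ (Real.exp_pos _)]
  rw [div_le_iff₀ hf] at h1
  linarith

/-- The probability that `k ≥ κ n` vertices lie in triangles is at least `n ^ (-k / 3)`, up to an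
exponential factor. -/
theorem exists_percProb_card_triangleVerts_ge {lam κ : ℝ} (hlam : 0 < lam) (hκ : 0 < κ) :
    ∃ C : ℝ, ∀ᶠ n : ℕ in atTop, ∀ k : ℕ, κ * n ≤ k → k ≤ n →
      Real.exp (-C * n - k / 3 * Real.log n) ≤
        percProb (lam / n) (allEdges (Fin n)) (fun X => (triangleVerts X).card = k) := by
  set c₀ := 40 * lam + 16 * lam ^ 2 + 2 * lam ^ 3 with hc₀
  refine ⟨2 * |Real.log (κ / 4)| + 2 + 2 * |Real.log lam| + 10 / 3 + c₀, ?_⟩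
  filter_upwards [eventually_ge_atTop 1,
    tendsto_natCast_atTop_atTop.eventually_ge_atTop (2 * lam),
    tendsto_natCast_atTop_atTop.eventually_ge_atTop (12 / κ)] with n hn1 hn2 hn3 k hk1 hk2
  have hn : (1 : ℝ) ≤ n := by exact_mod_cast hn1
  have hn0 : (0 : ℝ) < n := by linarith
  have hκn : 12 ≤ κ * n := by
    rw [div_le_iff₀ hκ] at hn3; linarith
  obtain ⟨q, r, hr, rfl⟩ : ∃ q r, r ≤ 2 ∧ k = 3 * q + r :=
    ⟨k / 3, k % 3, by omega, by omega⟩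
  have hr' : (r : ℝ) ≤ 2 := by exact_mod_cast hr
  push_cast at hk1
  have hqn : κ / 4 * n ≤ q := by linarith
  have hq0 : (0 : ℝ) < q := by linarith
  have hq : 0 < q := by exact_mod_cast hq0
  have hk2' : (3 * q + r : ℝ) ≤ n := by exact_mod_cast hk2
  have hqle : (q : ℝ) ≤ n := by linarith [(Nat.cast_nonneg r : (0 : ℝ) ≤ r)]
  have h1 := percProb_card_triangleVerts_ge (V := Fin n) hlam (q := q) (r := r)
    (by simpa using hn2) hq (by simpa using hk2)
  rw [Fintype.card_fin] at h1
  refine le_trans ?_ h1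
  have hlogn : 0 ≤ Real.log n := Real.log_nonneg hn
  have hlogq : Real.log (κ / 4) + Real.log n ≤ Real.log q := by
    rw [← Real.log_mul (by positivity) (by positivity)]
    exact Real.log_le_log (by positivity) hqn
  have hfac : Real.exp (q * (Real.log (κ / 4) + Real.log n) - q) ^ 2 ≤ (q.factorial : ℝ) ^ 2 := by
    refine pow_le_pow_left₀ (Real.exp_pos _).le (le_trans ?_ (exp_le_factorial hq)) 2
    refine Real.exp_le_exp.2 ?_
    gcongr
  have hpow : (lam / n) ^ (3 * q + 2 * r) =
      Real.exp ((3 * q + 2 * r : ℕ) * (Real.log lam - Real.log n)) := by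
    rw [Real.exp_nat_mul, Real.exp_sub, Real.exp_log hlam, Real.exp_log hn0]
  rw [hpow]
  refine le_trans ?_ (mul_le_mul_of_nonneg_right hfac (by positivity))
  rw [← Real.exp_nat_mul, ← Real.exp_add, ← Real.exp_add]
  refine Real.exp_le_exp.2 ?_
  push_cast
  have b1 : -(n * |Real.log (κ / 4)|) ≤ q * Real.log (κ / 4) := by
    have h2 : q * |Real.log (κ / 4)| ≤ n * |Real.log (κ / 4)| := by gcongr
    have h3 : q * (-|Real.log (κ / 4)|) ≤ q * Real.log (κ / 4) := by
      gcongr; exact neg_abs_le _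
    linarith
  have b2 : -(2 * n * |Real.log lam|) ≤ (3 * q + 2 * r) * Real.log lam := by
    have h2 : (3 * q + 2 * r) * |Real.log lam| ≤ 2 * n * |Real.log lam| := by
      gcongr; linarith
    have h3 : (3 * q + 2 * r : ℝ) * (-|Real.log lam|) ≤ (3 * q + 2 * r) * Real.log lam := by
      gcongr; exact neg_abs_le _
    linarith
  have b3 : (r : ℝ) * Real.log n ≤ 2 * n := by
    have := Real.log_le_sub_one_of_pos hn0
    have h2 : Real.log n ≤ n := by linarith
    exact mul_le_mul hr' h2 hlogn (by norm_num)
  have b4 : c₀ ≤ c₀ * n := by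
    have : 0 ≤ c₀ := by positivity
    nlinarith
  have b5 : 16 * lam * r ≤ 32 * lam := by nlinarith
  rw [hc₀] at b4 ⊢
  linarith

/-- Packing linearly many edges into `O(n / log n)` vertices is superexponentially unlikely. -/
lemma eventually_pow_div_factorial_le {lam K δ B : ℝ} (hlam : 0 < lam) (hK : 0 < K) (hδ : 0 < δ) :
    ∀ᶠ n : ℕ in atTop,
      ((⌈K * n / Real.log n⌉₊ : ℝ) ^ 2 * lam / n) ^ ⌊δ * n⌋₊ / (⌊δ * n⌋₊).factorial ≤
        Real.exp (-B * n) := by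
  have hlog : Tendsto (fun n : ℕ => Real.log n) atTop atTop :=
    Real.tendsto_log_atTop.comp tendsto_natCast_atTop_atTop
  have hsmall : ∀ᶠ n : ℕ in atTop,
      8 * Real.exp 1 * K ^ 2 * lam / δ * Real.exp (2 * |B| / δ) ≤ Real.log n := by
    exact hlog.eventually_ge_atTop _
  filter_upwards [hsmall, hlog.eventually_ge_atTop 1, eventually_ge_atTop 1,
    tendsto_natCast_atTop_atTop.eventually_ge_atTop (2 / δ),
    Real.isLittleO_log_id_atTop.bound hK |>.natCast_atTop] with n h1 h2 h3 h4 h5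
  have hn : (1 : ℝ) ≤ n := by exact_mod_cast h3
  have hn0 : (0 : ℝ) < n := by linarith
  set L := Real.log n with hL
  have hL0 : 0 < L := by linarith
  set m := ⌊δ * (n : ℝ)⌋₊ with hm
  have hδn : 2 ≤ δ * n := by rw [div_le_iff₀ hδ] at h4; linarith
  have hm1 : δ * n / 2 ≤ m := by
    have := Nat.sub_one_lt_floor (δ * (n : ℝ))
    linarith
  have hm0 : (0 : ℝ) < m := by linarith
  have hs : (⌈K * n / L⌉₊ : ℝ) ≤ 2 * (K * n / L) := by
    have h6 : 1 ≤ K * n / L := by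
      rw [le_div_iff₀ hL0]
      simp only [id, Real.norm_eq_abs] at h5
      rw [abs_of_pos hn0] at h5
      linarith [le_abs_self L]
    have := Nat.ceil_lt_add_one (show 0 ≤ K * n / L by positivity)
    linarith
  set y := (⌈K * n / L⌉₊ : ℝ) ^ 2 * lam / n with hy
  have hy0 : 0 ≤ y := by positivity
  have hy1 : y ≤ 4 * K ^ 2 * lam * n / L ^ 2 := by
    calc y ≤ (2 * (K * n / L)) ^ 2 * lam / n := by rw [hy]; gcongr
      _ = 4 * K ^ 2 * lam * n / L ^ 2 := by field_simp; ring
  clear_value y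
  have hmain : Real.exp 1 * (y / m) ≤ Real.exp (-(2 * |B| / δ)) := by
    have h7 : y / m ≤ 8 * K ^ 2 * lam / δ / L := by
      calc y / m ≤ (4 * K ^ 2 * lam * n / L ^ 2) / (δ * n / 2) := by gcongr
        _ = 8 * K ^ 2 * lam / δ / L / L := by field_simp; ring
        _ ≤ 8 * K ^ 2 * lam / δ / L := div_le_self (by positivity) h2
    rw [Real.exp_neg, ← one_div, le_div_iff₀ (Real.exp_pos _)]
    calc Real.exp 1 * (y / m) * Real.exp (2 * |B| / δ)
        ≤ Real.exp 1 * (8 * K ^ 2 * lam / δ / L) * Real.exp (2 * |B| / δ) := by gcongr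
      _ = (8 * Real.exp 1 * K ^ 2 * lam / δ * Real.exp (2 * |B| / δ)) / L := by ring
      _ ≤ 1 := by rw [div_le_one hL0]; exact h1
  have hfac := Real.pow_div_factorial_le_exp (m : ℝ) hm0.le m
  calc y ^ m / m.factorial = (y / m) ^ m * ((m : ℝ) ^ m / m.factorial) := by
        rw [div_pow]; field_simp
    _ ≤ (y / m) ^ m * Real.exp m := by gcongr
    _ = (Real.exp 1 * (y / m)) ^ m := by
        rw [mul_pow, ← Real.exp_nat_mul, mul_one]; ring
    _ ≤ Real.exp (-(2 * |B| / δ)) ^ m := by gcongr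
    _ = Real.exp (m * -(2 * |B| / δ)) := by rw [← Real.exp_nat_mul]
    _ ≤ Real.exp (-B * n) := by
        refine Real.exp_le_exp.2 ?_
        have h8 : δ * n / 2 * (2 * |B| / δ) ≤ m * (2 * |B| / δ) := by gcongr
        have h9 : δ * n / 2 * (2 * |B| / δ) = n * |B| := by field_simp
        have h10 : n * B ≤ n * |B| := by gcongr; exact le_abs_self B
        linarith

/-- Given the triangle-vertex count, the triangle edges outnumber the triangle vertices by a linear
amount only with exponentially small conditional probability. -/
theorem eventually_percProb_excess_le {lam κ δ : ℝ} (hlam : 0 < lam) (hκ : 0 < κ)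
    (hδ : 0 < δ) (hδ1 : δ ≤ 1) :
    ∀ᶠ n : ℕ in atTop, ∀ k : ℕ, κ * n ≤ k → k ≤ n →
      percProb (lam / n) (allEdges (Fin n)) (fun X => (triangleVerts X).card = k ∧
        k + ⌊δ * n⌋₊ ≤ (triangleEdges X).card) ≤
      2 * Real.exp (-n) *
        percProb (lam / n) (allEdges (Fin n)) (fun X => (triangleVerts X).card = k) := by
  obtain ⟨C, hC⟩ := exists_percProb_card_triangleVerts_ge hlam hκ
  set C₁ := 24 * lam ^ 2 + lam + 6 with hC₁
  set K := 24 * (C₁ + |C| + 1) with hK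
  have hK0 : 0 < K := by positivity
  set B := C₁ + (K + 1) / 3 + |C| + 1 with hB
  have hlog : Tendsto (fun n : ℕ => Real.log n) atTop atTop :=
    Real.tendsto_log_atTop.comp tendsto_natCast_atTop_atTop
  filter_upwards [hC, eventually_pow_div_factorial_le (B := B) hlam hK0 hδ,
    hlog.eventually_ge_atTop 1, eventually_ge_atTop 1,
    tendsto_natCast_atTop_atTop.eventually_ge_atTop lam] with n h1 h2 h3 h4 h5 k hk1 hk2
  have hn : (1 : ℝ) ≤ n := by exact_mod_cast h4
  have hn0 : (0 : ℝ) < n := by linarith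
  have hLB := h1 k hk1 hk2
  set L := Real.log n with hL
  have hL0 : 0 < L := by linarith
  set m := ⌊δ * (n : ℝ)⌋₊ with hm
  set s := ⌈K * n / L⌉₊ with hs
  set p := lam / (n : ℝ) with hp
  have hp0 : 0 ≤ p := by positivity
  have hp1 : p ≤ 1 := by rw [hp, div_le_one hn0]; exact h5
  have hmn : m ≤ n := by
    refine Nat.floor_le_of_le ?_
    nlinarith
  have hV : 0 < Fintype.card (Fin n) := by rw [Fintype.card_fin]; omega
  have hpV : p ≤ lam / (Fintype.card (Fin n) : ℝ) := by simp [hp]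
  have hA := percProb_card_triangleVerts_le hp0 hp1 hV hpV loopless_allEdges k s
  have hB' := percProb_excess_le hp0 hp1 hV hpV loopless_allEdges (k := k) (s := s)
    (m := m) (by simpa using hmn)
  simp only [Fintype.card_fin] at hA hB'
  have hsL : K * n ≤ s * L := by
    have := Nat.le_ceil (K * n / L)
    rw [div_le_iff₀ hL0] at this
    exact this
  have hsL' : s * L ≤ (K + 1) * n := by
    have h6 := (Nat.ceil_lt_add_one (show 0 ≤ K * n / L by positivity)).le
    have h7 : s * L ≤ (K * n / L + 1) * L := by gcongr
    have h8 : (K * n / L + 1) * L = K * n + L := by field_simp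
    have := Real.log_le_sub_one_of_pos hn0
    linarith
  have habs : C * n ≤ |C| * n := by gcongr; exact le_abs_self C
  have hA' : percProb p (allEdges (Fin n)) (fun X => (triangleVerts X).card = k ∧
      s ≤ (triangleVerts X \ isolatedVerts X).card) ≤ Real.exp (-n) *
        percProb p (allEdges (Fin n)) (fun X => (triangleVerts X).card = k) := by
    refine hA.trans (le_trans ?_ (mul_le_mul_of_nonneg_left hLB (Real.exp_pos _).le))
    rw [← Real.exp_add]
    refine Real.exp_le_exp.2 ?_
    rw [hK] at hsL
    linarith
  have hB'' : percProb p (allEdges (Fin n)) (fun X => (triangleVerts X).card = k ∧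
      (triangleVerts X \ isolatedVerts X).card < s ∧ k + m ≤ (triangleEdges X).card) ≤
      Real.exp (-n) *
        percProb p (allEdges (Fin n)) (fun X => (triangleVerts X).card = k) := by
    refine hB'.trans (le_trans ?_ (mul_le_mul_of_nonneg_left hLB (Real.exp_pos _).le))
    refine (mul_le_mul_of_nonneg_left h2 (Real.exp_pos _).le).trans ?_
    rw [← Real.exp_add, ← Real.exp_add]
    refine Real.exp_le_exp.2 ?_
    rw [hB]
    linarith
  have hor := percProb_or_le (E := allEdges (Fin n)) hp0 hp1
    (fun X => (triangleVerts X).card = k ∧ s ≤ (triangleVerts X \ isolatedVerts X).card)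
    (fun X => (triangleVerts X).card = k ∧
      (triangleVerts X \ isolatedVerts X).card < s ∧ k + m ≤ (triangleEdges X).card)
  refine (percProb_mono hp0 hp1 fun X _ h => ?_).trans (hor.trans (by linarith))
  rcases le_or_gt s (triangleVerts X \ isolatedVerts X).card with h' | h'
  · exact .inl ⟨h.1, h'⟩
  · exact .inr ⟨h.1, h', h.2⟩

/-- Given that the proportion of triangle vertices is close to `a`, the number of edges divided by
`n` is close to `a + lam / 2` with conditional probability tending to one, uniformly. -/
theorem exists_percProb_edge_deviation_le {lam a ε : ℝ} (hlam : 0 < lam) (ha : 0 < a)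
    (hε : 0 < ε) :
    ∃ η > 0, ∃ ρ : ℕ → ℝ, Tendsto ρ atTop (𝓝 0) ∧ ∀ᶠ n : ℕ in atTop, ∀ k : ℕ, k ≤ n →
      |(k : ℝ) / n - a| < η →
      percProb (lam / n) (allEdges (Fin n)) (fun X => (triangleVerts X).card = k ∧
        ε ≤ |(X.card : ℝ) / n - (a + lam / 2)|) ≤
      ρ n * percProb (lam / n) (allEdges (Fin n)) (fun X => (triangleVerts X).card = k) := by
  set x := ε / 2 with hx
  have hx0 : 0 < x := by positivity
  set t := min 1 (x / lam) with ht
  have ht0 : 0 < t := lt_min one_pos (by positivity)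
  have ht1 : t ≤ 1 := min_le_left _ _
  have htx : lam * t ≤ x := by
    have : t ≤ x / lam := min_le_right _ _
    rw [le_div_iff₀ hlam] at this
    linarith
  -- `δ n` bounds the excess of the triangle edges; it must be small compared with the Chernoff
  -- rate `t * x / 2`, because the conditioning costs `exp (16 * lam * δ * n)`.
  set δ := min 1 (min (ε / 4) (t * x / (64 * lam))) with hδ
  have hδ0 : 0 < δ := lt_min one_pos (lt_min (by positivity) (by positivity))
  have hδ1 : δ ≤ 1 := min_le_left _ _
  have hδε : δ ≤ ε / 4 := (min_le_right _ _).trans (min_le_left _ _)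
  have hδt : 16 * lam * δ ≤ t * x / 4 := by
    have : δ ≤ t * x / (64 * lam) := (min_le_right _ _).trans (min_le_right _ _)
    rw [le_div_iff₀ (by positivity)] at this
    linarith
  set c₀ := 11 * lam + 16 * lam ^ 2 + 2 * lam ^ 3 with hc₀
  refine ⟨min (ε / 4) (a / 2), lt_min (by positivity) (by positivity),
    fun n => 2 * Real.exp (-n) + 2 * Real.exp (c₀ - t * x / 4 * n), ?_, ?_⟩
  · have h1 : Tendsto (fun n : ℕ => Real.exp (-(n : ℝ))) atTop (𝓝 0) :=
      Real.tendsto_exp_neg_atTop_nhds_zero.comp tendsto_natCast_atTop_atTop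
    have h2 : Tendsto (fun n : ℕ => Real.exp (c₀ - t * x / 4 * n)) atTop (𝓝 0) := by
      refine Real.tendsto_exp_atBot.comp ?_
      simp only [sub_eq_add_neg]
      refine tendsto_atBot_add_const_left _ _ (tendsto_neg_atTop_atBot.comp ?_)
      exact tendsto_natCast_atTop_atTop.const_mul_atTop (by positivity)
    simpa using (h1.const_mul 2).add (h2.const_mul 2)
  filter_upwards [eventually_percProb_excess_le hlam (half_pos ha) hδ0 hδ1,
    eventually_ge_atTop 1, tendsto_natCast_atTop_atTop.eventually_ge_atTop (2 * lam)]
    with n h1 h2 h3 k hkn hk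
  have hn : (1 : ℝ) ≤ n := by exact_mod_cast h2
  have hn0 : (0 : ℝ) < n := by linarith
  have hk1 := abs_lt.1 (hk.trans_le (min_le_left _ _))
  have hk2 := abs_lt.1 (hk.trans_le (min_le_right _ _))
  have hκ : a / 2 * n ≤ k := by
    have : a / 2 < (k : ℝ) / n := by linarith
    rw [lt_div_iff₀ hn0] at this
    exact this.le
  have hexc := h1 k hκ hkn
  set p := lam / (n : ℝ) with hp
  have hp0 : 0 ≤ p := by positivity
  have hp1 : p ≤ 1 := by rw [hp, div_le_one hn0]; linarith
  set m := ⌊δ * (n : ℝ)⌋₊ with hm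
  have hmδ : (m : ℝ) ≤ δ * n := Nat.floor_le (by positivity)
  have hmn : m ≤ n := Nat.floor_le_of_le (by nlinarith)
  have hor := percProb_or_le (E := allEdges (Fin n)) hp0 hp1
    (fun X => (triangleVerts X).card = k ∧ k + m ≤ (triangleEdges X).card)
    (fun X => ((triangleVerts X).card = k ∧ (triangleEdges X).card < k + m) ∧
      x * n ≤ |(X.card : ℝ) - (triangleEdges X).card - lam * n / 2|)
  have hC : percProb p (allEdges (Fin n)) (fun X => ((triangleVerts X).card = k ∧
      (triangleEdges X).card < k + m) ∧
      x * n ≤ |(X.card : ℝ) - (triangleEdges X).card - lam * n / 2|) ≤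
      2 * Real.exp (c₀ - t * x / 4 * n) *
        percProb p (allEdges (Fin n)) (fun X => (triangleVerts X).card = k) := by
    rw [percProb_eq_sum Finset.univ triangleEdges _ fun _ _ _ => Finset.mem_univ _,
      percProb_eq_sum (P := fun X => (triangleVerts X).card = k) Finset.univ triangleEdges
        fun _ _ _ => Finset.mem_univ _, Finset.mul_sum]
    refine Finset.sum_le_sum fun H _ => ?_
    by_cases hH : triangleEdges H = H ∧ Loopless H ∧ (triangleVerts H).card = k ∧
        H.card < k + m
    · obtain ⟨hH, hl, hv, hc⟩ := hH
      have h4 := percProb_triangleEdges_eq_and_deviation_le (V := Fin n) hlam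
        (by simpa using h3) hl hH (j := m) (by omega) (by rw [Fintype.card_fin]; omega)
        ht0 ht1 htx
      simp only [Fintype.card_fin] at h4
      refine (percProb_mono hp0 hp1 ?_).trans (h4.trans (mul_le_mul ?_ ?_
        (percProb_nonneg hp0 hp1 _) (by positivity)))
      · rintro X - ⟨⟨-, h5⟩, rfl⟩
        exact ⟨rfl, h5⟩
      · refine mul_le_mul_of_nonneg_left (Real.exp_le_exp.2 ?_) (by norm_num)
        have h6 : 16 * lam * m ≤ 16 * lam * (δ * n) := by gcongr
        have h7 : 16 * lam * δ * n ≤ t * x / 4 * n := by gcongr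
        linarith
      · refine percProb_mono hp0 hp1 ?_
        rintro X - rfl
        exact ⟨by rw [← hv, triangleVerts_triangleEdges], rfl⟩
    · refine le_trans (le_of_eq ?_) (mul_nonneg (by positivity) (percProb_nonneg hp0 hp1 _))
      refine Finset.sum_eq_zero fun X hX => if_neg ?_
      rintro ⟨⟨⟨h5, h6⟩, -⟩, rfl⟩
      refine hH ⟨triangleEdges_triangleEdges X, ?_, ?_, h6⟩
      · exact fun e he => loopless_allEdges e
          (Finset.mem_powerset.1 hX (triangleEdges_subset X he))
      · rw [triangleVerts_triangleEdges]; exact h5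
  refine (percProb_mono hp0 hp1 fun X hX h => ?_).trans (hor.trans
    ((add_le_add hexc hC).trans (le_of_eq (by ring))))
  obtain ⟨hXk, hdev⟩ := h
  rcases le_or_gt (k + m) (triangleEdges X).card with h' | h'
  · exact .inl ⟨hXk, h'⟩
  · refine .inr ⟨⟨hXk, h'⟩, ?_⟩
    have hlow : k ≤ (triangleEdges X).card := by
      have hl : Loopless (triangleEdges X) := fun e he =>
        loopless_allEdges e (hX (triangleEdges_subset X he))
      have := card_triangleVerts_le hl
      rwa [triangleVerts_triangleEdges, hXk] at this
    have hlow' : (k : ℝ) ≤ (triangleEdges X).card := by exact_mod_cast hlow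
    have hup' : ((triangleEdges X).card : ℝ) ≤ k + δ * n := by
      have : ((triangleEdges X).card : ℝ) ≤ k + m := by exact_mod_cast h'.le
      linarith
    have e1 : (X.card : ℝ) / n * n = X.card := by field_simp
    have e2 : (k : ℝ) / n * n = k := by field_simp
    have d1 : δ * n ≤ ε / 4 * n := by gcongr
    have d2 : (k : ℝ) / n * n ≤ (a + ε / 4) * n := by gcongr; linarith
    have d3 : (a - ε / 4) * n ≤ (k : ℝ) / n * n := by gcongr; linarith
    rcases le_abs'.1 hdev with h5 | h5
    · have d4 : (X.card : ℝ) / n * n ≤ (a + lam / 2 - ε) * n := by gcongr; linarith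
      refine le_abs'.2 (.inl ?_)
      rw [hx]
      linarith
    · have d4 : (a + lam / 2 + ε) * n ≤ (X.card : ℝ) / n * n := by gcongr; linarith
      refine le_abs'.2 (.inr ?_)
      rw [hx]
      linarith

/-! ### Laplace asymptotics at speed `n log n` -/

section Laplace

variable {P : ℕ → ℕ → ℝ} {g : ℝ → ℝ} {a C₁ C₂ : ℝ}

lemma tendsto_inv_log_natCast : Tendsto (fun n : ℕ => (Real.log n)⁻¹) atTop (𝓝 0) :=
  tendsto_inv_atTop_zero.comp (Real.tendsto_log_atTop.comp tendsto_natCast_atTop_atTop)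

/-- Upper bound for a partial sum over those `k` for which the rate function at `k / n` is at
most `B`. -/
lemma eventually_sum_mul_exp_le
    (hU : ∀ᶠ n : ℕ in atTop, ∀ k ≤ n, P n k ≤ Real.exp (C₁ * n - k / 3 * Real.log n)) :
    ∀ᶠ n : ℕ in atTop, ∀ (B : ℝ) (S : Finset ℕ), S ⊆ Finset.range (n + 1) →
      (∀ k ∈ S, g ((k : ℝ) / n) - (k : ℝ) / n / 3 ≤ B) →
      ∑ k ∈ S, P n k * Real.exp (n * Real.log n * g ((k : ℝ) / n)) ≤
        Real.exp ((C₁ + 1) * n + n * Real.log n * B) := by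
  filter_upwards [hU, eventually_ge_atTop 1] with n h1 h2 B S hS hB
  have hn : (1 : ℝ) ≤ n := by exact_mod_cast h2
  have hn0 : (0 : ℝ) < n := by linarith
  have hlog : 0 ≤ Real.log n := Real.log_nonneg hn
  have hterm : ∀ k ∈ S, P n k * Real.exp (n * Real.log n * g ((k : ℝ) / n)) ≤
      Real.exp (C₁ * n + n * Real.log n * B) := by
    intro k hk
    have hkn : k ≤ n := by have := Finset.mem_range.1 (hS hk); omega
    refine (mul_le_mul_of_nonneg_right (h1 k hkn) (Real.exp_pos _).le).trans ?_
    rw [← Real.exp_add]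
    refine Real.exp_le_exp.2 ?_
    have h3 := mul_le_mul_of_nonneg_left (hB k hk) (mul_nonneg hn0.le hlog)
    have h4 : n * Real.log n * ((k : ℝ) / n / 3) = k / 3 * Real.log n := by field_simp
    rw [mul_sub, h4] at h3
    linarith
  refine (Finset.sum_le_card_nsmul _ _ _ hterm).trans ?_
  have hc : (S.card : ℝ) ≤ Real.exp n := by
    have := Finset.card_le_card hS
    rw [Finset.card_range] at this
    have h5 : (S.card : ℝ) ≤ n + 1 := by exact_mod_cast this
    exact h5.trans (card_add_one_le_exp n)
  rw [nsmul_eq_mul]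
  refine (mul_le_mul_of_nonneg_right hc (Real.exp_pos _).le).trans ?_
  rw [← Real.exp_add]
  exact Real.exp_le_exp.2 (by linarith)

lemma tendsto_ceil_div (ha0 : 0 ≤ a) :
    Tendsto (fun n : ℕ => (⌈a * n⌉₊ : ℝ) / n) atTop (𝓝 a) :=
  (tendsto_nat_ceil_mul_div_atTop ha0).comp tendsto_natCast_atTop_atTop

lemma ceil_mul_le (ha1 : a ≤ 1) (n : ℕ) : ⌈a * n⌉₊ ≤ n :=
  Nat.ceil_le.2 (mul_le_of_le_one_left (Nat.cast_nonneg n) ha1)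

lemma tendsto_rate_ceil_div (hg : ContinuousOn g (Set.Icc 0 1)) (ha0 : 0 ≤ a) (ha1 : a ≤ 1) :
    Tendsto (fun n : ℕ => g ((⌈a * n⌉₊ : ℝ) / n) - (⌈a * n⌉₊ : ℝ) / n / 3) atTop
      (𝓝 (g a - a / 3)) := by
  have h1 : Tendsto (fun n : ℕ => (⌈a * n⌉₊ : ℝ) / n) atTop (𝓝[Set.Icc 0 1] a) := by
    refine tendsto_nhdsWithin_iff.2 ⟨tendsto_ceil_div ha0, Eventually.of_forall fun n => ?_⟩
    refine ⟨by positivity, div_le_one_of_le₀ ?_ (Nat.cast_nonneg n)⟩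
    exact_mod_cast ceil_mul_le ha1 n
  exact ((hg a ⟨ha0, ha1⟩).tendsto.comp h1).sub ((tendsto_ceil_div ha0).div_const 3)

/-- Lower bound for the whole sum, from the single term `k = ⌈a n⌉`. -/
lemma eventually_le_sum_mul_exp (hP : ∀ n k, 0 ≤ P n k)
    (hL : ∀ᶠ n : ℕ in atTop, ∀ k : ℕ, a * n ≤ k → k ≤ n →
      Real.exp (-C₂ * n - k / 3 * Real.log n) ≤ P n k) (ha1 : a ≤ 1) :
    ∀ᶠ n : ℕ in atTop,
      Real.exp (-C₂ * n + n * Real.log n *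
        (g ((⌈a * n⌉₊ : ℝ) / n) - (⌈a * n⌉₊ : ℝ) / n / 3)) ≤
      ∑ k ∈ Finset.range (n + 1), P n k * Real.exp (n * Real.log n * g ((k : ℝ) / n)) := by
  filter_upwards [hL, eventually_ge_atTop 1] with n h1 h2
  have hn0 : (0 : ℝ) < n := by exact_mod_cast h2
  have hk := ceil_mul_le ha1 n
  refine le_trans ?_ (Finset.single_le_sum
    (f := fun k : ℕ => P n k * Real.exp (n * Real.log n * g ((k : ℝ) / n)))
    (fun k _ => mul_nonneg (hP n k) (Real.exp_pos _).le)
    (Finset.mem_range.2 (Nat.lt_succ_of_le hk)))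
  refine le_trans (le_of_eq ?_)
    (mul_le_mul_of_nonneg_right (h1 ⌈a * n⌉₊ (Nat.le_ceil _) hk) (Real.exp_pos _).le)
  rw [← Real.exp_add]
  congr 1
  field_simp
  ring

/-- Varadhan's lemma at speed `n log n`. -/
theorem tendsto_log_sum_mul_exp (hP : ∀ n k, 0 ≤ P n k)
    (hU : ∀ᶠ n : ℕ in atTop, ∀ k ≤ n, P n k ≤ Real.exp (C₁ * n - k / 3 * Real.log n))
    (hL : ∀ᶠ n : ℕ in atTop, ∀ k : ℕ, a * n ≤ k → k ≤ n →
      Real.exp (-C₂ * n - k / 3 * Real.log n) ≤ P n k)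
    (hg : ContinuousOn g (Set.Icc 0 1)) (ha : a ∈ Set.Icc (0 : ℝ) 1)
    (hmax : IsMaxOn (fun x => g x - x / 3) (Set.Icc 0 1) a) :
    Tendsto (fun n : ℕ => 1 / ((n : ℝ) * Real.log n) * Real.log
      (∑ k ∈ Finset.range (n + 1), P n k * Real.exp (n * Real.log n * g ((k : ℝ) / n))))
      atTop (𝓝 (g a - a / 3)) := by
  have hlog : Tendsto (fun n : ℕ => Real.log n) atTop atTop :=
    Real.tendsto_log_atTop.comp tendsto_natCast_atTop_atTop
  have hlow : Tendsto (fun n : ℕ => -C₂ * (Real.log n)⁻¹ +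
      (g ((⌈a * n⌉₊ : ℝ) / n) - (⌈a * n⌉₊ : ℝ) / n / 3)) atTop (𝓝 (g a - a / 3)) := by
    simpa using (tendsto_inv_log_natCast.const_mul (-C₂)).add
      (tendsto_rate_ceil_div hg ha.1 ha.2)
  have hup : Tendsto (fun n : ℕ => (C₁ + 1) * (Real.log n)⁻¹ + (g a - a / 3)) atTop
      (𝓝 (g a - a / 3)) := by
    simpa using (tendsto_inv_log_natCast.const_mul (C₁ + 1)).add_const (g a - a / 3)
  refine tendsto_of_tendsto_of_tendsto_of_le_of_le' hlow hup ?_ ?_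
  · filter_upwards [eventually_le_sum_mul_exp (g := g) hP hL ha.2, eventually_ge_atTop 1,
      hlog.eventually_ge_atTop 1] with n h1 h2 h3
    have hn0 : (0 : ℝ) < n := by exact_mod_cast h2
    have hl0 : 0 < Real.log n := by linarith
    have h4 := Real.log_le_log (Real.exp_pos _) h1
    rw [Real.log_exp] at h4
    rw [one_div_mul_eq_div, le_div_iff₀ (by positivity)]
    refine le_trans (le_of_eq ?_) h4
    field_simp
  · filter_upwards [eventually_sum_mul_exp_le (g := g) hU,
      eventually_le_sum_mul_exp (g := g) hP hL ha.2, eventually_ge_atTop 1,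
      hlog.eventually_ge_atTop 1] with n h1 h1' h2 h3
    have hn0 : (0 : ℝ) < n := by exact_mod_cast h2
    have hl0 : 0 < Real.log n := by linarith
    have h4 := h1 (g a - a / 3) (Finset.range (n + 1)) le_rfl fun k hk =>
      hmax (a := (k : ℝ) / n) ⟨by positivity, div_le_one_of_le₀ (by
        have := Finset.mem_range.1 hk
        exact_mod_cast Nat.lt_succ_iff.1 this) hn0.le⟩
    have h5 := Real.log_le_log ((Real.exp_pos _).trans_le h1') h4
    rw [Real.log_exp] at h5
    rw [one_div_mul_eq_div, div_le_iff₀ (by positivity)]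
    refine h5.trans (le_of_eq ?_)
    field_simp

/-- Away from a unique maximizer the tilted weights are negligible. -/
theorem tendsto_sum_filter_div (hP : ∀ n k, 0 ≤ P n k)
    (hU : ∀ᶠ n : ℕ in atTop, ∀ k ≤ n, P n k ≤ Real.exp (C₁ * n - k / 3 * Real.log n))
    (hL : ∀ᶠ n : ℕ in atTop, ∀ k : ℕ, a * n ≤ k → k ≤ n →
      Real.exp (-C₂ * n - k / 3 * Real.log n) ≤ P n k)
    (hg : ContinuousOn g (Set.Icc 0 1)) (ha : a ∈ Set.Icc (0 : ℝ) 1)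
    (hmax : IsMaxOn (fun x => g x - x / 3) (Set.Icc 0 1) a)
    (huniq : ∀ b ∈ Set.Icc (0 : ℝ) 1, IsMaxOn (fun x => g x - x / 3) (Set.Icc 0 1) b → b = a)
    {η : ℝ} (hη : 0 < η) :
    Tendsto (fun n : ℕ =>
      (∑ k ∈ (Finset.range (n + 1)).filter fun k : ℕ => η ≤ |(k : ℝ) / n - a|,
        P n k * Real.exp (n * Real.log n * g ((k : ℝ) / n))) /
      ∑ k ∈ Finset.range (n + 1), P n k * Real.exp (n * Real.log n * g ((k : ℝ) / n)))
      atTop (𝓝 0) := by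
  obtain ⟨δ, hδ, hgap⟩ : ∃ δ > 0, ∀ x ∈ Set.Icc (0 : ℝ) 1, η ≤ |x - a| →
      g x - x / 3 ≤ (g a - a / 3) - δ := by
    have hK : IsCompact (Set.Icc (0 : ℝ) 1 ∩ {x | η ≤ |x - a|}) :=
      isCompact_Icc.inter_right (isClosed_le continuous_const (by fun_prop))
    rcases Set.eq_empty_or_nonempty (Set.Icc (0 : ℝ) 1 ∩ {x | η ≤ |x - a|}) with he | hne
    · exact ⟨1, one_pos, fun x hx hx' => absurd (show x ∈ (∅ : Set ℝ) from he ▸ ⟨hx, hx'⟩)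
        (Set.notMem_empty x)⟩
    · obtain ⟨b, hb, hbmax⟩ := hK.exists_isMaxOn hne
        (f := fun x => g x - x / 3) ((hg.mono Set.inter_subset_left).sub (by fun_prop))
      refine ⟨(g a - a / 3) - (g b - b / 3), ?_, fun x hx hx' => ?_⟩
      · have h1 : g b - b / 3 ≤ g a - a / 3 := hmax hb.1
        rcases h1.lt_or_eq with h | h
        · linarith
        · exfalso
          have hba : b = a := huniq b hb.1 fun x hx => by
            have h2 : g x - x / 3 ≤ g a - a / 3 := hmax hx
            change g x - x / 3 ≤ g b - b / 3
            linarith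
          have h3 : η ≤ |b - a| := hb.2
          rw [hba, sub_self, abs_zero] at h3
          linarith
      · have h1 : g x - x / 3 ≤ g b - b / 3 := hbmax ⟨hx, hx'⟩
        linarith
  have hlog : Tendsto (fun n : ℕ => Real.log n) atTop atTop :=
    Real.tendsto_log_atTop.comp tendsto_natCast_atTop_atTop
  have hbound : Tendsto (fun n : ℕ => Real.exp (-(n : ℝ))) atTop (𝓝 0) :=
    Real.tendsto_exp_neg_atTop_nhds_zero.comp tendsto_natCast_atTop_atTop
  refine tendsto_of_tendsto_of_tendsto_of_le_of_le' tendsto_const_nhds hbound ?_ ?_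
  · refine Eventually.of_forall fun n => div_nonneg ?_ ?_ <;>
    exact Finset.sum_nonneg fun k _ => mul_nonneg (hP n k) (Real.exp_pos _).le
  · filter_upwards [eventually_sum_mul_exp_le (g := g) hU,
      eventually_le_sum_mul_exp (g := g) hP hL ha.2, eventually_ge_atTop 1,
      hlog.eventually_ge_atTop (2 / δ * (C₁ + C₂ + 2)),
      (tendsto_rate_ceil_div hg ha.1 ha.2).eventually_const_lt
        (show (g a - a / 3) - δ / 2 < g a - a / 3 by linarith), hlog.eventually_ge_atTop 1]
      with n h1 h2 h3 h4 h5 h6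
    have hn0 : (0 : ℝ) < n := by exact_mod_cast h3
    have h7 := h1 (g a - a / 3 - δ) ((Finset.range (n + 1)).filter
      fun k : ℕ => η ≤ |(k : ℝ) / n - a|) (Finset.filter_subset _ _) fun k hk => by
        obtain ⟨hk, hk'⟩ := Finset.mem_filter.1 hk
        refine hgap _ ⟨by positivity, div_le_one_of_le₀ ?_ hn0.le⟩ hk'
        have := Finset.mem_range.1 hk
        exact_mod_cast Nat.lt_succ_iff.1 this
    rw [div_le_iff₀ ((Real.exp_pos _).trans_le h2)]
    refine h7.trans (le_trans ?_ (mul_le_mul_of_nonneg_left h2 (Real.exp_pos _).le))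
    rw [← Real.exp_add]
    refine Real.exp_le_exp.2 ?_
    have h8 : n * Real.log n * (g a - a / 3 - δ / 2) ≤
        n * Real.log n * (g ((⌈a * n⌉₊ : ℝ) / n) - (⌈a * n⌉₊ : ℝ) / n / 3) :=
      mul_le_mul_of_nonneg_left h5.le (by positivity)
    have h9 : C₁ + C₂ + 2 ≤ Real.log n * (δ / 2) := by
      have e : C₁ + C₂ + 2 = 2 / δ * (C₁ + C₂ + 2) * (δ / 2) := by field_simp
      rw [e]
      exact mul_le_mul_of_nonneg_right h4 (by positivity)
    have h10 := mul_le_mul_of_nonneg_left h9 hn0.le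
    linarith

end Laplace

/-! ### The Erdős–Rényi law as percolation on the complete graph -/

section Bridge

variable {n : ℕ}

lemma adj_fromEdgeSet {X : Finset (Sym2 (Fin n))} (hX : Loopless X) {x y : Fin n} :
    (SimpleGraph.fromEdgeSet (X : Set (Sym2 (Fin n)))).Adj x y ↔ s(x, y) ∈ X := by
  rw [SimpleGraph.fromEdgeSet_adj, Finset.mem_coe]
  exact ⟨fun h => h.1, fun h => ⟨h, hX.ne h⟩⟩

lemma verticesInTriangles_fromEdgeSet {X : Finset (Sym2 (Fin n))} (hX : Loopless X) :
    verticesInTriangles (SimpleGraph.fromEdgeSet (X : Set (Sym2 (Fin n)))) =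
      (triangleVerts X).card := by
  rw [verticesInTriangles, ← Set.ncard_coe_finset]
  congr 1
  ext v
  simp only [adj_fromEdgeSet hX, Finset.mem_coe, mem_triangleVerts]
  rfl

lemma edgeSet_fromEdgeSet_of_loopless {X : Finset (Sym2 (Fin n))} (hX : Loopless X) :
    (SimpleGraph.fromEdgeSet (X : Set (Sym2 (Fin n)))).edgeSet = X := by
  ext e
  induction e using Sym2.ind with
  | _ x y => rw [SimpleGraph.mem_edgeSet, adj_fromEdgeSet hX, Finset.mem_coe]

lemma numEdges_fromEdgeSet {X : Finset (Sym2 (Fin n))} (hX : Loopless X) :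
    numEdges (SimpleGraph.fromEdgeSet (X : Set (Sym2 (Fin n)))) = X.card := by
  rw [numEdges, edgeSet_fromEdgeSet_of_loopless hX, Set.ncard_coe_finset]

lemma edgeProb_coe {lam : ℝ} (hlam : 0 ≤ lam) (hn : lam ≤ n) :
    (edgeProb lam n : ℝ) = lam / n := by
  have h : lam / n ∈ Set.Icc (0 : ℝ) 1 :=
    ⟨by positivity, div_le_one_of_le₀ hn (Nat.cast_nonneg n)⟩
  rw [edgeProb, Set.projIcc_of_mem zero_le_one h]

lemma erLaw_real_singleton {lam : ℝ} (hlam : 0 ≤ lam) (hn : lam ≤ n)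
    {X : Finset (Sym2 (Fin n))} (hX : Loopless X) :
    (erLaw lam n).real {SimpleGraph.fromEdgeSet (X : Set (Sym2 (Fin n)))} =
      percWeight (lam / n) (allEdges (Fin n)) X := by
  rw [measureReal_def, erLaw, SimpleGraph.binomialRandom_singleton,
    edgeSet_fromEdgeSet_of_loopless hX, Set.ncard_coe_finset, percWeight, card_allEdges,
    ← edgeProb_coe hlam hn]
  simp

/-- Sums over graphs are sums over loopless edge sets. -/
lemma sum_erLaw_real_mul {lam : ℝ} (hlam : 0 ≤ lam) (hn : lam ≤ n)
    (F : SimpleGraph (Fin n) → ℝ) :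
    ∑ G, (erLaw lam n).real {G} * F G = ∑ X ∈ (allEdges (Fin n)).powerset,
      percWeight (lam / n) (allEdges (Fin n)) X * F (SimpleGraph.fromEdgeSet (X : Set _)) := by
  symm
  refine Finset.sum_bij' (fun X _ => SimpleGraph.fromEdgeSet (X : Set (Sym2 (Fin n))))
    (fun G _ => G.edgeFinset) (fun X _ => Finset.mem_univ _) ?_ ?_ ?_ ?_
  · intro G _
    rw [Finset.mem_powerset, subset_allEdges_iff]
    intro e he
    exact G.not_isDiag_of_mem_edgeFinset he
  · intro X hX
    have hX := subset_allEdges_iff.1 (Finset.mem_powerset.1 hX)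
    apply Finset.coe_injective
    rw [SimpleGraph.coe_edgeFinset, edgeSet_fromEdgeSet_of_loopless hX]
  · intro G _
    simp
  · intro X hX
    have hX := subset_allEdges_iff.1 (Finset.mem_powerset.1 hX)
    rw [erLaw_real_singleton hlam hn hX]

instance instIsProbabilityMeasureErLaw (lam : ℝ) (n : ℕ) :
    IsProbabilityMeasure (erLaw lam n) := by
  unfold erLaw; infer_instance

instance instMeasurableSingletonClassSimpleGraph :
    MeasurableSingletonClass (SimpleGraph (Fin n)) where
  measurableSet_singleton G := by
    have h : {G} = SimpleGraph.edgeSet ⁻¹' {G.edgeSet} := by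
      ext G'; simp
    rw [h]
    exact SimpleGraph.measurable_edgeSet (measurableSet_singleton _)

lemma erLaw_real_setOf {lam : ℝ} (hlam : 0 ≤ lam) (hn : lam ≤ n)
    (Q : SimpleGraph (Fin n) → Prop) :
    (erLaw lam n).real {G | Q G} = percProb (lam / n) (allEdges (Fin n))
      (fun X => Q (SimpleGraph.fromEdgeSet (X : Set _))) := by
  have h1 := sum_measureReal_singleton (μ := erLaw lam n) (Finset.univ.filter Q)
  have h2 : ((Finset.univ.filter Q : Finset (SimpleGraph (Fin n))) : Set _) = {G | Q G} := by
    ext; simp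
  rw [h2] at h1
  rw [← h1, Finset.sum_filter, percProb]
  have h3 := sum_erLaw_real_mul hlam hn (fun G => if Q G then 1 else 0)
  simpa using h3

/-- The total weight of the graphs satisfying `Q`, organised by the number of triangle
vertices. -/
lemma sum_filter_erLaw_real_mul_weight (lam : ℝ) (g : ℝ → ℝ) (Q : SimpleGraph (Fin n) → Prop) :
    ∑ G with Q G, (erLaw lam n).real {G} * weight g n G =
      ∑ k ∈ Finset.range (n + 1), (erLaw lam n).real {G | verticesInTriangles G = k ∧ Q G} *
        Real.exp (n * Real.log n * g ((k : ℝ) / n)) := by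
  have hmaps : ∀ G ∈ (Finset.univ.filter Q : Finset (SimpleGraph (Fin n))),
      verticesInTriangles G ∈ Finset.range (n + 1) := by
    intro G _
    rw [Finset.mem_range, Nat.lt_succ_iff, verticesInTriangles]
    simpa using Set.ncard_le_card
      {v : Fin n | ∃ u w : Fin n, G.Adj v u ∧ G.Adj u w ∧ G.Adj w v}
  rw [← Finset.sum_fiberwise_of_maps_to hmaps]
  refine Finset.sum_congr rfl fun k _ => ?_
  have h1 := sum_measureReal_singleton (μ := erLaw lam n)
    ((Finset.univ.filter Q).filter fun G => verticesInTriangles G = k)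
  have h2 : (((Finset.univ.filter Q).filter fun G => verticesInTriangles G = k :
      Finset (SimpleGraph (Fin n))) : Set _) = {G | verticesInTriangles G = k ∧ Q G} := by
    ext; simp [and_comm]
  rw [h2] at h1
  rw [← h1, Finset.sum_mul]
  refine Finset.sum_congr rfl fun G hG => ?_
  rw [weight, (Finset.mem_filter.1 hG).2]

lemma partitionFunction_eq_sum (lam : ℝ) (g : ℝ → ℝ) (n : ℕ) :
    partitionFunction lam g n =
      ∑ k ∈ Finset.range (n + 1), (erLaw lam n).real {G | verticesInTriangles G = k} *
        Real.exp (n * Real.log n * g ((k : ℝ) / n)) := by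
  have h := sum_filter_erLaw_real_mul_weight (n := n) lam g (fun _ => True)
  simp only [and_true, Finset.filter_true] at h
  rw [← h, partitionFunction, integral_fintype .of_finite]
  simp [smul_eq_mul]

lemma ergmLaw_setOf (lam : ℝ) (g : ℝ → ℝ) (n : ℕ) (Q : SimpleGraph (Fin n) → Prop) :
    ergmLaw lam g n {G | Q G} = ENNReal.ofReal
      ((∑ k ∈ Finset.range (n + 1), (erLaw lam n).real {G | verticesInTriangles G = k ∧ Q G} *
        Real.exp (n * Real.log n * g ((k : ℝ) / n))) / partitionFunction lam g n) := by
  have hZ : 0 ≤ partitionFunction lam g n :=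
    integral_nonneg fun G => (Real.exp_pos _).le
  have hw : ∀ G, 0 ≤ weight g n G := fun G => (Real.exp_pos _).le
  rw [← sum_filter_erLaw_real_mul_weight, ergmLaw,
    withDensity_apply _ (Set.toFinite _).measurableSet,
    ← lintegral_indicator (Set.toFinite _).measurableSet, lintegral_fintype, Finset.sum_div,
    ENNReal.ofReal_sum_of_nonneg fun G _ => div_nonneg
      (mul_nonneg measureReal_nonneg (hw G)) hZ, Finset.sum_filter]
  refine Finset.sum_congr rfl fun G _ => ?_
  by_cases hG : Q G
  · have h0 : 0 ≤ weight g n G / partitionFunction lam g n :=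
      div_nonneg (Real.exp_pos _).le hZ
    simp only [Set.indicator, Set.mem_ofPred_eq, hG, if_true]
    rw [mul_div_assoc, mul_comm, ENNReal.ofReal_mul measureReal_nonneg, ofReal_measureReal]
  · simp [Set.indicator, hG]

end Bridge

/-! ### From the Erdős–Rényi law to the exponential random graph -/

section ErdosRenyi

variable {lam a : ℝ}

lemma erLaw_real_eq_percProb {n : ℕ} (hlam : 0 ≤ lam) (hn : lam ≤ n) (k : ℕ) (Q : ℕ → Prop) :
    (erLaw lam n).real {G | verticesInTriangles G = k ∧ Q (numEdges G)} =
      percProb (lam / n) (allEdges (Fin n)) (fun X => (triangleVerts X).card = k ∧ Q X.card) := by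
  rw [erLaw_real_setOf hlam hn]
  refine percProb_congr fun X hX => ?_
  rw [verticesInTriangles_fromEdgeSet (subset_allEdges_iff.1 hX),
    numEdges_fromEdgeSet (subset_allEdges_iff.1 hX)]

lemma erLaw_real_verticesInTriangles_eq {n : ℕ} (hlam : 0 ≤ lam) (hn : lam ≤ n) (k : ℕ) :
    (erLaw lam n).real {G | verticesInTriangles G = k} =
      percProb (lam / n) (allEdges (Fin n)) (fun X => (triangleVerts X).card = k) := by
  simpa using erLaw_real_eq_percProb hlam hn k (fun _ => True)

lemma eventually_erLaw_real_le (hlam : 0 < lam) :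
    ∀ᶠ n : ℕ in atTop, ∀ k ≤ n, (erLaw lam n).real {G | verticesInTriangles G = k} ≤
      Real.exp ((24 * lam ^ 2 + lam + 6) * n - k / 3 * Real.log n) := by
  filter_upwards [eventually_ge_atTop 1, tendsto_natCast_atTop_atTop.eventually_ge_atTop lam]
    with n h1 h2 k _
  have hn0 : (0 : ℝ) < n := by exact_mod_cast h1
  rw [erLaw_real_verticesInTriangles_eq hlam.le h2]
  have := percProb_card_triangleVerts_le (p := lam / n) (lam := lam) (by positivity)
    (by rw [div_le_one hn0]; exact h2) (by rw [Fintype.card_fin]; omega)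
    (by rw [Fintype.card_fin]) (loopless_allEdges (V := Fin n)) k 0
  simpa using this

lemma exists_eventually_le_erLaw_real (hlam : 0 < lam) (ha : 0 < a) :
    ∃ C : ℝ, ∀ᶠ n : ℕ in atTop, ∀ k : ℕ, a * n ≤ k → k ≤ n →
      Real.exp (-C * n - k / 3 * Real.log n) ≤
        (erLaw lam n).real {G | verticesInTriangles G = k} := by
  obtain ⟨C, hC⟩ := exists_percProb_card_triangleVerts_ge hlam ha
  refine ⟨C, ?_⟩
  filter_upwards [hC, tendsto_natCast_atTop_atTop.eventually_ge_atTop lam] with n h1 h2 k hk hkn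
  rw [erLaw_real_verticesInTriangles_eq hlam.le h2]
  exact h1 k hk hkn

lemma tendsto_log_partitionFunction (hlam : 0 < lam) (ha0 : 0 < a) {g : ℝ → ℝ}
    (hg : ContinuousOn g (Set.Icc 0 1)) (ha : a ∈ Set.Icc (0 : ℝ) 1)
    (hamax : IsMaxOn (fun x => g x - x / 3) (Set.Icc 0 1) a) :
    Tendsto (fun n : ℕ => 1 / ((n : ℝ) * Real.log n) * Real.log (partitionFunction lam g n))
      atTop (𝓝 (g a - a / 3)) := by
  obtain ⟨C, hL⟩ := exists_eventually_le_erLaw_real hlam ha0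
  simp only [partitionFunction_eq_sum]
  exact tendsto_log_sum_mul_exp (fun _ _ => measureReal_nonneg) (eventually_erLaw_real_le hlam) hL
    hg ha hamax

/-- The weight of the graphs whose proportion of triangle vertices is away from `a` is a
negligible part of the partition function. -/
lemma tendsto_sum_filter_div_partitionFunction (hlam : 0 < lam) (ha0 : 0 < a) {g : ℝ → ℝ}
    (hg : ContinuousOn g (Set.Icc 0 1)) (ha : a ∈ Set.Icc (0 : ℝ) 1)
    (hamax : IsMaxOn (fun x => g x - x / 3) (Set.Icc 0 1) a)
    (huniq : ∀ b ∈ Set.Icc (0 : ℝ) 1, IsMaxOn (fun x => g x - x / 3) (Set.Icc 0 1) b → b = a)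
    {η : ℝ} (hη : 0 < η) :
    Tendsto (fun n : ℕ =>
      (∑ k ∈ (Finset.range (n + 1)).filter fun k : ℕ => η ≤ |(k : ℝ) / n - a|,
        (erLaw lam n).real {G | verticesInTriangles G = k} *
          Real.exp (n * Real.log n * g ((k : ℝ) / n))) / partitionFunction lam g n)
      atTop (𝓝 0) := by
  obtain ⟨C, hL⟩ := exists_eventually_le_erLaw_real hlam ha0
  simp only [partitionFunction_eq_sum]
  exact tendsto_sum_filter_div (fun _ _ => measureReal_nonneg) (eventually_erLaw_real_le hlam) hL
    hg ha hamax huniq hη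

lemma tendstoInProbability_verticesInTriangles (hlam : 0 < lam) (ha0 : 0 < a) {g : ℝ → ℝ}
    (hg : ContinuousOn g (Set.Icc 0 1)) (ha : a ∈ Set.Icc (0 : ℝ) 1)
    (hamax : IsMaxOn (fun x => g x - x / 3) (Set.Icc 0 1) a)
    (huniq : ∀ b ∈ Set.Icc (0 : ℝ) 1, IsMaxOn (fun x => g x - x / 3) (Set.Icc 0 1) b → b = a) :
    TendstoInProbability (ergmLaw lam g) (fun n G => (verticesInTriangles G : ℝ) / n) a := by
  intro ε hε
  have h1 := ENNReal.tendsto_ofReal 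
    (tendsto_sum_filter_div_partitionFunction hlam ha0 hg ha hamax huniq hε)
  rw [ENNReal.ofReal_zero] at h1
  refine h1.congr fun n => ?_
  rw [ergmLaw_setOf, Finset.sum_filter]
  congr 2
  refine Finset.sum_congr rfl fun k _ => ?_
  split_ifs with hk
  · congr 2
    ext G
    simp only [Set.mem_ofPred_eq]
    exact ⟨fun h => ⟨h, by rw [h]; exact hk⟩, fun h => h.1⟩
  · have : {G : SimpleGraph (Fin n) | verticesInTriangles G = k ∧
        ε ≤ |(verticesInTriangles G : ℝ) / n - a|} = ∅ := by
      ext G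
      simp only [Set.mem_ofPred_eq, Set.mem_empty_iff_false, iff_false]
      rintro ⟨rfl, h⟩
      exact hk h
    rw [this]
    simp

lemma tendstoInProbability_numEdges (hlam : 0 < lam) (ha0 : 0 < a) {g : ℝ → ℝ}
    (hg : ContinuousOn g (Set.Icc 0 1)) (ha : a ∈ Set.Icc (0 : ℝ) 1)
    (hamax : IsMaxOn (fun x => g x - x / 3) (Set.Icc 0 1) a)
    (huniq : ∀ b ∈ Set.Icc (0 : ℝ) 1, IsMaxOn (fun x => g x - x / 3) (Set.Icc 0 1) b → b = a) :
    TendstoInProbability (ergmLaw lam g) (fun n G => (numEdges G : ℝ) / n) (a + lam / 2) := by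
  intro ε hε
  have hP : ∀ n k : ℕ, 0 ≤ (erLaw lam n).real {G | verticesInTriangles G = k} :=
    fun _ _ => measureReal_nonneg
  obtain ⟨η, hη, ρ, hρ, hdev⟩ := exists_percProb_edge_deviation_le hlam ha0 hε
  have h1 : Tendsto (fun n : ℕ => ENNReal.ofReal
      ((∑ k ∈ (Finset.range (n + 1)).filter fun k : ℕ => η ≤ |(k : ℝ) / n - a|,
        (erLaw lam n).real {G | verticesInTriangles G = k} *
          Real.exp (n * Real.log n * g ((k : ℝ) / n))) / partitionFunction lam g n + |ρ n|))
      atTop (𝓝 0) := by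
    have := ENNReal.tendsto_ofReal ((tendsto_sum_filter_div_partitionFunction hlam ha0 hg ha hamax
      huniq hη).add hρ.abs)
    simpa using this
  refine tendsto_of_tendsto_of_tendsto_of_le_of_le' tendsto_const_nhds h1
    (Eventually.of_forall fun _ => zero_le) ?_
  filter_upwards [hdev, tendsto_natCast_atTop_atTop.eventually_ge_atTop lam] with n h2 h3
  rw [ergmLaw_setOf]
  refine ENNReal.ofReal_le_ofReal ?_
  have hZ : 0 ≤ partitionFunction lam g n := integral_nonneg fun G => (Real.exp_pos _).le
  have h4 : ∑ k ∈ Finset.range (n + 1), (erLaw lam n).real {G | verticesInTriangles G = k ∧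
        ε ≤ |(numEdges G : ℝ) / n - (a + lam / 2)|} *
          Real.exp (n * Real.log n * g ((k : ℝ) / n)) ≤
      (∑ k ∈ (Finset.range (n + 1)).filter fun k : ℕ => η ≤ |(k : ℝ) / n - a|,
        (erLaw lam n).real {G | verticesInTriangles G = k} *
          Real.exp (n * Real.log n * g ((k : ℝ) / n))) + |ρ n| * partitionFunction lam g n := by
    rw [partitionFunction_eq_sum, Finset.mul_sum, Finset.sum_filter, ← Finset.sum_add_distrib]
    refine Finset.sum_le_sum fun k hk => ?_
    have hw := Real.exp_pos (n * Real.log n * g ((k : ℝ) / n))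
    split_ifs with hkη
    · have h5 : (erLaw lam n).real {G | verticesInTriangles G = k ∧
          ε ≤ |(numEdges G : ℝ) / n - (a + lam / 2)|} ≤
          (erLaw lam n).real {G | verticesInTriangles G = k} :=
        measureReal_mono fun G hG => hG.1
      have h6 : 0 ≤ |ρ n| * ((erLaw lam n).real {G | verticesInTriangles G = k} *
          Real.exp (n * Real.log n * g ((k : ℝ) / n))) :=
        mul_nonneg (abs_nonneg _) (mul_nonneg (hP n k) hw.le)
      have h7 := mul_le_mul_of_nonneg_right h5 hw.le
      linarith
    · have h5 := h2 k (Nat.lt_succ_iff.1 (Finset.mem_range.1 hk)) (not_le.1 hkη)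
      rw [← erLaw_real_verticesInTriangles_eq hlam.le h3,
        ← erLaw_real_eq_percProb hlam.le h3 k
          (fun m => ε ≤ |(m : ℝ) / n - (a + lam / 2)|)] at h5
      have h6 := h5.trans (mul_le_mul_of_nonneg_right (le_abs_self (ρ n)) (hP n k))
      rw [zero_add, ← mul_assoc]
      exact mul_le_mul_of_nonneg_right h6 hw.le
  refine (div_le_div_of_nonneg_right h4 hZ).trans ?_
  rw [add_div, mul_div_assoc]
  have := mul_le_mul_of_nonneg_left (div_self_le_one (partitionFunction lam g n))
    (abs_nonneg (ρ n))
  linarith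

end ErdosRenyi

end TriangleERGM

theorem theorem3p2 (lam : ℝ) (hlam : 0 < lam) (g : ℝ → ℝ)
    (hg : ContinuousOn g (Set.Icc 0 1))
    (hmax : ∀ a ∈ Set.Icc (0 : ℝ) 1,
      IsMaxOn (fun x => g x - x / 3) (Set.Icc 0 1) a → a ∈ Set.Ioo (0 : ℝ) 1)
    (a : ℝ) (ha : a ∈ Set.Icc (0 : ℝ) 1)
    (hamax : IsMaxOn (fun x => g x - x / 3) (Set.Icc 0 1) a) :
    Tendsto (fun n : ℕ =>
        1 / ((n : ℝ) * Real.log n) * Real.log (TriangleERGM.partitionFunction lam g n))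
      atTop (𝓝 (g a - a / 3)) ∧
    ((∀ b ∈ Set.Icc (0 : ℝ) 1, IsMaxOn (fun x => g x - x / 3) (Set.Icc 0 1) b → b = a) →
      TriangleERGM.TendstoInProbability (TriangleERGM.ergmLaw lam g)
        (fun n G => (TriangleERGM.verticesInTriangles G : ℝ) / n) a ∧
      TriangleERGM.TendstoInProbability (TriangleERGM.ergmLaw lam g)
        (fun n G => (TriangleERGM.numEdges G : ℝ) / n) (a + lam / 2)) := by
  have ha0 : 0 < a := (hmax a ha hamax).1
  exact ⟨TriangleERGM.tendsto_log_partitionFunction hlam ha0 hg ha hamax, fun huniq =>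
    ⟨TriangleERGM.tendstoInProbability_verticesInTriangles hlam ha0 hg ha hamax huniq,
      TriangleERGM.tendstoInProbability_numEdges hlam ha0 hg ha hamax huniq⟩⟩
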